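/- **Setting.** Let $S$ be a finite nonempty set, $\mathbb H=\{-1,0,1\}$, and let $A_{i,j}$ ($i,j\in\mathbb H$) be nonnegative real $S\times S$ matrices whose sum $\sum_{i,j}A_{i,j}$ is stochastic. Assume that the Markov chain on $\mathbb Z^2\times S$ that moves from $(x_1,x_2,a)$ to $(x_1+i,x_2+j,b)$, $i,j\in\mathbb H$, with probability $[A_{i,j}]_{a,b}$ is irreducible and aperiodic. Put $$A_{*,j}(z)=\sum_{i\in\mathbb H}A_{i,j}z^i,\qquad C(z,w)=\sum_{i,j\in\mathbb H}A_{i,j}z^iw^j,\qquad L(z,w)=zA_{*,-1}(z)+z(A_{*,0}(z)-I)w+zA_{*,1}(z)w^2 ,$$ let $\chi(z,w)$ be the spectral radius of $C(z,w)$ for $z,w>0$, let $\bar\Gamma=\{(s_1,s_2)\in\mathbb R^2:\chi(e^{s_1},e^{s_2})\le 1\}$, and let $\underline z_1^*=\exp(\min_{\bar\Gamma}s_1)$, $\bar z_1^*=\exp(\max_{\bar\Gamma}s_1)$. For real $x$ with $\underline z_1^*<x<\bar z_1^*$ let $\underline\zeta_2(x)$ and $\bar\zeta_2(x)$ be the smallest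 and the largest positive solution $w$ of $\chi(x,w)=1$. For $\underline z_1^*\le|z|\le\bar z_1^*$ let $$G_1(z)=\sum_{n\ge1}\ \sum_{(i_1,\dots,i_n)}A_{*,i_1}(z)A_{*,i_2}(z)\cdots A_{*,i_n}(z),$$ where the inner sum is over all $(i_1,\dots,i_n)\in\mathbb H^n$ with $i_1+\dots+i_k\ge0$ for $1\le k<n$ and $i_1+\dots+i_n=-1$. Assume that for some $z_0$ with $\underline z_1^*<|z_0|\le\bar z_1^*$ all eigenvalues of $G_1(z_0)$ are distinct. For $\delta>0$ let $D_\delta=\{z\in\mathbb{C}:|z-\bar z_1^*|<\delta,\ z\notin[\bar z_1^*,\infty)\}$, and for $z\in D_\delta$ let $(\bar z_1^*-z)^{1/2}$ be the principal square root. **Statement.** There are $r>0$, an open set $U\subset\mathbb C$ that contains $D_{r^2}$ and all $z\ne\bar z_1^*$ with $\underline z_1^*<|z|\le\bar z_1^*$, and an entrywise analytic matrix function on $U$, again denoted by $G_1$, which agrees with the series at all $z\neq\bar z_1^*$ with $\underline z_1^*<|z|\le\bar z_1^*$ and satisfies on $U$ the equation $$A_{*,-1}(z)+A_{*,0}(z)X+A_{*,1}(z)X^2=X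 \qquad (X=G_1(z)).\tag{1}$$ In particular $G_1$ is analytic on the circle $|z|=\bar z_1^*$ except at $\bar z_1^*$. Moreover: 1. $\bar z_1^*$ is a branch point of order one of $G_1$: there is a matrix function $F$, entrywise analytic in $|\zeta|<r$, with $G_1(z)=F\big((\bar z_1^*-z)^{1/2}\big)$ for $z\in D_{r^2}$ and $F(-\zeta)\not\equiv F(\zeta)$; and $F(0)$ is the value $G_1(\bar z_1^*)$ of the series. 2. Companion solution: let $\alpha_{s_0}$ and $\alpha_{s_0+1}$ denote the analytic functions on $D_{r^2}$ which equal $\underline\zeta_2$ and $\bar\zeta_2$, respectively, at the real points $x\in D_{r^2}$ with $\underline z_1^*<x<\bar z_1^*$. They exist, and for each $z\in D_{r^2}$ there are a left eigenvector $\boldsymbol u_{s_0}(z)\neq 0$ of $G_1(z)$ for the eigenvalue $\alpha_{s_0}(z)$ and a column vector $\boldsymbol v_{s_0+1}(z)$ with $L(z,\alpha_{s_0+1}(z))\boldsymbol v_{s_0+1}(z)=\boldsymbol 0$ and $\boldsymbol u_{s_0}(z)\boldsymbol v_{s_0+1}(z)=1$. For every such choice the matrix function $$G_1^{co}(z)=G_1(z)+\big(\alpha_{s_0+1}(z)I-G_1(z)\big)\boldsymbol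 v_{s_0+1}(z)\boldsymbol u_{s_0}(z)$$ satisfies the same equation (1) on $D_{r^2}$, it is the other branch, $G_1^{co}(z)=F\big(-(\bar z_1^*-z)^{1/2}\big)$ for $z\in D_{r^2}$, and it coalesces with $G_1$ at $\bar z_1^*$: both $G_1(z)$ and $G_1^{co}(z)$ tend to $G_1(\bar z_1^*)$ as $D_{r^2}\ni z\to\bar z_1^*$. -/

import Mathlib

open scoped Topology

noncomputable section

namespace QBD

/-- The set of increments `{-1, 0, 1}`. -/
def H : Finset ℤ := {-1, 0, 1}

/-! ### Irreducibility and aperiodicity of a countable Markov chain -/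

/-- `y` is reached from `x` in exactly `n` steps with positive probability, for a chain with
nonnegative transition probabilities `p`: there is a path of length `n` all of whose one-step
probabilities are positive. -/
def Reaches {X : Type*} (p : X → X → ℝ) : ℕ → X → X → Prop
  | 0, x, y => x = y
  | n + 1, x, y => ∃ t, 0 < p x t ∧ Reaches p n t y

/-- Irreducibility: any two states communicate. -/
def ChainIrreducible {X : Type*} (p : X → X → ℝ) : Prop :=
  ∀ x y, ∃ n, Reaches p n x y

/-- Aperiodicity: for every state the greatest common divisor of the possible return times is
one. -/
def ChainAperiodic {X : Type*} (p : X → X → ℝ) : Prop :=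
  ∀ x, ∀ d : ℕ, (∀ n, Reaches p n x x → d ∣ n) → d = 1

section Model

variable {S : Type*} [Fintype S] [DecidableEq S]

/-- Transition probabilities, on `ℤ × ℤ × S`, of the Markov chain generated by the blocks
`A k l`, `k, l ∈ {-1, 0, 1}` (only these blocks are ever used). -/
def transition (A : ℤ → ℤ → Matrix S S ℝ) (x y : ℤ × ℤ × S) : ℝ :=
  if y.1 - x.1 ∈ H ∧ y.2.1 - x.2.1 ∈ H then
    A (y.1 - x.1) (y.2.1 - x.2.1) x.2.2 y.2.2
  else 0

/-- The sum of all blocks. -/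
def total (A : ℤ → ℤ → Matrix S S ℝ) : Matrix S S ℝ := ∑ i ∈ H, ∑ j ∈ H, A i j

/-- `A_{*,j}(z) = ∑_{i ∈ H} A_{i,j} z^i`. -/
def Astar (A : ℤ → ℤ → Matrix S S ℝ) (j : ℤ) (z : ℂ) : Matrix S S ℂ :=
  ∑ i ∈ H, z ^ i • (A i j).map (fun a : ℝ => (a : ℂ))

/-- `C(z,w) = ∑_{i,j ∈ H} A_{i,j} z^i w^j`. -/
def Cmat (A : ℤ → ℤ → Matrix S S ℝ) (z w : ℂ) : Matrix S S ℂ :=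
  ∑ i ∈ H, ∑ j ∈ H, (z ^ i * w ^ j) • (A i j).map (fun a : ℝ => (a : ℂ))

/-- The spectral radius of a complex matrix, as a real number. -/
def spr (M : Matrix S S ℂ) : ℝ := (spectralRadius ℂ M).toReal

/-- `χ(z,w) = spr (C(z,w))` for real `z, w` (used only for positive `z, w`). -/
def chi (A : ℤ → ℤ → Matrix S S ℝ) (z w : ℝ) : ℝ := spr (Cmat A (z : ℂ) (w : ℂ))

/-- The set `Γ̄ = {(s₁,s₂) : χ(exp s₁, exp s₂) ≤ 1}`. -/
def Gam (A : ℤ → ℤ → Matrix S S ℝ) : Set (ℝ × ℝ) :=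
  {s | chi A (Real.exp s.1) (Real.exp s.2) ≤ 1}

/-- The lower extreme point `exp (min_{Γ̄} s₁)`. -/
def zLow (A : ℤ → ℤ → Matrix S S ℝ) : ℝ := Real.exp (sInf (Prod.fst '' Gam A))

/-- The upper extreme point `exp (max_{Γ̄} s₁)`. -/
def zBar (A : ℤ → ℤ → Matrix S S ℝ) : ℝ := Real.exp (sSup (Prod.fst '' Gam A))

/-- The smallest positive solution `w` of `χ(x,w) = 1`. -/
def zetaLow (A : ℤ → ℤ → Matrix S S ℝ) (x : ℝ) : ℝ := sInf {w | 0 < w ∧ chi A x w = 1}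

/-- The largest positive solution `w` of `χ(x,w) = 1`. -/
def zetaHigh (A : ℤ → ℤ → Matrix S S ℝ) (x : ℝ) : ℝ := sSup {w | 0 < w ∧ chi A x w = 1}

/-- The index sequences of length `n` in `{-1,0,1}` whose proper nonempty partial sums are
nonnegative and whose total sum is `-1` (first passage one level down at time `n`). -/
def downSeqs (n : ℕ) : Finset (Fin n → ℤ) :=
  open Classical in
  (Fintype.piFinset (fun _ : Fin n => H)).filter (fun i =>
    (∀ k : ℕ, 1 ≤ k → k < n → 0 ≤ ∑ l : Fin n, if (l : ℕ) < k then i l else 0) ∧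
      ∑ l : Fin n, i l = -1)

/-- `D₁⁽ⁿ⁾(z)`: the sum of the ordered products `A_{*,i₁}(z) ⋯ A_{*,iₙ}(z)` over `downSeqs n`. -/
def D1 (A : ℤ → ℤ → Matrix S S ℝ) (n : ℕ) (z : ℂ) : Matrix S S ℂ :=
  ∑ i ∈ downSeqs n, (List.ofFn (fun l : Fin n => Astar A (i l) z)).prod

/-- `G₁(z) = ∑_{n ≥ 1} D₁⁽ⁿ⁾(z)`. -/
def G1 (A : ℤ → ℤ → Matrix S S ℝ) (z : ℂ) : Matrix S S ℂ := ∑' n : ℕ, D1 A (n + 1) z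

/-- `X` solves `A_{*,-1}(z) + A_{*,0}(z) X + A_{*,1}(z) X² = X`. -/
def SolvesQuadratic (A : ℤ → ℤ → Matrix S S ℝ) (z : ℂ) (X : Matrix S S ℂ) : Prop :=
  Astar A (-1) z + Astar A 0 z * X + Astar A 1 z * X ^ 2 = X

/-- `L(z,w) = z w (C(z,w) - I)`, in its polynomial form
`z A_{*,-1}(z) + z (A_{*,0}(z) - I) w + z A_{*,1}(z) w²`. -/
def Lmat (A : ℤ → ℤ → Matrix S S ℝ) (z w : ℂ) : Matrix S S ℂ :=
  z • Astar A (-1) z + (z * w) • (Astar A 0 z - 1) + (z * w ^ 2) • Astar A 1 z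

/-! ### Branch points -/

/-- The disc of center `p` and radius `δ`, slit along `[p, p + δ)`. -/
def slitDisc (p : ℂ) (δ : ℝ) : Set ℂ := {z | z ∈ Metric.ball p δ ∧ p - z ∈ Complex.slitPlane}

/-- The principal value of `(p - z)^{1/(ν+1)}`, analytic off the slit. -/
def rootAt (ν : ℕ) (p z : ℂ) : ℂ := (p - z) ^ (1 / ((ν : ℂ) + 1))

/-- `p` is an algebraic branch point of order `ν ≥ 1` of the matrix function `f`, given on the slit
disc of center `p` and radius `r ^ (ν + 1)`, and `f` stays finite at `p`; this is witnessed by `F`: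
`F` is entrywise analytic near the origin, `f z = F ((p - z)^{1/(ν+1)})`, and the `ν + 1`
determinations `F (ω (p - z)^{1/(ν+1)})`, `ω ^ (ν + 1) = 1`, obtained by continuing `f` around `p`
are distinct from `f`, so that exactly `ν + 1` turns are needed to return to `f`. -/
structure IsBranchPoint (ν : ℕ) (f : ℂ → Matrix S S ℂ) (p : ℂ) (r : ℝ)
    (F : ℂ → Matrix S S ℂ) : Prop where
  order_pos : 1 ≤ ν
  radius_pos : 0 < r
  analytic : ∀ i j, AnalyticOnNhd ℂ (fun ζ => F ζ i j) (Metric.ball 0 r)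
  eq_comp : ∀ z ∈ slitDisc p (r ^ (ν + 1)), f z = F (rootAt ν p z)
  distinct : ∀ ω : ℂ, ω ^ (ν + 1) = 1 → ω ≠ 1 → ∃ ζ ∈ Metric.ball (0 : ℂ) r, F (ω * ζ) ≠ F ζ

/-! ### The companion solution -/

/-- `Gco` is the companion of `G` on the slit disc of center `zBar A` and radius `δ`:
`α` (resp. `β`) is the analytic continuation to this connected domain of `zetaLow A`
(resp. `zetaHigh A`) on the real interval just to the left of `zBar A`; `u z` is a left eigenvector
of `G z` for the eigenvalue `α z`; `v z` is in the kernel of `L(z, β z)`, normalized by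
`u z * v z = 1`; and `Gco = G + (β I - G) v u`. -/
def IsCompanion (A : ℤ → ℤ → Matrix S S ℝ) (δ : ℝ) (G Gco : ℂ → Matrix S S ℂ) : Prop :=
  ∃ (α β : ℂ → ℂ) (u v : ℂ → S → ℂ),
    AnalyticOnNhd ℂ α (slitDisc (zBar A) δ) ∧
    AnalyticOnNhd ℂ β (slitDisc (zBar A) δ) ∧
    (∀ x : ℝ, (x : ℂ) ∈ slitDisc (zBar A) δ → zLow A < x →
      α x = (zetaLow A x : ℂ) ∧ β x = (zetaHigh A x : ℂ)) ∧
    ∀ z ∈ slitDisc (zBar A) δ,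
      u z ≠ 0 ∧ Matrix.vecMul (u z) (G z) = α z • u z ∧
      (Lmat A z (β z)).mulVec (v z) = 0 ∧
      u z ⬝ᵥ v z = 1 ∧
      Gco z = G z + (β z • (1 : Matrix S S ℂ) - G z) * Matrix.vecMulVec (v z) (u z)

end Model

end QBD

end

/-! At the right end of `Γ̄` the curve `χ = 1` has a vertical tangent: the mean vertical drift
vanishes (`drift₂_eq_zero`), the horizontal drift is positive (`exists_extremal`) and the second
variation is strictly positive (`second_variation_pos`). The two solutions `w` of `χ(x,w) = 1`
therefore meet there like the two values of a square root. With `z = zBar - ζ²` they become one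
analytic function `w ζ`, with an analytic kernel vector `v ζ` of `L`, and the two solutions are
exchanged by `ζ ↦ -ζ` (`exists_branches`).

Only the Perron eigenvalue of `G₁` carries this singularity. The linearization of equation (1) at
`G₁(zBar)` is injective on matrices that kill the Perron vector (`IsBranchPair.linearized_eq_zero`),
so once the eigenpair `(w ζ, v ζ)` is prescribed, the implicit function theorem, applied to (1) with
a rank-one correction, gives a locally unique analytic solution `F ζ` (`exists_solutionBranch`). For
small `ζ > 0` it is `G₁`, whose Perron value is `zetaLow` by `greal_mulVec_eq`. On the other side `F
(-ζ)` has the eigenvalue `zetaHigh`, beyond the spectral radius of `G₁`, so the two determinations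
differ. The companion exchanges the eigenvalue `zetaLow` for `zetaHigh`, still solves (1) and stays
close to `G₁(zBar)`; local uniqueness identifies it with `F (-ζ)`.

At the other points of the circle, irreducibility prevents the phases in the path sums from
aligning, so large powers of `G₁(z)` are strictly dominated by those of `G₁(zBar)` (`norm_pow_lt`).
The full linearization is then injective, and `G₁` continues across the circle. The local
continuations are glued along radial segments (`exists_glued`).

Both injectivity statements rest on `linearized_eq_zero`. If `X = U X + B X G` and `π` is a positive
left fixed vector of the dominating matrix `U + w B`, then `π B` applied to the weighted row norms
of `X Gⁿ` grows at least like `wⁿ`. A contraction of some power of `G` on the rows of `X`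
contradicts this unless it vanishes, and transience of `U` then gives `X = 0`. -/

set_option linter.unusedSectionVars false

noncomputable section

namespace QBD

open scoped Matrix Topology

/-! ### Perron–Frobenius theory for irreducible nonnegative matrices -/

section NonnegMatrix
variable {S : Type*} [Fintype S] [DecidableEq S]

/-- Irreducibility of a nonnegative matrix: some power of `1 + M` is positive. -/
def Irred (M : Matrix S S ℝ) : Prop := ∃ N : ℕ, ∀ a b, 0 < ((1 + M) ^ N) a b

lemma mulVec_mono {M : Matrix S S ℝ} (hM : ∀ a b, 0 ≤ M a b) {x y : S → ℝ} (h : x ≤ y) :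
    M *ᵥ x ≤ M *ᵥ y := fun a =>
  Finset.sum_le_sum fun b _ => mul_le_mul_of_nonneg_left (h b) (hM a b)

lemma mulVec_nonneg' {M : Matrix S S ℝ} (hM : ∀ a b, 0 ≤ M a b) {x : S → ℝ} (h : 0 ≤ x) :
    0 ≤ M *ᵥ x := fun a => Finset.sum_nonneg fun b _ => mul_nonneg (hM a b) (h b)

lemma mulVec_pos' [Nonempty S] {M : Matrix S S ℝ} (hM : ∀ a b, 0 < M a b) {x : S → ℝ} (h : 0 ≤ x)
    (hx : x ≠ 0) (a : S) : 0 < (M *ᵥ x) a := by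
  obtain ⟨b, hb⟩ := Function.ne_iff.mp hx
  exact Finset.sum_pos' (fun b _ => mul_nonneg (hM a b).le (h b))
    ⟨b, Finset.mem_univ _, mul_pos (hM a b) (lt_of_le_of_ne (h b) (Ne.symm hb))⟩

lemma one_add_nonneg {M : Matrix S S ℝ} (hM : ∀ a b, 0 ≤ M a b) (a b : S) :
    0 ≤ (1 + M) a b := by
  rw [Matrix.add_apply, Matrix.one_apply]
  split_ifs
  · linarith [hM a b]
  · linarith [hM a b]

lemma pow_nonneg' {M : Matrix S S ℝ} (hM : ∀ a b, 0 ≤ M a b) (n : ℕ) (a b : S) :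
    0 ≤ (M ^ n) a b := by
  induction n generalizing a b with
  | zero => rw [pow_zero, Matrix.one_apply]; split_ifs <;> norm_num
  | succ n ih =>
    rw [pow_succ, Matrix.mul_apply]
    exact Finset.sum_nonneg fun c _ => mul_nonneg (ih a c) (hM c b)

lemma pow_mulVec_eq {M : Matrix S S ℝ} {v : S → ℝ} {c : ℝ} (h : M *ᵥ v = c • v) (n : ℕ) :
    (M ^ n) *ᵥ v = c ^ n • v := by
  induction n with
  | zero => simp
  | succ n ih => rw [pow_succ, ← Matrix.mulVec_mulVec, h, Matrix.mulVec_smul, ih, smul_smul, pow_succ,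
      mul_comm]

lemma pow_mulVec_le {M : Matrix S S ℝ} (hM : ∀ a b, 0 ≤ M a b) {v : S → ℝ} {c : ℝ} (hc : 0 ≤ c)
    (h : M *ᵥ v ≤ c • v) (n : ℕ) :
    (M ^ n) *ᵥ v ≤ c ^ n • v := by
  induction n with
  | zero => simp
  | succ n ih =>
    rw [pow_succ, ← Matrix.mulVec_mulVec]
    refine (mulVec_mono (pow_nonneg' hM n) h).trans ?_
    rw [Matrix.mulVec_smul, pow_succ, mul_comm, ← smul_smul]
    exact smul_le_smul_of_nonneg_left ih hc

lemma irred_transpose {M : Matrix S S ℝ} (h : Irred M) : Irred Mᵀ := by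
  obtain ⟨N, hN⟩ := h
  refine ⟨N, fun a b => ?_⟩
  have : (1 + Mᵀ) ^ N = ((1 + M) ^ N)ᵀ := by
    rw [Matrix.transpose_pow, Matrix.transpose_add, Matrix.transpose_one]
  rw [this]; exact hN b a

/-- A nonzero nonnegative subinvariant vector of an irreducible matrix is positive. -/
lemma irred_pos [Nonempty S] {M : Matrix S S ℝ} (hM : ∀ a b, 0 ≤ M a b) (hi : Irred M)
    {v : S → ℝ} {c : ℝ} (hc : 0 ≤ c) (hv : 0 ≤ v) (h0 : v ≠ 0) (h : M *ᵥ v ≤ c • v) (a : S) :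
    0 < v a := by
  obtain ⟨N, hN⟩ := hi
  have h1 : (1 + M) *ᵥ v ≤ (1 + c) • v := by
    rw [Matrix.add_mulVec, Matrix.one_mulVec, add_smul, one_smul]
    exact add_le_add_right h v
  -- This bounds the strictly positive entry in `h3` by `(1 + c) ^ N * v a`, so `v a` cannot vanish.
  have h2 := pow_mulVec_le (one_add_nonneg hM) (by linarith) h1 N a
  have h3 := mulVec_pos' hN hv h0 a
  have h4 : 0 < (1 + c) ^ N := by positivity
  simp only [Pi.smul_apply, smul_eq_mul] at h2
  by_contra h5
  nlinarith [hv a]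

/-- A subinvariant vector of an irreducible matrix which is not invariant can be improved to a
strictly subinvariant one. -/
lemma irred_strict [Nonempty S] {M : Matrix S S ℝ} (hi : Irred M)
    {v : S → ℝ} {c : ℝ} (hv : ∀ a, 0 < v a) (h : M *ᵥ v ≤ c • v) (h0 : M *ᵥ v ≠ c • v) :
    ∃ v' : S → ℝ, (∀ a, 0 < v' a) ∧ ∀ a, (M *ᵥ v') a < c * v' a := by
  obtain ⟨N, hN⟩ := hi
  have hv0 : (0 : S → ℝ) ≤ v := fun a => (hv a).le
  have hvn : v ≠ 0 := fun h => by
    obtain ⟨a⟩ := ‹Nonempty S›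
    exact (hv a).ne' (congrFun h a)
  -- The positive matrix commutes with `M` and spreads the nonzero defect `c v - M v` over all
  -- coordinates.
  refine ⟨(1 + M) ^ N *ᵥ v, mulVec_pos' hN hv0 hvn, fun a => ?_⟩
  have h1 := mulVec_pos' hN (sub_nonneg.mpr h) (sub_ne_zero.mpr (Ne.symm h0)) a
  have hcomm : M * (1 + M) ^ N = (1 + M) ^ N * M := by
    have : Commute M (1 + M) := by
      rw [commute_iff_eq]; noncomm_ring
    exact (this.pow_right N).eq
  rw [Matrix.mulVec_sub, Matrix.mulVec_smul, Matrix.mulVec_mulVec, ← hcomm,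
    ← Matrix.mulVec_mulVec] at h1
  simpa using h1

/-- Perron's theorem: a positive eigenvector. -/
lemma exists_perron [Nonempty S] {M : Matrix S S ℝ} (hM : ∀ a b, 0 ≤ M a b) (hi : Irred M) :
    ∃ (c : ℝ) (v : S → ℝ), 0 ≤ c ∧ (∀ a, 0 < v a) ∧ M *ᵥ v = c • v := by
  classical
  set cm : ℝ := ∑ a, ∑ b, M a b with hcm
  have hcm0 : 0 ≤ cm := Finset.sum_nonneg fun a _ => Finset.sum_nonneg fun b _ => hM a b
  -- The Perron root is the least `c` admitting a normalized subinvariant vector; the bound `cm`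
  -- makes the search compact.
  set K : Set (ℝ × (S → ℝ)) :=
    (Set.Icc 0 cm ×ˢ stdSimplex ℝ S) ∩ {q | M *ᵥ q.2 ≤ q.1 • q.2} with hK
  have hKc : IsCompact K := by
    refine (isCompact_Icc.prod (isCompact_stdSimplex ℝ S)).inter_right ?_
    refine isClosed_le ?_ ?_
    · exact Continuous.matrix_mulVec continuous_const continuous_snd
    · exact continuous_fst.smul continuous_snd
  have hKn : K.Nonempty := by
    have hcard : (0 : ℝ) < Fintype.card S := by exact_mod_cast Fintype.card_pos
    refine ⟨(cm, fun _ => (Fintype.card S : ℝ)⁻¹), ⟨⟨⟨hcm0, le_rfl⟩, fun _ => by positivity, ?_⟩, ?_⟩⟩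
    · simp [hcard.ne']
    · intro a
      simp only [Matrix.mulVec, dotProduct, Pi.smul_apply, smul_eq_mul]
      rw [← Finset.sum_mul]
      refine mul_le_mul_of_nonneg_right ?_ (by positivity)
      exact Finset.single_le_sum (f := fun a => ∑ b, M a b)
        (fun a _ => Finset.sum_nonneg fun b _ => hM a b) (Finset.mem_univ a)
  obtain ⟨⟨c, v⟩, ⟨⟨⟨hc0, hcc⟩, hv0, hv1⟩, hle⟩, hmin⟩ := hKc.exists_isMinOn hKn continuous_fst.continuousOn
  simp only at hc0 hcc hv0 hv1 hle
  have hvn : v ≠ 0 := by rintro rfl; simp at hv1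
  have hvp := irred_pos hM hi hc0 hv0 hvn hle
  refine ⟨c, v, hc0, hvp, ?_⟩
  by_contra hne
  obtain ⟨v', hv', hs⟩ := irred_strict hi hvp hle hne
  have hsum : 0 < ∑ a, v' a := Finset.sum_pos (fun a _ => hv' a) Finset.univ_nonempty
  obtain ⟨a0, -, ha0⟩ := Finset.exists_max_image Finset.univ (fun a => (M *ᵥ v') a / v' a)
    Finset.univ_nonempty
  -- The worst ratio of a strictly subinvariant vector is below `c`, which contradicts minimality.
  set c' := (M *ᵥ v') a0 / v' a0
  have hc'c : c' < c := by
    rw [div_lt_iff₀ (hv' a0)]; exact hs a0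
  have hc'0 : 0 ≤ c' := div_nonneg (mulVec_nonneg' hM (fun a => (hv' a).le) a0) (hv' a0).le
  have : ((c', (∑ a, v' a)⁻¹ • v') : ℝ × (S → ℝ)) ∈ K := by
    refine ⟨⟨⟨hc'0, hc'c.le.trans hcc⟩, fun a => ?_, ?_⟩, ?_⟩
    · exact mul_nonneg (inv_nonneg.mpr hsum.le) (hv' a).le
    · simp only [Pi.smul_apply, smul_eq_mul, ← Finset.mul_sum]
      exact inv_mul_cancel₀ hsum.ne'
    · change M *ᵥ ((∑ a, v' a)⁻¹ • v') ≤ c' • ((∑ a, v' a)⁻¹ • v')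
      rw [Matrix.mulVec_smul, smul_comm]
      refine smul_le_smul_of_nonneg_left (fun a => ?_) (inv_nonneg.mpr hsum.le)
      have := ha0 a (Finset.mem_univ _)
      rwa [div_le_iff₀ (hv' a)] at this
  exact absurd (hmin this) (not_le.mpr hc'c)

/-- A positive right eigenvector of an irreducible matrix has a positive left partner. -/
lemma exists_left [Nonempty S] {M : Matrix S S ℝ} (hM : ∀ a b, 0 ≤ M a b) (hi : Irred M)
    {v : S → ℝ} {c : ℝ} (hv : ∀ a, 0 < v a) (h : M *ᵥ v = c • v) :
    ∃ u : S → ℝ, (∀ a, 0 < u a) ∧ u ᵥ* M = c • u := by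
  obtain ⟨c', u, -, hu, hc'⟩ := exists_perron (M := Mᵀ) (fun a b => hM b a) (irred_transpose hi)
  rw [Matrix.mulVec_transpose] at hc'
  have h1 : u ᵥ* M ⬝ᵥ v = u ⬝ᵥ M *ᵥ v := (Matrix.dotProduct_mulVec u M v).symm
  rw [hc', h, smul_dotProduct, dotProduct_smul, smul_eq_mul, smul_eq_mul] at h1
  have : 0 < u ⬝ᵥ v := Finset.sum_pos (fun a _ => mul_pos (hu a) (hv a)) Finset.univ_nonempty
  have hcc : c' = c := mul_right_cancel₀ this.ne' h1
  exact ⟨u, hu, hcc ▸ hc'⟩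

/-- Eigenvalues of a matrix dominated by a nonnegative one with a positive subinvariant vector. -/
lemma norm_eigenvalue_le {M : Matrix S S ℝ} {T : Matrix S S ℂ} (hT : ∀ a b, ‖T a b‖ ≤ M a b)
    {v : S → ℝ} (hv : ∀ a, 0 < v a) {c : ℝ} (h : M *ᵥ v ≤ c • v) {l : ℂ} {y : S → ℂ}
    (hy : T *ᵥ y = l • y) (hy0 : y ≠ 0) : ‖l‖ ≤ c := by
  obtain ⟨b0, hb0⟩ := Function.ne_iff.mp hy0
  have : Nonempty S := ⟨b0⟩
  -- Maximum principle: the eigenvalue equation is read at the coordinate where `‖y‖ / v` is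
  -- largest.
  obtain ⟨a, -, ha⟩ := Finset.exists_max_image Finset.univ (fun a => ‖y a‖ / v a)
    Finset.univ_nonempty
  set m := ‖y a‖ / v a
  have hm : ∀ b, ‖y b‖ ≤ m * v b := fun b => by
    have := ha b (Finset.mem_univ _)
    rwa [div_le_iff₀ (hv b)] at this
  have hm0 : 0 < m := by
    have := hm b0
    have h2 : 0 < ‖y b0‖ := norm_pos_iff.mpr hb0
    by_contra h3
    nlinarith [hv b0]
  have hya : ‖y a‖ = m * v a := by simp only [m]; field_simp [(hv a).ne']
  have h1 : ‖l‖ * ‖y a‖ ≤ m * (M *ᵥ v) a := by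
    rw [← norm_mul, show l * y a = (T *ᵥ y) a by rw [hy]; rfl]
    simp only [Matrix.mulVec, dotProduct]
    refine (norm_sum_le _ _).trans ?_
    rw [Finset.mul_sum]
    refine Finset.sum_le_sum fun b _ => ?_
    rw [norm_mul]
    calc ‖T a b‖ * ‖y b‖ ≤ M a b * (m * v b) :=
          mul_le_mul (hT a b) (hm b) (norm_nonneg _) ((norm_nonneg _).trans (hT a b))
      _ = m * (M a b * v b) := by ring
  have h2 := h a
  simp only [Pi.smul_apply, smul_eq_mul] at h2
  rw [hya] at h1
  have h3 : ‖l‖ * (m * v a) ≤ c * (m * v a) := by nlinarith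
  exact le_of_mul_le_mul_right h3 (mul_pos hm0 (hv a))

lemma mem_spectrum_iff {T : Matrix S S ℂ} {l : ℂ} :
    l ∈ spectrum ℂ T ↔ ∃ y : S → ℂ, y ≠ 0 ∧ T *ᵥ y = l • y := by
  rw [spectrum.mem_iff, Matrix.isUnit_iff_isUnit_det, isUnit_iff_ne_zero, not_not,
    ← Matrix.exists_mulVec_eq_zero_iff]
  refine exists_congr fun y => and_congr_right fun _ => ?_
  rw [Matrix.sub_mulVec, Matrix.algebraMap_eq_diagonal, sub_eq_zero]
  have : Matrix.diagonal (algebraMap ℂ (S → ℂ) l) *ᵥ y = l • y := by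
    ext a; simp [Matrix.mulVec_diagonal]
  rw [this]; exact eq_comm

/-- The spectral radius of an irreducible nonnegative matrix is the eigenvalue of its positive
eigenvector. -/
lemma spr_eq [Nonempty S] {M : Matrix S S ℝ} (hM : ∀ a b, 0 ≤ M a b)
    {v : S → ℝ} (hv : ∀ a, 0 < v a) {c : ℝ} (hc : 0 ≤ c) (h : M *ᵥ v = c • v) :
    spr (M.map (fun a : ℝ => (a : ℂ))) = c := by
  set T := M.map (fun a : ℝ => (a : ℂ)) with hT
  have hle : ∀ l ∈ spectrum ℂ T, ‖l‖ ≤ c := fun l hl => by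
    obtain ⟨y, hy0, hy⟩ := mem_spectrum_iff.mp hl
    refine norm_eigenvalue_le (M := M) (fun a b => ?_) hv h.le hy hy0
    simp [hT, abs_of_nonneg (hM a b)]
  have hmem : (c : ℂ) ∈ spectrum ℂ T := by
    refine mem_spectrum_iff.mpr ⟨fun a => (v a : ℂ), fun h => ?_, ?_⟩
    · obtain ⟨a⟩ := ‹Nonempty S›
      have := congrFun h a
      exact (hv a).ne' (by simpa using this)
    · ext a
      have := congrFun h a
      simp only [Matrix.mulVec, dotProduct, Pi.smul_apply, smul_eq_mul] at this
      simp only [hT, Matrix.mulVec, dotProduct, Pi.smul_apply, smul_eq_mul, Matrix.map_apply]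
      exact_mod_cast this
  have h1 : spectralRadius ℂ T = ENNReal.ofReal c := by
    refine le_antisymm ?_ ?_
    · refine iSup₂_le fun l hl => ?_
      rw [← enorm_eq_nnnorm, ← ofReal_norm]
      exact ENNReal.ofReal_le_ofReal (hle l hl)
    · have := le_iSup₂ (f := fun (k : ℂ) (_ : k ∈ spectrum ℂ T) => (‖k‖₊ : ENNReal)) (c : ℂ) hmem
      refine le_trans (le_of_eq ?_) this
      rw [← enorm_eq_nnnorm, ← ofReal_norm, Complex.norm_real, Real.norm_of_nonneg hc]
  rw [spr, h1, ENNReal.toReal_ofReal hc]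

/-- Dobrushin contraction on row vectors orthogonal to the positive eigenvector. -/
lemma dobrushin [Nonempty S] {B : Matrix S S ℝ} (hB : ∀ a b, 0 ≤ B a b) {v : S → ℝ}
    (hv : ∀ a, 0 < v a)
    {c : ℝ} (h : B *ᵥ v = c • v) {b0 : S} (hb0 : ∀ a, 0 < B a b0) :
    ∃ c' < c, ∀ u : S → ℂ, ∑ a, u a * v a = 0 →
      ∑ b, ‖∑ a, u a * B a b‖ * v b ≤ c' * ∑ a, ‖u a‖ * v a := by
  obtain ⟨a1, -, ha1⟩ := Finset.exists_min_image Finset.univ (fun a => B a b0 / v a)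
    Finset.univ_nonempty
  set ε := B a1 b0 / v a1 with hε
  have hε0 : 0 < ε := div_pos (hb0 a1) (hv a1)
  have hεle : ∀ a, ε * v a ≤ B a b0 := fun a => by
    have := ha1 a (Finset.mem_univ _)
    rwa [le_div_iff₀ (hv a)] at this
  refine ⟨c - ε * v b0, by nlinarith [mul_pos hε0 (hv b0)], fun u hu => ?_⟩
  -- The subtracted rank-one matrix acts as zero on row vectors orthogonal to `v`, keeps `B'`
  -- nonnegative and lowers the eigenvalue of `v` by `ε * v b0`.
  set B' : S → S → ℝ := fun a b => B a b - if b = b0 then ε * v a else 0 with hB'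
  have hB'0 : ∀ a b, 0 ≤ B' a b := fun a b => by
    simp only [hB']
    split_ifs with hb
    · subst hb; linarith [hεle a]
    · linarith [hB a b]
  have e1 : ∀ b, ∑ a, u a * (B a b : ℂ) = ∑ a, u a * (B' a b : ℂ) := fun b => by
    simp only [hB']
    by_cases hb : b = b0
    · subst hb
      have : ∑ a, u a * ((ε * v a : ℝ) : ℂ) = 0 := by
        rw [← mul_zero (ε : ℂ), ← hu, Finset.mul_sum]
        refine Finset.sum_congr rfl fun a _ => ?_
        push_cast; ring
      simp only [if_true, Complex.ofReal_sub, mul_sub, Finset.sum_sub_distrib, this, sub_zero]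
    · simp [hb]
  calc ∑ b, ‖∑ a, u a * (B a b : ℂ)‖ * v b
      ≤ ∑ b, (∑ a, ‖u a‖ * B' a b) * v b := by
        refine Finset.sum_le_sum fun b _ => mul_le_mul_of_nonneg_right ?_ (hv b).le
        rw [e1]
        refine (norm_sum_le _ _).trans (Finset.sum_le_sum fun a _ => ?_)
        rw [norm_mul, Complex.norm_real, Real.norm_of_nonneg (hB'0 a b)]
    _ = ∑ a, ‖u a‖ * ∑ b, B' a b * v b := by
        simp only [Finset.sum_mul, Finset.mul_sum]
        rw [Finset.sum_comm]
        exact Finset.sum_congr rfl fun a _ => Finset.sum_congr rfl fun b _ => by ring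
    _ = ∑ a, ‖u a‖ * ((c - ε * v b0) * v a) := by
        refine Finset.sum_congr rfl fun a _ => ?_
        congr 1
        have := congrFun h a
        simp only [Matrix.mulVec, dotProduct, Pi.smul_apply, smul_eq_mul] at this
        simp only [hB', sub_mul, Finset.sum_sub_distrib, this]
        simp [ite_mul]; ring
    _ = (c - ε * v b0) * ∑ a, ‖u a‖ * v a := by
        rw [Finset.mul_sum]
        exact Finset.sum_congr rfl fun a _ => by ring

/-- Simplicity of the Perron eigenvalue: an eigenvector orthogonal to the left eigenvector
vanishes. -/
lemma perron_simple [Nonempty S] {M : Matrix S S ℝ} (hi : Irred M)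
    {u : S → ℝ} (hu : ∀ a, 0 < u a) (h : u ᵥ* M = u) {x : S → ℂ}
    (hx : M.map (fun a : ℝ => (a : ℂ)) *ᵥ x = x) (hux : ∑ a, x a * u a = 0) : x = 0 := by
  obtain ⟨N, hN⟩ := hi
  -- Transposing turns `x` into a row vector orthogonal to the eigenvector `u` of `B`. It is an
  -- eigenvector for `2 ^ N`, which the strict contraction excludes unless it is zero.
  set B := ((1 + M) ^ N)ᵀ with hBd
  have hB : B *ᵥ u = (2 ^ N : ℝ) • u := by
    rw [hBd, Matrix.transpose_pow]
    refine pow_mulVec_eq ?_ N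
    rw [Matrix.mulVec_transpose, Matrix.vecMul_add, Matrix.vecMul_one, h, two_smul]
  have hxN : (((1 + M) ^ N).map (fun a : ℝ => (a : ℂ))) *ᵥ x = (2 ^ N : ℂ) • x := by
    have e : ((1 + M) ^ N).map (fun a : ℝ => (a : ℂ)) = (1 + M.map (fun a : ℝ => (a : ℂ))) ^ N := by
      have := map_pow (Complex.ofRealHom.mapMatrix (m := S)) (1 + M) N
      rw [map_add, map_one] at this
      exact this
    rw [e]
    clear e
    induction N with
    | zero => simp
    | succ n ih =>
      have key : ∀ k : ℕ, (1 + M.map (fun a : ℝ => (a : ℂ))) ^ k *ᵥ x = (2 ^ k : ℂ) • x := by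
        intro k
        induction k with
        | zero => simp
        | succ k ih =>
          rw [pow_succ, ← Matrix.mulVec_mulVec, Matrix.add_mulVec, Matrix.one_mulVec, hx,
            ← two_smul ℂ x, Matrix.mulVec_smul, ih, smul_smul, pow_succ, mul_comm]
      exact key _
  obtain ⟨b0⟩ := ‹Nonempty S›
  have : Nonempty S := ⟨b0⟩
  obtain ⟨c', hc', H⟩ := dobrushin (B := B) (fun a b => (hN b a).le) hu hB (b0 := b0)
    (fun a => hN b0 a)
  have H1 := H x hux
  have e2 : ∀ b, ∑ a, x a * (B a b : ℂ) = 2 ^ N * x b := fun b => by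
    have := congrFun hxN b
    simp only [Matrix.mulVec, dotProduct, Pi.smul_apply, smul_eq_mul, Matrix.map_apply] at this
    rw [← this]
    exact Finset.sum_congr rfl fun a _ => by rw [mul_comm, hBd, Matrix.transpose_apply]
  simp only [e2, norm_mul, norm_pow, mul_assoc, ← Finset.mul_sum, Complex.norm_ofNat] at H1
  have h0 : ∑ a, ‖x a‖ * u a ≤ 0 := by
    by_contra h5
    push Not at h5
    nlinarith
  have h6 : ∀ a, 0 ≤ ‖x a‖ * u a := fun a => mul_nonneg (norm_nonneg _) (hu a).le
  ext a
  have h7 := (Finset.sum_eq_zero_iff_of_nonneg fun a _ => h6 a).mp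
    (le_antisymm h0 (Finset.sum_nonneg fun a _ => h6 a)) a (Finset.mem_univ _)
  have := (mul_eq_zero.mp h7).resolve_right (hu a).ne'
  simpa using this

end NonnegMatrix

/-! ### The chain, its transforms, and convexity of `χ` -/

section Chain
variable {S : Type*} [Fintype S] [DecidableEq S]

lemma sum_H {M : Type*} [AddCommMonoid M] (f : ℤ → M) :
    ∑ i ∈ H, f i = f (-1) + f 0 + f 1 := by
  simp [H, Finset.sum_insert, add_assoc]

/-- The real form of `Astar`. -/
def astar (A : ℤ → ℤ → Matrix S S ℝ) (j : ℤ) (x : ℝ) : Matrix S S ℝ := ∑ i ∈ H, x ^ i • A i j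

/-- The real form of `Cmat`. -/
def creal (A : ℤ → ℤ → Matrix S S ℝ) (x w : ℝ) : Matrix S S ℝ :=
  ∑ i ∈ H, ∑ j ∈ H, (x ^ i * w ^ j) • A i j

lemma Astar_ofReal (A : ℤ → ℤ → Matrix S S ℝ) (j : ℤ) (x : ℝ) :
    Astar A j (x : ℂ) = (astar A j x).map (fun a : ℝ => (a : ℂ)) := by
  ext a b
  simp [Astar, astar, Matrix.sum_apply]

lemma Cmat_ofReal (A : ℤ → ℤ → Matrix S S ℝ) (x w : ℝ) :
    Cmat A (x : ℂ) (w : ℂ) = (creal A x w).map (fun a : ℝ => (a : ℂ)) := by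
  ext a b
  simp [Cmat, creal, Matrix.sum_apply]

lemma creal_eq (A : ℤ → ℤ → Matrix S S ℝ) (x w : ℝ) :
    creal A x w = w⁻¹ • astar A (-1) x + astar A 0 x + w • astar A 1 x := by
  simp only [creal, astar, sum_H, smul_add, smul_smul]
  simp only [zpow_neg_one, zpow_zero, zpow_one, mul_one, one_mul]
  simp only [mul_comm w, mul_comm w⁻¹]
  abel

variable {A : ℤ → ℤ → Matrix S S ℝ}

lemma astar_nonneg (hA : ∀ i ∈ H, ∀ j ∈ H, ∀ a b : S, 0 ≤ A i j a b) {j : ℤ} (hj : j ∈ H)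
    {x : ℝ} (hx : 0 < x) (a b : S) : 0 ≤ astar A j x a b := by
  rw [astar, Matrix.sum_apply]
  exact Finset.sum_nonneg fun i hi => mul_nonneg (zpow_pos hx i).le (hA i hi j hj a b)

lemma creal_nonneg (hA : ∀ i ∈ H, ∀ j ∈ H, ∀ a b : S, 0 ≤ A i j a b)
    {x w : ℝ} (hx : 0 < x) (hw : 0 < w) (a b : S) : 0 ≤ creal A x w a b := by
  rw [creal, Matrix.sum_apply]
  refine Finset.sum_nonneg fun i hi => ?_
  rw [Matrix.sum_apply]
  exact Finset.sum_nonneg fun j hj => mul_nonneg (mul_pos (zpow_pos hx i) (zpow_pos hw j)).le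
    (hA i hi j hj a b)

lemma astar_pos (hA : ∀ i ∈ H, ∀ j ∈ H, ∀ a b : S, 0 ≤ A i j a b) {i j : ℤ} (hi : i ∈ H)
    (hj : j ∈ H) {x : ℝ} (hx : 0 < x) {a b : S} (h : 0 < A i j a b) : 0 < astar A j x a b := by
  rw [astar, Matrix.sum_apply]
  exact Finset.sum_pos' (fun i hi => mul_nonneg (zpow_pos hx i).le (hA i hi j hj a b))
    ⟨i, hi, mul_pos (zpow_pos hx i) h⟩

lemma creal_pos (hA : ∀ i ∈ H, ∀ j ∈ H, ∀ a b : S, 0 ≤ A i j a b)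
    {i j : ℤ} (hi : i ∈ H) (hj : j ∈ H)
    {x w : ℝ} (hx : 0 < x) (hw : 0 < w) {a b : S} (h : 0 < A i j a b) : 0 < creal A x w a b := by
  rw [creal, Matrix.sum_apply]
  have h0 : ∀ i ∈ H, ∀ j ∈ H, 0 ≤ ((x ^ i * w ^ j) • A i j) a b := fun i hi j hj =>
    mul_nonneg (mul_pos (zpow_pos hx i) (zpow_pos hw j)).le (hA i hi j hj a b)
  refine Finset.sum_pos' (fun i hi => ?_) ⟨i, hi, ?_⟩
  · rw [Matrix.sum_apply]
    exact Finset.sum_nonneg fun j hj => h0 i hi j hj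
  · rw [Matrix.sum_apply]
    exact Finset.sum_pos' (fun j hj => h0 i hi j hj)
      ⟨j, hj, mul_pos (mul_pos (zpow_pos hx i) (zpow_pos hw j)) h⟩

/-- Induction along the paths of the chain. -/
lemma path_induct (hirr : ChainIrreducible (transition A)) (Q : ℤ → ℤ → S → Prop)
    (hstep : ∀ k l a i j b, i ∈ H → j ∈ H → 0 < A i j a b → Q k l a → Q (k + i) (l + j) b)
    {k l : ℤ} {a : S} (h : Q k l a) (k' l' : ℤ) (b : S) : Q k' l' b := by
  have key : ∀ n (x y : ℤ × ℤ × S), Reaches (transition A) n x y →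
      Q x.1 x.2.1 x.2.2 → Q y.1 y.2.1 y.2.2 := by
    intro n
    induction n with
    | zero => rintro x y rfl h; exact h
    | succ n ih =>
      rintro x y ⟨t, ht, hr⟩ h
      refine ih t y hr ?_
      unfold transition at ht
      split_ifs at ht with hH
      · have := hstep x.1 x.2.1 x.2.2 _ _ t.2.2 hH.1 hH.2 ht h
        simpa using this
      · exact absurd ht (lt_irrefl _)
  obtain ⟨n, hn⟩ := hirr (k, l, a) (k', l', b)
  exact key n _ _ hn h

/-- The chain of levels generated by three blocks is irreducible. -/
def LevelIrr (Bm B0 Bp : Matrix S S ℝ) : Prop :=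
  ∀ Q : ℤ → S → Prop, (∀ l a b, Q l a → (0 < Bm a b → Q (l - 1) b) ∧ (0 < B0 a b → Q l b) ∧
    (0 < Bp a b → Q (l + 1) b)) → ∀ l a, Q l a → ∀ l' b, Q l' b

lemma levelIrr_astar (hA : ∀ i ∈ H, ∀ j ∈ H, ∀ a b : S, 0 ≤ A i j a b)
    (hirr : ChainIrreducible (transition A)) {x : ℝ} (hx : 0 < x) :
    LevelIrr (astar A (-1) x) (astar A 0 x) (astar A 1 x) := by
  intro Q hQ l a h l' b
  refine path_induct hirr (fun _ l a => Q l a) ?_ (k := 0) h 0 l' b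
  intro k l a i j b hi hj hp h
  have hp' := astar_pos hA hi hj hx hp
  obtain ⟨h1, h2, h3⟩ := hQ l a b h
  simp only [H, Finset.mem_insert, Finset.mem_singleton] at hj
  rcases hj with rfl | rfl | rfl
  · exact h1 hp'
  · simpa using h2 hp'
  · exact h3 hp'

/-- A path of the chain projects to a path in `S` along positive entries of `creal`, since powers of
`x, w > 0` do not affect positivity. -/
lemma irred_creal (hA : ∀ i ∈ H, ∀ j ∈ H, ∀ a b : S, 0 ≤ A i j a b)
    (hirr : ChainIrreducible (transition A)) {x w : ℝ} (hx : 0 < x) (hw : 0 < w) :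
    Irred (creal A x w) := by
  classical
  set M := creal A x w with hM
  have hM0 : ∀ a b, 0 ≤ M a b := creal_nonneg hA hx hw
  have hpn := fun n => pow_nonneg' (one_add_nonneg hM0) n
  have hsucc : ∀ (n : ℕ) (a b : S), ((1 + M) ^ (n + 1)) a b
      = ((1 + M) ^ n) a b + ∑ c, ((1 + M) ^ n) a c * M c b := fun n a b => by
    rw [pow_succ, mul_add, mul_one, Matrix.add_apply, Matrix.mul_apply]
  have hmono : ∀ n m : ℕ, n ≤ m → ∀ a b : S, 0 < ((1 + M) ^ n) a b → 0 < ((1 + M) ^ m) a b := by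
    intro n m hnm a b h
    induction m, hnm using Nat.le_induction with
    | base => exact h
    | succ m _ ih =>
      rw [hsucc]
      exact add_pos_of_pos_of_nonneg ih (Finset.sum_nonneg fun c _ => mul_nonneg (hpn m a c) (hM0 c b))
  have hex : ∀ a b : S, ∃ n : ℕ, 0 < ((1 + M) ^ n) a b := by
    intro a b
    refine path_induct hirr (fun _ _ b => ∃ n : ℕ, 0 < ((1 + M) ^ n) a b) ?_ (k := 0) (l := 0) (a := a)
      ⟨0, by simp⟩ 0 0 b
    rintro k l c i j b hi hj hp ⟨n, hn⟩
    refine ⟨n + 1, ?_⟩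
    rw [hsucc]
    refine add_pos_of_nonneg_of_pos (hpn n a b) ?_
    exact Finset.sum_pos' (fun c _ => mul_nonneg (hpn n a c) (hM0 c b))
      ⟨c, Finset.mem_univ _, mul_pos hn (creal_pos hA hi hj hx hw hp)⟩
  -- The supports of the powers of `1 + M` increase, so the largest of finitely many exponents
  -- serves all pairs.
  choose f hf using hex
  refine ⟨Finset.univ.sup fun q : S × S => f q.1 q.2, fun a b => hmono _ _ ?_ a b (hf a b)⟩
  exact Finset.le_sup (f := fun q : S × S => f q.1 q.2) (Finset.mem_univ (a, b))

/-- Together with the two lemmas below, this replaces the spectral radius by positive vectors, the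
only form in which `χ` is used later. -/
lemma chi_perron [Nonempty S] (hA : ∀ i ∈ H, ∀ j ∈ H, ∀ a b : S, 0 ≤ A i j a b)
    (hirr : ChainIrreducible (transition A)) {x w : ℝ} (hx : 0 < x) (hw : 0 < w) :
    ∃ v : S → ℝ, (∀ a, 0 < v a) ∧ creal A x w *ᵥ v = chi A x w • v := by
  obtain ⟨c, v, hc, hv, h⟩ := exists_perron (creal_nonneg hA hx hw) (irred_creal hA hirr hx hw)
  refine ⟨v, hv, ?_⟩
  rw [chi, Cmat_ofReal, spr_eq (creal_nonneg hA hx hw) hv hc h, h]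

lemma chi_eq_one_of [Nonempty S] (hA : ∀ i ∈ H, ∀ j ∈ H, ∀ a b : S, 0 ≤ A i j a b)
    {x w : ℝ} (hx : 0 < x) (hw : 0 < w)
    {v : S → ℝ} (hv : ∀ a, 0 < v a) (h : creal A x w *ᵥ v = v) : chi A x w = 1 := by
  rw [chi, Cmat_ofReal]
  exact spr_eq (creal_nonneg hA hx hw) hv zero_le_one (by rw [h, one_smul])

lemma chi_le_one_of [Nonempty S] (hA : ∀ i ∈ H, ∀ j ∈ H, ∀ a b : S, 0 ≤ A i j a b)
    (hirr : ChainIrreducible (transition A)) {x w : ℝ} (hx : 0 < x) (hw : 0 < w)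
    {v : S → ℝ} (hv : ∀ a, 0 < v a) (h : creal A x w *ᵥ v ≤ v) : chi A x w ≤ 1 := by
  obtain ⟨c, v', hc, hv', h'⟩ := exists_perron (creal_nonneg hA hx hw) (irred_creal hA hirr hx hw)
  obtain ⟨u, hu, hu'⟩ := exists_left (creal_nonneg hA hx hw) (irred_creal hA hirr hx hw) hv' h'
  rw [chi, Cmat_ofReal, spr_eq (creal_nonneg hA hx hw) hv' hc h']
  have h1 : u ᵥ* creal A x w ⬝ᵥ v = u ⬝ᵥ creal A x w *ᵥ v :=
    (Matrix.dotProduct_mulVec u _ v).symm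
  have h2 : u ⬝ᵥ creal A x w *ᵥ v ≤ u ⬝ᵥ v :=
    Finset.sum_le_sum fun a _ => mul_le_mul_of_nonneg_left (h a) (hu a).le
  rw [← h1, hu', smul_dotProduct, smul_eq_mul] at h2
  have : 0 < u ⬝ᵥ v := Finset.sum_pos (fun a _ => mul_pos (hu a) (hv a)) Finset.univ_nonempty
  nlinarith

/-! ### Weights of transitions -/

/-- Index set of the transitions. -/
def trans (S : Type*) [Fintype S] : Finset (ℤ × ℤ × S × S) :=
  H ×ˢ H ×ˢ Finset.univ ×ˢ Finset.univ

/-- The weight of a transition under a left and a right vector. -/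
def wt (A : ℤ → ℤ → Matrix S S ℝ) (x w : ℝ) (π v : S → ℝ) (q : ℤ × ℤ × S × S) : ℝ :=
  π q.2.2.1 * (x ^ q.1 * w ^ q.2.1 * A q.1 q.2.1 q.2.2.1 q.2.2.2) * v q.2.2.2

/-- Mean horizontal drift. -/
def drift₁ (A : ℤ → ℤ → Matrix S S ℝ) (x w : ℝ) (π v : S → ℝ) : ℝ :=
  ∑ q ∈ trans S, wt A x w π v q * (q.1 : ℝ)

/-- Mean vertical drift. -/
def drift₂ (A : ℤ → ℤ → Matrix S S ℝ) (x w : ℝ) (π v : S → ℝ) : ℝ :=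
  ∑ q ∈ trans S, wt A x w π v q * (q.2.1 : ℝ)

lemma sum_trans (f : ℤ × ℤ × S × S → ℝ) :
    ∑ q ∈ trans S, f q = ∑ a, ∑ b, ∑ i ∈ H, ∑ j ∈ H, f (i, j, a, b) := by
  simp only [trans, Finset.sum_product]
  have h1 : ∀ i ∈ H, ∑ j ∈ H, ∑ a : S, ∑ b : S, f (i, j, a, b)
      = ∑ a, ∑ b, ∑ j ∈ H, f (i, j, a, b) := fun i _ => by
    rw [Finset.sum_comm]
    exact Finset.sum_congr rfl fun a _ => Finset.sum_comm
  rw [Finset.sum_congr rfl h1, Finset.sum_comm]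
  exact Finset.sum_congr rfl fun a _ => Finset.sum_comm

lemma creal_apply (A : ℤ → ℤ → Matrix S S ℝ) (x w : ℝ) (a b : S) :
    creal A x w a b = ∑ i ∈ H, ∑ j ∈ H, x ^ i * w ^ j * A i j a b := by
  simp [creal, Matrix.sum_apply]

/-- If `C v = v` and `π C = π`, the weights have equal left and right marginals `π v`; sums of
differences `f b - f a` then vanish. -/
lemma sum_wt_left (x w : ℝ) (π v : S → ℝ) (f : S → ℝ) :
    ∑ q ∈ trans S, wt A x w π v q * f q.2.2.1 = ∑ a, π a * f a * (creal A x w *ᵥ v) a := by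
  rw [sum_trans]
  simp only [wt, Matrix.mulVec, dotProduct, creal_apply, Finset.sum_mul, Finset.mul_sum]
  refine Finset.sum_congr rfl fun a _ => Finset.sum_congr rfl fun b _ =>
    Finset.sum_congr rfl fun i _ => Finset.sum_congr rfl fun j _ => by ring

lemma sum_wt_right (x w : ℝ) (π v : S → ℝ) (f : S → ℝ) :
    ∑ q ∈ trans S, wt A x w π v q * f q.2.2.2 = ∑ b, (π ᵥ* creal A x w) b * v b * f b := by
  rw [sum_trans, Finset.sum_comm]
  simp only [wt, Matrix.vecMul, dotProduct, creal_apply, Finset.sum_mul, Finset.mul_sum]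

lemma wt_nonneg (hA : ∀ i ∈ H, ∀ j ∈ H, ∀ a b : S, 0 ≤ A i j a b)
    {x w : ℝ} (hx : 0 < x) (hw : 0 < w) {π v : S → ℝ} (hπ : ∀ a, 0 < π a) (hv : ∀ a, 0 < v a)
    {q : ℤ × ℤ × S × S} (hq : q ∈ trans S) : 0 ≤ wt A x w π v q := by
  simp only [trans, Finset.mem_product, Finset.mem_univ, and_true] at hq
  have := hA _ hq.1 _ hq.2 q.2.2.1 q.2.2.2
  have h1 := hπ q.2.2.1
  have h2 := hv q.2.2.2
  unfold wt
  positivity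

lemma wt_pos {x w : ℝ} (hx : 0 < x) (hw : 0 < w) {π v : S → ℝ} (hπ : ∀ a, 0 < π a)
    (hv : ∀ a, 0 < v a) {i j : ℤ} {a b : S} (h : 0 < A i j a b) :
    0 < wt A x w π v (i, j, a, b) := by
  have h1 := hπ a
  have h2 := hv b
  unfold wt
  dsimp only
  positivity

/-- A linear form which vanishes on all transitions is zero. -/
lemma exists_transition_ne [Nonempty S] (hirr : ChainIrreducible (transition A))
    {s t : ℝ} (h : S → ℝ) (hst : ¬(s = 0 ∧ t = 0)) :
    ∃ i ∈ H, ∃ j ∈ H, ∃ a b, 0 < A i j a b ∧ i * s + j * t + h b - h a ≠ 0 := by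
  by_contra hcon
  push Not at hcon
  obtain ⟨o⟩ := ‹Nonempty S›
  have key := path_induct hirr (fun k l b => k * s + l * t + h b - h o = 0) (by
    intro k l a i j b hi hj hp h1
    have := hcon i hi j hj a b hp
    push_cast
    linarith) (k := 0) (l := 0) (a := o) (by simp)
  refine hst ⟨?_, ?_⟩
  · have := key 1 0 o
    simpa using this
  · have := key 0 1 o
    simpa using this

/-- The gradient inequality for the convex set `Γ̄`. -/
lemma drift_lt [Nonempty S] (hA : ∀ i ∈ H, ∀ j ∈ H, ∀ a b : S, 0 ≤ A i j a b)
    (hirr : ChainIrreducible (transition A)) {x w x' w' : ℝ} (hx : 0 < x) (hw : 0 < w)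
    (hx' : 0 < x') (hw' : 0 < w') {π v v' : S → ℝ} (hπ : ∀ a, 0 < π a) (hv : ∀ a, 0 < v a)
    (hv' : ∀ a, 0 < v' a) (h : creal A x w *ᵥ v = v) (hl : π ᵥ* creal A x w = π)
    (h' : creal A x' w' *ᵥ v' ≤ v') (hne : ¬(x' = x ∧ w' = w)) :
    Real.log (x' / x) * drift₁ A x w π v + Real.log (w' / w) * drift₂ A x w π v < 0 := by
  set s := Real.log (x' / x) with hs
  set t := Real.log (w' / w) with ht
  set g : S → ℝ := fun a => Real.log (v' a / v a) with hg
  have hst : ¬(s = 0 ∧ t = 0) := by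
    rintro ⟨h1, h2⟩
    refine hne ⟨?_, ?_⟩
    · have := Real.eq_one_of_pos_of_log_eq_zero (div_pos hx' hx) h1
      rwa [div_eq_one_iff_eq hx.ne'] at this
    · have := Real.eq_one_of_pos_of_log_eq_zero (div_pos hw' hw) h2
      rwa [div_eq_one_iff_eq hw.ne'] at this
  obtain ⟨i, hi, j, hj, a, b, hp, hne0⟩ := exists_transition_ne hirr g hst
  -- `exp θ` is the density of the weights at `(x', w')`, with left vector `π v / v'` and right
  -- vector `v'`, against those at `(x, w)`.
  set θ : ℤ × ℤ × S × S → ℝ := fun q => q.1 * s + q.2.1 * t + g q.2.2.2 - g q.2.2.1 with hθ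
  have hexp : ∀ q : ℤ × ℤ × S × S, wt A x w π v q * Real.exp (θ q)
      = wt A x' w' (fun a => π a * (v a / v' a)) v' q := by
    intro q
    have e1 : Real.exp (θ q) = (x' / x) ^ q.1 * (w' / w) ^ q.2.1 * (v' q.2.2.2 / v q.2.2.2) *
        (v q.2.2.1 / v' q.2.2.1) := by
      simp only [hθ]
      rw [Real.exp_sub, Real.exp_add, Real.exp_add]
      rw [show (q.1 : ℝ) * s = Real.log ((x' / x) ^ q.1) by rw [Real.log_zpow],
        show (q.2.1 : ℝ) * t = Real.log ((w' / w) ^ q.2.1) by rw [Real.log_zpow]]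
      rw [Real.exp_log (zpow_pos (div_pos hx' hx) _), Real.exp_log (zpow_pos (div_pos hw' hw) _),
        Real.exp_log (div_pos (hv' _) (hv _)), Real.exp_log (div_pos (hv' _) (hv _)),
        div_eq_mul_inv _ (v' q.2.2.1 / v q.2.2.1), inv_div]
    rw [e1, div_zpow, div_zpow]
    have n1 := (zpow_pos hx q.1).ne'
    have n2 := (zpow_pos hw q.2.1).ne'
    have n3 := (hv q.2.2.1).ne'
    have n4 := (hv q.2.2.2).ne'
    have n5 := (hv' q.2.2.1).ne'
    unfold wt
    field_simp
  have hsum1 : ∑ q ∈ trans S, wt A x w π v q * Real.exp (θ q) ≤ ∑ a, π a * v a := by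
    simp only [hexp]
    have := sum_wt_left (A := A) x' w' (fun a => π a * (v a / v' a)) v' (fun _ => 1)
    simp only [mul_one] at this
    rw [this]
    refine Finset.sum_le_sum fun a _ => ?_
    calc π a * (v a / v' a) * (creal A x' w' *ᵥ v') a ≤ π a * (v a / v' a) * v' a :=
          mul_le_mul_of_nonneg_left (h' a) (mul_nonneg (hπ a).le (div_pos (hv a) (hv' a)).le)
      _ = π a * v a := by field_simp [(hv' a).ne']
  -- The differences of `g` cancel because the marginals agree, and the drifts remain. The claim is
  -- then `θ + 1 ≤ exp θ`, strict on a transition with `θ ≠ 0`.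
  have hsum2 : ∑ q ∈ trans S, wt A x w π v q * (θ q + 1)
      = s * drift₁ A x w π v + t * drift₂ A x w π v + ∑ a, π a * v a := by
    have e1 := sum_wt_left (A := A) x w π v g
    have e2 := sum_wt_right (A := A) x w π v g
    have e3 := sum_wt_left (A := A) x w π v (fun _ => 1)
    simp only [mul_one] at e3
    rw [h] at e1 e3
    rw [hl] at e2
    have e4 : ∑ a, π a * g a * v a = ∑ a, π a * v a * g a :=
      Finset.sum_congr rfl fun a _ => by ring
    rw [← e3]
    simp only [drift₁, drift₂, hθ, Finset.mul_sum, ← Finset.sum_add_distrib]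
    rw [← sub_eq_zero, ← Finset.sum_sub_distrib]
    rw [← sub_eq_zero.mpr (e2.trans (e4.symm.trans e1.symm)), ← Finset.sum_sub_distrib]
    refine Finset.sum_congr rfl fun q _ => by ring
  have hlt : ∑ q ∈ trans S, wt A x w π v q * (θ q + 1)
      < ∑ q ∈ trans S, wt A x w π v q * Real.exp (θ q) := by
    refine Finset.sum_lt_sum (fun q hq => mul_le_mul_of_nonneg_left (Real.add_one_le_exp _)
      (wt_nonneg hA hx hw hπ hv hq)) ⟨(i, j, a, b), ?_, ?_⟩
    · simp [trans, hi, hj]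
    · exact mul_lt_mul_of_pos_left (Real.add_one_lt_exp hne0) (wt_pos hx hw hπ hv hp)
  linarith

/-- At the middle of three roots the gradient inequality toward the two others would give the
vertical drift both signs. -/
lemma chi_eq_one_at_most_two [Nonempty S] (hA : ∀ i ∈ H, ∀ j ∈ H, ∀ a b : S, 0 ≤ A i j a b)
    (hirr : ChainIrreducible (transition A)) {x w₁ w₂ w₃ : ℝ} (hx : 0 < x) (hw₁ : 0 < w₁)
    (h12 : w₁ < w₂) (h23 : w₂ < w₃) (h₁ : chi A x w₁ = 1) (h₂ : chi A x w₂ = 1)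
    (h₃ : chi A x w₃ = 1) : False := by
  have hw₂ := hw₁.trans h12
  have hw₃ := hw₂.trans h23
  obtain ⟨v₁, hv₁, e₁⟩ := chi_perron hA hirr hx hw₁
  obtain ⟨v₂, hv₂, e₂⟩ := chi_perron hA hirr hx hw₂
  obtain ⟨v₃, hv₃, e₃⟩ := chi_perron hA hirr hx hw₃
  obtain ⟨π, hπ, hl⟩ := exists_left (creal_nonneg hA hx hw₂) (irred_creal hA hirr hx hw₂) hv₂ e₂
  rw [h₁, one_smul] at e₁
  rw [h₂, one_smul] at e₂ hl
  rw [h₃, one_smul] at e₃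
  have k1 := drift_lt hA hirr hx hw₂ hx hw₁ hπ hv₂ hv₁ e₂ hl e₁.le (fun h => h12.ne h.2)
  have k3 := drift_lt hA hirr hx hw₂ hx hw₃ hπ hv₂ hv₃ e₂ hl e₃.le (fun h => h23.ne' h.2)
  rw [div_self hx.ne', Real.log_one, zero_mul, zero_add] at k1 k3
  have l1 : Real.log (w₁ / w₂) < 0 := Real.log_neg (div_pos hw₁ hw₂) ((div_lt_one hw₂).mpr h12)
  have l3 : 0 < Real.log (w₃ / w₂) := Real.log_pos ((one_lt_div hw₂).mpr h23)
  nlinarith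

end Chain

/-! ### Compactness of `Γ̄` and its right extreme point -/

section Extremal
variable {S : Type*} [Fintype S] [DecidableEq S] {A : ℤ → ℤ → Matrix S S ℝ}

lemma creal_ge (hA : ∀ i ∈ H, ∀ j ∈ H, ∀ a b : S, 0 ≤ A i j a b)
    {i j : ℤ} (hi : i ∈ H) (hj : j ∈ H) {x w : ℝ} (hx : 0 < x) (hw : 0 < w) (a b : S) :
    x ^ i * w ^ j * A i j a b ≤ creal A x w a b := by
  rw [creal_apply]
  have h0 : ∀ i ∈ H, ∀ j ∈ H, 0 ≤ x ^ i * w ^ j * A i j a b := fun i hi j hj =>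
    mul_nonneg (mul_pos (zpow_pos hx i) (zpow_pos hw j)).le (hA i hi j hj a b)
  refine le_trans ?_ (Finset.single_le_sum (f := fun i => ∑ j ∈ H, x ^ i * w ^ j * A i j a b)
    (fun i hi => Finset.sum_nonneg fun j hj => h0 i hi j hj) hi)
  exact Finset.single_le_sum (f := fun j => x ^ i * w ^ j * A i j a b) (fun j hj => h0 i hi j hj) hj

/-- The set `Γ̄` lifted to logarithms of positive subinvariant vectors. -/
def liftGam (A : ℤ → ℤ → Matrix S S ℝ) : Set (ℝ × ℝ × (S → ℝ)) :=
  {q | ∀ a, ∑ b, creal A (Real.exp q.1) (Real.exp q.2.1) a b * Real.exp (q.2.2 b)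
    ≤ Real.exp (q.2.2 a)}

lemma mem_liftGam {q : ℝ × ℝ × (S → ℝ)} : q ∈ liftGam A ↔
    creal A (Real.exp q.1) (Real.exp q.2.1) *ᵥ (fun a => Real.exp (q.2.2 a))
      ≤ fun a => Real.exp (q.2.2 a) := Iff.rfl

lemma isClosed_liftGam (A : ℤ → ℤ → Matrix S S ℝ) : IsClosed (liftGam A) := by
  simp only [liftGam, Set.ofPred_forall]
  refine isClosed_iInter fun a => isClosed_le ?_ ?_
  · refine continuous_finsetSum _ fun b _ => Continuous.mul ?_ ?_
    · simp only [creal_apply]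
      refine continuous_finsetSum _ fun i _ => continuous_finsetSum _ fun j _ => ?_
      refine Continuous.mul (Continuous.mul ?_ ?_) continuous_const
      · exact (Real.continuous_exp.comp continuous_fst).zpow₀ i fun _ => Or.inl (Real.exp_ne_zero _)
      · exact (Real.continuous_exp.comp (continuous_fst.comp continuous_snd)).zpow₀ j
          fun _ => Or.inl (Real.exp_ne_zero _)
    · fun_prop
  · fun_prop

/-- Each positive transition gives a linear inequality between the logarithmic coordinates; adding
these along a path to `(k, l, b)` bounds the corresponding linear form. Opposite displacements then
bound every coordinate. -/
lemma liftGam_bound (hA : ∀ i ∈ H, ∀ j ∈ H, ∀ a b : S, 0 ≤ A i j a b)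
    (hirr : ChainIrreducible (transition A)) (o : S) (k l : ℤ) (b : S) :
    ∃ N : ℝ, ∀ q ∈ liftGam A, k * q.1 + l * q.2.1 + q.2.2 b - q.2.2 o ≤ N := by
  refine path_induct hirr
    (fun k l b => ∃ N : ℝ, ∀ q ∈ liftGam A, k * q.1 + l * q.2.1 + q.2.2 b - q.2.2 o ≤ N) ?_
    (k := 0) (l := 0) (a := o) ⟨0, fun q _ => by simp⟩ k l b
  rintro k l a i j b hi hj hp ⟨N, hN⟩
  refine ⟨N - Real.log (A i j a b), fun q hq => ?_⟩
  have h1 := hN q hq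
  have h2 : Real.exp (i * q.1 + j * q.2.1 + Real.log (A i j a b) + q.2.2 b)
      ≤ Real.exp (q.2.2 a) := by
    refine le_trans ?_ (hq a)
    refine le_trans ?_ (Finset.single_le_sum
      (f := fun b => creal A (Real.exp q.1) (Real.exp q.2.1) a b * Real.exp (q.2.2 b))
      (fun b _ => mul_nonneg (creal_nonneg hA (Real.exp_pos _) (Real.exp_pos _) a b)
        (Real.exp_pos _).le) (Finset.mem_univ b))
    rw [Real.exp_add, Real.exp_add, Real.exp_add, Real.exp_log hp, mul_comm (i : ℝ),
      mul_comm (j : ℝ), Real.exp_mul, Real.exp_mul, Real.rpow_intCast, Real.rpow_intCast]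
    exact mul_le_mul_of_nonneg_right (creal_ge hA hi hj (Real.exp_pos _) (Real.exp_pos _) a b)
      (Real.exp_pos _).le
  have h3 := Real.exp_le_exp.mp h2
  push_cast
  linarith

/-- Carrying the eigenvector along avoids continuity of the spectral radius: the lifted set is
closed by inspection. Setting the coordinate at `o` to zero removes the scaling freedom. -/
lemma fst_image_Gam [Nonempty S] (hA : ∀ i ∈ H, ∀ j ∈ H, ∀ a b : S, 0 ≤ A i j a b)
    (hirr : ChainIrreducible (transition A)) (o : S) :
    Prod.fst '' Gam A = Prod.fst '' (liftGam A ∩ {q | q.2.2 o = 0}) := by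
  ext s
  constructor
  · rintro ⟨⟨s, t⟩, hst, rfl⟩
    obtain ⟨v, hv, h⟩ := chi_perron hA hirr (Real.exp_pos s) (Real.exp_pos t)
    refine ⟨(s, t, fun a => Real.log (v a / v o)), ⟨?_, by simp [(hv o).ne']⟩, rfl⟩
    rw [mem_liftGam]
    have e : (fun a => Real.exp (Real.log (v a / v o))) = (v o)⁻¹ • v := by
      ext a
      rw [Real.exp_log (div_pos (hv a) (hv o))]
      simp [div_eq_inv_mul]
    simp only [e]
    rw [Matrix.mulVec_smul]
    refine smul_le_smul_of_nonneg_left (fun a => ?_) (inv_pos.mpr (hv o)).le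
    rw [h]
    have : chi A (Real.exp s) (Real.exp t) ≤ 1 := hst
    simp only [Pi.smul_apply, smul_eq_mul]
    nlinarith [hv a]
  · rintro ⟨⟨s, t, g⟩, ⟨hq, -⟩, rfl⟩
    have h1 : chi A (Real.exp s) (Real.exp t) ≤ 1 :=
      chi_le_one_of hA hirr (Real.exp_pos s) (Real.exp_pos t)
        (v := fun a => Real.exp (g a)) (fun a => Real.exp_pos _) hq
    exact ⟨(s, t), h1, rfl⟩

lemma isCompact_liftGam (hA : ∀ i ∈ H, ∀ j ∈ H, ∀ a b : S, 0 ≤ A i j a b)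
    (hirr : ChainIrreducible (transition A)) (o : S) :
    IsCompact (liftGam A ∩ {q | q.2.2 o = 0}) := by
  have hb := liftGam_bound hA hirr
  obtain ⟨n1, h1⟩ := hb o 1 0 o
  obtain ⟨n2, h2⟩ := hb o (-1) 0 o
  obtain ⟨n3, h3⟩ := hb o 0 1 o
  obtain ⟨n4, h4⟩ := hb o 0 (-1) o
  choose f hf using fun b => hb o 0 0 b
  choose g hg using fun b => hb b 0 0 o
  have hsub : liftGam A ∩ {q | q.2.2 o = 0} ⊆
      Set.Icc ((-n2, -n4, fun b => -g b) : ℝ × ℝ × (S → ℝ)) (n1, n3, fun b => f b) := by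
    rintro q ⟨hq, hq0⟩
    have hq0' : q.2.2 o = 0 := hq0
    have k1 := h1 q hq
    have k2 := h2 q hq
    have k3 := h3 q hq
    have k4 := h4 q hq
    push_cast at k1 k2 k3 k4
    refine ⟨⟨?_, ?_, fun b => ?_⟩, ?_, ?_, fun b => ?_⟩
    · change -n2 ≤ q.1; linarith
    · change -n4 ≤ q.2.1; linarith
    · have := hg b q hq
      push_cast at this
      change -g b ≤ q.2.2 b; linarith
    · change q.1 ≤ n1; linarith
    · change q.2.1 ≤ n3; linarith
    · have := hf b q hq
      push_cast at this
      change q.2.2 b ≤ f b; linarith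
  refine isCompact_Icc.of_isClosed_subset ((isClosed_liftGam A).inter ?_) hsub
  exact isClosed_eq (by fun_prop) continuous_const

/-- The extreme points of `Γ̄` are attained. -/
lemma gam_extremes [Nonempty S] (hA : ∀ i ∈ H, ∀ j ∈ H, ∀ a b : S, 0 ≤ A i j a b)
    (hstoch : ∀ a : S, ∑ b : S, total A a b = 1)
    (hirr : ChainIrreducible (transition A)) :
    (∃ (w : ℝ) (v : S → ℝ), 0 < w ∧ (∀ a, 0 < v a) ∧ creal A (zBar A) w *ᵥ v ≤ v) ∧
    (∃ (w : ℝ) (v : S → ℝ), 0 < w ∧ (∀ a, 0 < v a) ∧ creal A (zLow A) w *ᵥ v ≤ v) ∧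
    ∀ (x w : ℝ) (v : S → ℝ), 0 < x → 0 < w → (∀ a, 0 < v a) → creal A x w *ᵥ v ≤ v →
      x ≤ zBar A := by
  obtain ⟨o⟩ := id ‹Nonempty S›
  have hc := (isCompact_liftGam hA hirr o).image continuous_fst
  have hn : (Prod.fst '' (liftGam A ∩ {q | q.2.2 o = 0})).Nonempty := by
    -- Stochasticity makes the constant vector invariant at `x = w = 1`.
    refine ⟨0, (0, 0, 0), ⟨fun a => ?_, rfl⟩, rfl⟩
    have e : creal A 1 1 = total A := by simp [creal, total]
    simp [e, hstoch a]
  rw [← fst_image_Gam hA hirr o] at hc hn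
  have hex : ∀ s ∈ Prod.fst '' Gam A, ∃ (w : ℝ) (v : S → ℝ), 0 < w ∧ (∀ a, 0 < v a) ∧
      creal A (Real.exp s) w *ᵥ v ≤ v := by
    intro s hs
    rw [fst_image_Gam hA hirr o] at hs
    obtain ⟨⟨s, t, g⟩, ⟨hq, -⟩, rfl⟩ := hs
    exact ⟨Real.exp t, _, Real.exp_pos t, fun a => Real.exp_pos _, mem_liftGam.mp hq⟩
  refine ⟨hex _ (hc.sSup_mem hn), hex _ (hc.sInf_mem hn), ?_⟩
  intro x w v hx hw hv h
  rw [zBar, ← Real.log_le_iff_le_exp hx]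
  refine le_csSup hc.bddAbove ⟨(Real.log x, Real.log w), ?_, rfl⟩
  change chi A (Real.exp (Real.log x)) (Real.exp (Real.log w)) ≤ 1
  rw [Real.exp_log hx, Real.exp_log hw]
  exact chi_le_one_of hA hirr hx hw hv h

lemma zBar_pos (A : ℤ → ℤ → Matrix S S ℝ) : 0 < zBar A := Real.exp_pos _
lemma zLow_pos (A : ℤ → ℤ → Matrix S S ℝ) : 0 < zLow A := Real.exp_pos _

/-- There is no strictly subinvariant vector at the extreme point. -/
lemma no_strict [Nonempty S] (hA : ∀ i ∈ H, ∀ j ∈ H, ∀ a b : S, 0 ≤ A i j a b)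
    (hstoch : ∀ a : S, ∑ b : S, total A a b = 1)
    (hirr : ChainIrreducible (transition A)) {w : ℝ} (hw : 0 < w) {v : S → ℝ}
    (hv : ∀ a, 0 < v a) : ¬ ∀ a, (creal A (zBar A) w *ᵥ v) a < v a := by
  intro h
  have hcont : ∀ a, ContinuousAt (fun x => (creal A x w *ᵥ v) a) (zBar A) := by
    intro a
    simp only [Matrix.mulVec, dotProduct, creal_apply]
    refine tendsto_finsetSum _ fun b _ => Filter.Tendsto.mul_const _ ?_
    refine tendsto_finsetSum _ fun i _ => tendsto_finsetSum _ fun j _ => ?_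
    refine Filter.Tendsto.mul_const _ (Filter.Tendsto.mul_const _ ?_)
    exact continuousAt_zpow₀ _ _ (Or.inl (zBar_pos A).ne')
  have hev : ∀ᶠ x in 𝓝 (zBar A), ∀ a, (creal A x w *ᵥ v) a < v a :=
    Filter.eventually_all.mpr fun a => (hcont a).eventually_lt_const (h a)
  -- Strict inequalities survive a small increase of `x`, against the maximality of `zBar`.
  have hev2 : ∀ᶠ x in 𝓝[>] (zBar A), ∀ a, (creal A x w *ᵥ v) a < v a :=
    hev.filter_mono nhdsWithin_le_nhds
  obtain ⟨x, hx, hxp⟩ := (hev2.and self_mem_nhdsWithin).exists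
  have hxp' : zBar A < x := hxp
  exact absurd ((gam_extremes hA hstoch hirr).2.2 x w v ((zBar_pos A).trans hxp') hw hv
    fun a => (hx a).le) (not_le.mpr hxp')

/-- Fredholm alternative for `M - 1` at a Perron root one. -/
lemma exists_solution [Nonempty S] {M : Matrix S S ℝ} (hi : Irred M)
    {v π : S → ℝ} (hv0 : ∀ a, 0 < v a) (hπ : ∀ a, 0 < π a) (hl : π ᵥ* M = π)
    {y : S → ℝ} (hy : π ⬝ᵥ y = 0) : ∃ d : S → ℝ, M *ᵥ d - d = y := by
  -- The rank-one term makes `M - 1` injective, hence surjective; it vanishes on the solution when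
  -- `π ⬝ᵥ y = 0`.
  set g : (S → ℝ) →ₗ[ℝ] (S → ℝ) :=
    { toFun := fun d => M *ᵥ d - d + (π ⬝ᵥ d) • v
      map_add' := fun a b => by
        rw [Matrix.mulVec_add, dotProduct_add, add_smul]; abel
      map_smul' := fun c a => by
        rw [Matrix.mulVec_smul, dotProduct_smul, RingHom.id_apply, smul_add, smul_sub, smul_assoc] }
    with hg
  have hdot : ∀ d, π ⬝ᵥ (M *ᵥ d - d) = 0 := fun d => by
    rw [dotProduct_sub, Matrix.dotProduct_mulVec, hl, sub_self]
  have hπv : 0 < π ⬝ᵥ v :=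
    Finset.sum_pos (fun a _ => mul_pos (hπ a) (hv0 a)) Finset.univ_nonempty
  have hgd : ∀ d, g d = M *ᵥ d - d + (π ⬝ᵥ d) • v := fun d => rfl
  have hcoef : ∀ d, π ⬝ᵥ g d = (π ⬝ᵥ d) * (π ⬝ᵥ v) := fun d => by
    rw [hgd, dotProduct_add, hdot, zero_add, dotProduct_smul, smul_eq_mul]
  have hinj : Function.Injective g := by
    rw [← LinearMap.ker_eq_bot, LinearMap.ker_eq_bot']
    intro d hd
    have h1 : π ⬝ᵥ d = 0 := by
      have := hcoef d
      rw [hd, dotProduct_zero] at this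
      exact (mul_eq_zero.mp this.symm).resolve_right hπv.ne'
    rw [hgd, h1, zero_smul, add_zero, sub_eq_zero] at hd
    have h2 := perron_simple hi hπ hl (x := fun a => (d a : ℂ)) (by
      ext a
      have := congrFun hd a
      simp only [Matrix.mulVec, dotProduct, Matrix.map_apply] at this ⊢
      exact_mod_cast this) (by
      have : ∑ a, π a * d a = 0 := h1
      rw [← Complex.ofReal_zero, ← this]
      push_cast
      exact Finset.sum_congr rfl fun a _ => mul_comm _ _)
    ext a
    have := congrFun h2 a
    simpa using this
  obtain ⟨d, hd⟩ := (LinearMap.injective_iff_surjective.mp hinj) y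
  refine ⟨d, ?_⟩
  have h1 : π ⬝ᵥ d = 0 := by
    have := hcoef d
    rw [hd, hy] at this
    exact (mul_eq_zero.mp this.symm).resolve_right hπv.ne'
  rw [← hd, hgd, h1, zero_smul, add_zero]

/-- `w ∂C/∂w`. -/
def cderiv (A : ℤ → ℤ → Matrix S S ℝ) (x w : ℝ) : Matrix S S ℝ :=
  w • astar A 1 x - w⁻¹ • astar A (-1) x

lemma cderiv_apply (A : ℤ → ℤ → Matrix S S ℝ) (x w : ℝ) (a b : S) :
    cderiv A x w a b = ∑ i ∈ H, ∑ j ∈ H, x ^ i * w ^ j * A i j a b * (j : ℝ) := by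
  simp only [cderiv, astar, sum_H, Matrix.sub_apply, Matrix.smul_apply, Matrix.add_apply,
    smul_eq_mul, zpow_neg_one, zpow_zero, zpow_one]
  push_cast
  ring

lemma drift₂_eq (x w : ℝ) (π v : S → ℝ) : drift₂ A x w π v = π ⬝ᵥ cderiv A x w *ᵥ v := by
  rw [drift₂, sum_trans]
  simp only [wt, Matrix.mulVec, dotProduct, cderiv_apply, Finset.sum_mul, Finset.mul_sum]
  refine Finset.sum_congr rfl fun a _ => Finset.sum_congr rfl fun b _ =>
    Finset.sum_congr rfl fun i _ => Finset.sum_congr rfl fun j _ => by ring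

/-- With nonzero vertical drift, a first-order change of `w` and of the eigenvector would produce a
strictly subinvariant vector at `zBar`, which `no_strict` forbids. -/
lemma drift₂_eq_zero [Nonempty S] (hA : ∀ i ∈ H, ∀ j ∈ H, ∀ a b : S, 0 ≤ A i j a b)
    (hstoch : ∀ a : S, ∑ b : S, total A a b = 1)
    (hirr : ChainIrreducible (transition A)) {w : ℝ} (hw : 0 < w) {v π : S → ℝ}
    (hv : ∀ a, 0 < v a) (hπ : ∀ a, 0 < π a) (h : creal A (zBar A) w *ᵥ v = v)
    (hl : π ᵥ* creal A (zBar A) w = π) : drift₂ A (zBar A) w π v = 0 := by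
  by_contra hne
  set p := zBar A with hp
  have hp0 : 0 < p := zBar_pos A
  rw [drift₂_eq] at hne
  set y := cderiv A p w *ᵥ v with hy
  set m := π ⬝ᵥ y with hm
  -- The speed of `log w` for which `-1 - e y` is orthogonal to `π`; the direction `d` can then be
  -- solved so that every coordinate of the defect has derivative `-1`.
  set e : ℝ := -(∑ a, π a) / m with he
  obtain ⟨d, hd⟩ := exists_solution (irred_creal hA hirr hp0 hw) hv hπ hl
    (y := fun a => -1 - e * y a) (by
      have : π ⬝ᵥ (fun a => -1 - e * y a) = -(∑ a, π a) - e * m := by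
        simp only [hm, dotProduct, mul_sub, Finset.sum_sub_distrib, Finset.mul_sum]
        congr 1
        · simp
        · exact Finset.sum_congr rfl fun a _ => by ring
      rw [this, he]
      field_simp
      ring)
  set φ : S → ℝ → ℝ := fun a ε =>
    (creal A p (w * Real.exp (e * ε)) *ᵥ fun b => v b + d b * ε) a - (v a + d a * ε) with hφ
  have hder : ∀ a, HasDerivAt (φ a) (-1) 0 := by
    intro a
    have h1 : ∀ b, HasDerivAt (fun ε : ℝ => creal A p (w * Real.exp (e * ε)) a b)
        (e * cderiv A p w a b) 0 := by
      intro b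
      have hx : HasDerivAt (fun ε : ℝ => Real.exp (e * ε)) e 0 := by
        have := ((hasDerivAt_id (0 : ℝ)).const_mul e).exp
        simpa using this
      have hxi : HasDerivAt (fun ε : ℝ => (Real.exp (e * ε))⁻¹) (-e) 0 := by
        have := hx.fun_inv (Real.exp_ne_zero _)
        simpa using this
      have e1 : (fun ε : ℝ => creal A p (w * Real.exp (e * ε)) a b) = fun ε =>
          w⁻¹ * astar A (-1) p a b * (Real.exp (e * ε))⁻¹ + astar A 0 p a b +
            w * astar A 1 p a b * Real.exp (e * ε) := by
        ext ε
        rw [creal_eq]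
        simp only [Matrix.add_apply, Matrix.smul_apply, smul_eq_mul, mul_inv]
        ring
      rw [e1]
      refine (((hxi.const_mul _).add_const _).add (hx.const_mul _)).congr_deriv ?_
      simp only [cderiv, Matrix.sub_apply, Matrix.smul_apply, smul_eq_mul]
      ring
    have h2 : ∀ b, HasDerivAt (fun ε : ℝ => v b + d b * ε) (d b) 0 := fun b => by
      simpa using ((hasDerivAt_id (0 : ℝ)).const_mul (d b)).const_add (v b)
    have h3 := (HasDerivAt.fun_sum (u := Finset.univ) fun b _ => (h1 b).mul (h2 b)).sub (h2 a)
    refine h3.congr_deriv ?_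
    have hd' := congrFun hd a
    simp only [Pi.sub_apply, Matrix.mulVec, dotProduct, hy] at hd'
    simp only [mul_zero, Real.exp_zero, mul_one, add_zero, Finset.sum_add_distrib]
    simp only [mul_assoc, ← Finset.mul_sum]
    linarith
  have hφ0 : ∀ a, φ a 0 = 0 := fun a => by
    have := congrFun h a
    simp [hφ, this]
  have hev : ∀ᶠ ε in 𝓝[>] (0 : ℝ), (∀ a, φ a ε < 0) ∧ ∀ a, 0 < v a + d a * ε := by
    refine (Filter.eventually_all.mpr fun a => ?_).and (Filter.eventually_all.mpr fun a => ?_)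
    · have h1 := (hasDerivAt_iff_tendsto_slope.mp (hder a)).eventually_lt_const
        (show (-1 : ℝ) < 0 by norm_num)
      have h2 := h1.filter_mono (nhdsWithin_mono (0 : ℝ) (fun x (hx : 0 < x) => ne_of_gt hx))
      filter_upwards [h2, self_mem_nhdsWithin] with ε hε hε0
      rw [slope_def_field, hφ0, sub_zero, sub_zero] at hε
      have hε0' : (0 : ℝ) < ε := hε0
      by_contra hcon
      push Not at hcon
      exact absurd hε (not_lt.mpr (div_nonneg hcon hε0'.le))
    · have hc : ContinuousAt (fun ε : ℝ => v a + d a * ε) 0 := by fun_prop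
      exact ((hc.eventually_const_lt (by simpa using hv a)).filter_mono nhdsWithin_le_nhds)
  obtain ⟨ε, hε1, hε2⟩ := hev.exists
  refine no_strict hA hstoch hirr (mul_pos hw (Real.exp_pos (e * ε))) hε2 fun a => ?_
  have := hε1 a
  simp only [hφ] at this
  linarith

/-- The data at the right extreme point of `Γ̄`. -/
lemma exists_extremal [Nonempty S] (hA : ∀ i ∈ H, ∀ j ∈ H, ∀ a b : S, 0 ≤ A i j a b)
    (hstoch : ∀ a : S, ∑ b : S, total A a b = 1)
    (hirr : ChainIrreducible (transition A)) (hlt : zLow A < zBar A) :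
    ∃ (w : ℝ) (v π : S → ℝ), 0 < w ∧ (∀ a, 0 < v a) ∧ (∀ a, 0 < π a) ∧
      creal A (zBar A) w *ᵥ v = v ∧ π ᵥ* creal A (zBar A) w = π ∧
      drift₂ A (zBar A) w π v = 0 ∧ 0 < drift₁ A (zBar A) w π v := by
  obtain ⟨⟨w, v, hw, hv, h⟩, ⟨w', v', hw', hv', h'⟩, -⟩ := gam_extremes hA hstoch hirr
  have hp0 := zBar_pos A
  have hi := irred_creal hA hirr hp0 hw
  -- A subinvariant vector that is not invariant improves to a strict one, excluded at `zBar`.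
  have heq : creal A (zBar A) w *ᵥ v = v := by
    by_contra hne
    obtain ⟨v'', hv'', hs⟩ := irred_strict hi hv (c := 1) (by rwa [one_smul]) (by rwa [one_smul])
    exact no_strict hA hstoch hirr hw hv'' fun a => by simpa using hs a
  obtain ⟨π, hπ, hl⟩ := exists_left (creal_nonneg hA hp0 hw) hi hv (c := 1) (by rwa [one_smul])
  rw [one_smul] at hl
  have h2 := drift₂_eq_zero hA hstoch hirr hw hv hπ heq hl
  refine ⟨w, v, π, hw, hv, hπ, heq, hl, h2, ?_⟩
  -- The gradient inequality toward the left extreme point; the logarithm of `zLow / zBar` is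
  -- negative.
  have h3 := drift_lt hA hirr hp0 hw (zLow_pos A) hw' hπ hv hv' heq hl h' (fun h => hlt.ne h.1)
  rw [h2, mul_zero, add_zero] at h3
  have h4 : Real.log (zLow A / zBar A) < 0 :=
    Real.log_neg (div_pos (zLow_pos A) hp0) ((div_lt_one hp0).mpr hlt)
  by_contra h5
  nlinarith

end Extremal

/-! ### First passage sums as a recursion -/

section Passage
variable {S : Type*} [Fintype S] [DecidableEq S]

/-- Weighted first passage sums: `passage n m` collects the paths of length `n` which reach the
level `m` steps below for the first time at time `n`. -/
def passage {R : Type*} [Semiring R] (Bm B0 Bp : Matrix S S R) : ℕ → ℕ → Matrix S S R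
  | 0, 0 => 1
  | 0, _ + 1 => 0
  | _ + 1, 0 => 0
  | n + 1, m + 1 => Bm * passage Bm B0 Bp n m + B0 * passage Bm B0 Bp n (m + 1)
      + Bp * passage Bm B0 Bp n (m + 2)

lemma passage_succ_succ {R : Type*} [Semiring R] (Bm B0 Bp : Matrix S S R) (n m : ℕ) :
    passage Bm B0 Bp (n + 1) (m + 1) = Bm * passage Bm B0 Bp n m
      + B0 * passage Bm B0 Bp n (m + 1) + Bp * passage Bm B0 Bp n (m + 2) := by
  rw [passage]

/-- Levels are not skipped on the way down, so a passage of depth `m + m'` splits uniquely at its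
first visit to depth `m`. -/
lemma passage_add {R : Type*} [Semiring R] (Bm B0 Bp : Matrix S S R) (n m m' : ℕ) :
    passage Bm B0 Bp n (m + m') = ∑ q ∈ Finset.HasAntidiagonal.antidiagonal n,
      passage Bm B0 Bp q.1 m * passage Bm B0 Bp q.2 m' := by
  induction n generalizing m with
  | zero =>
    cases m with
    | zero => simp [passage]
    | succ m => rw [show m + 1 + m' = (m + m') + 1 by ring]; simp [passage]
  | succ n ih =>
    cases m with
    | zero => simp [passage, Finset.Nat.antidiagonal_succ]
    | succ m =>
      rw [show m + 1 + m' = (m + m') + 1 by ring, passage_succ_succ,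
        Finset.Nat.antidiagonal_succ, Finset.sum_cons, Finset.sum_map]
      simp only [Function.Embedding.coe_prodMap, Function.Embedding.coeFn_mk, Prod.map_fst,
        Prod.map_snd, Function.Embedding.refl_apply, Nat.succ_eq_add_one]
      rw [show passage Bm B0 Bp 0 (m + 1) = 0 from by rw [passage], zero_mul, zero_add,
        ih m, show m + m' + 1 = (m + 1) + m' by ring, ih (m + 1),
        show m + m' + 2 = (m + 2) + m' by ring, ih (m + 2)]
      simp only [passage_succ_succ, add_mul, Finset.sum_add_distrib, Finset.mul_sum, mul_assoc]

lemma passage_nonneg {Bm B0 Bp : Matrix S S ℝ} (hm : ∀ a b, 0 ≤ Bm a b) (h0 : ∀ a b, 0 ≤ B0 a b)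
    (hp : ∀ a b, 0 ≤ Bp a b) (n m : ℕ) (a b : S) : 0 ≤ passage Bm B0 Bp n m a b := by
  induction n generalizing m a b with
  | zero =>
    cases m with
    | zero => rw [passage, Matrix.one_apply]; split_ifs <;> norm_num
    | succ m => rw [passage]; simp
  | succ n ih =>
    cases m with
    | zero => rw [passage]; simp
    | succ m =>
      rw [passage_succ_succ]
      simp only [Matrix.add_apply, Matrix.mul_apply]
      refine add_nonneg (add_nonneg ?_ ?_) ?_
      · exact Finset.sum_nonneg fun c _ => mul_nonneg (hm a c) (ih m c b)
      · exact Finset.sum_nonneg fun c _ => mul_nonneg (h0 a c) (ih _ c b)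
      · exact Finset.sum_nonneg fun c _ => mul_nonneg (hp a c) (ih _ c b)

lemma norm_mul_apply_le {𝕜 : Type*} [RCLike 𝕜] {X Y : Matrix S S 𝕜} {X' Y' : Matrix S S ℝ}
    (hX : ∀ a b, ‖X a b‖ ≤ X' a b) (hY : ∀ a b, ‖Y a b‖ ≤ Y' a b) (a b : S) :
    ‖(X * Y) a b‖ ≤ (X' * Y') a b := by
  rw [Matrix.mul_apply, Matrix.mul_apply]
  refine (norm_sum_le _ _).trans (Finset.sum_le_sum fun c _ => ?_)
  rw [norm_mul]
  exact mul_le_mul (hX a c) (hY c b) (norm_nonneg _) ((norm_nonneg _).trans (hX a c))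

lemma norm_passage_le {𝕜 : Type*} [RCLike 𝕜] {Cm C0 Cp : Matrix S S 𝕜} {Bm B0 Bp : Matrix S S ℝ}
    (hm : ∀ a b, ‖Cm a b‖ ≤ Bm a b) (h0 : ∀ a b, ‖C0 a b‖ ≤ B0 a b)
    (hp : ∀ a b, ‖Cp a b‖ ≤ Bp a b) (n m : ℕ) (a b : S) :
    ‖passage Cm C0 Cp n m a b‖ ≤ passage Bm B0 Bp n m a b := by
  induction n generalizing m a b with
  | zero =>
    cases m with
    | zero => rw [passage, passage, Matrix.one_apply, Matrix.one_apply]; split_ifs <;> simp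
    | succ m => rw [passage, passage]; simp
  | succ n ih =>
    cases m with
    | zero => rw [passage, passage]; simp
    | succ m =>
      rw [passage_succ_succ, passage_succ_succ]
      simp only [Matrix.add_apply]
      refine (norm_add_le _ _).trans (add_le_add ((norm_add_le _ _).trans (add_le_add ?_ ?_)) ?_)
      · exact norm_mul_apply_le hm (ih _) a b
      · exact norm_mul_apply_le h0 (ih _) a b
      · exact norm_mul_apply_le hp (ih _) a b

lemma passage_map (Bm B0 Bp : Matrix S S ℝ) (n m : ℕ) :
    passage (Bm.map (fun a : ℝ => (a : ℂ))) (B0.map (fun a : ℝ => (a : ℂ)))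
      (Bp.map (fun a : ℝ => (a : ℂ))) n m
      = (passage Bm B0 Bp n m).map (fun a : ℝ => (a : ℂ)) := by
  have hmul : ∀ X Y : Matrix S S ℝ, (X * Y).map (fun a : ℝ => (a : ℂ))
      = X.map (fun a : ℝ => (a : ℂ)) * Y.map (fun a : ℝ => (a : ℂ)) := fun X Y =>
    Matrix.map_mul (f := Complex.ofRealHom)
  have hadd : ∀ X Y : Matrix S S ℝ, (X + Y).map (fun a : ℝ => (a : ℂ))
      = X.map (fun a : ℝ => (a : ℂ)) + Y.map (fun a : ℝ => (a : ℂ)) := fun X Y => by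
    ext a b; simp
  induction n generalizing m with
  | zero =>
    cases m with
    | zero => rw [passage, passage, Matrix.map_one _ Complex.ofReal_zero Complex.ofReal_one]
    | succ m => rw [passage, passage]; ext a b; simp
  | succ n ih =>
    cases m with
    | zero => rw [passage, passage]; ext a b; simp
    | succ m => rw [passage_succ_succ, passage_succ_succ, ih, ih, ih, hadd, hadd, hmul, hmul, hmul]

/-- First passage sums are bounded by subinvariant vectors. -/
lemma sum_passage_le {Bm B0 Bp : Matrix S S ℝ} (hm : ∀ a b, 0 ≤ Bm a b) (h0 : ∀ a b, 0 ≤ B0 a b)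
    (hp : ∀ a b, 0 ≤ Bp a b) {v : S → ℝ} (hv : ∀ a, 0 < v a) {w : ℝ} (hw : 0 < w)
    (h : (w⁻¹ • Bm + B0 + w • Bp) *ᵥ v ≤ v) (N m : ℕ) :
    (∑ n ∈ Finset.range N, passage Bm B0 Bp n m) *ᵥ v ≤ w ^ m • v := by
  induction N generalizing m with
  | zero =>
    intro a
    simpa using mul_nonneg (pow_pos hw m).le (hv a).le
  | succ N ih =>
    rw [Finset.sum_range_succ']
    cases m with
    | zero =>
      simp [passage]
    | succ m =>
      rw [show passage Bm B0 Bp 0 (m + 1) = 0 from by rw [passage], add_zero]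
      simp only [passage_succ_succ, Finset.sum_add_distrib, ← Finset.mul_sum]
      simp only [Matrix.add_mulVec, ← Matrix.mulVec_mulVec]
      -- The powers of `w` distribute so that subinvariance is exactly what closes the first-step
      -- recursion.
      have e : w ^ (m + 1) • ((w⁻¹ • Bm + B0 + w • Bp) *ᵥ v)
          = Bm *ᵥ (w ^ m • v) + B0 *ᵥ (w ^ (m + 1) • v) + Bp *ᵥ (w ^ (m + 2) • v) := by
        simp only [Matrix.add_mulVec, Matrix.smul_mulVec, Matrix.mulVec_smul, smul_add, smul_smul]
        rw [show w ^ (m + 1) * w⁻¹ = w ^ m by field_simp; ring,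
          show w ^ (m + 1) * w = w ^ (m + 2) by ring]
      refine le_trans (add_le_add (add_le_add (mulVec_mono hm (ih m)) (mulVec_mono h0 (ih _)))
        (mulVec_mono hp (ih _))) ?_
      rw [← e]
      exact smul_le_smul_of_nonneg_left h (pow_pos hw _).le

lemma passage_sum_apply_le {Bm B0 Bp : Matrix S S ℝ} (hm : ∀ a b, 0 ≤ Bm a b)
    (h0 : ∀ a b, 0 ≤ B0 a b)
    (hp : ∀ a b, 0 ≤ Bp a b) {v : S → ℝ} (hv : ∀ a, 0 < v a) {w : ℝ} (hw : 0 < w)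
    (h : (w⁻¹ • Bm + B0 + w • Bp) *ᵥ v ≤ v) (N : ℕ) (a b : S) :
    ∑ n ∈ Finset.range N, passage Bm B0 Bp n 1 a b ≤ w * v a / v b := by
  have h1 := sum_passage_le hm h0 hp hv hw h N 1 a
  rw [le_div_iff₀ (hv b)]
  simp only [pow_one, Pi.smul_apply, smul_eq_mul, Matrix.mulVec, dotProduct, Matrix.sum_apply] at h1
  refine le_trans ?_ h1
  exact Finset.single_le_sum (f := fun b => (∑ n ∈ Finset.range N, passage Bm B0 Bp n 1 a b) * v b)
    (fun b _ => mul_nonneg (Finset.sum_nonneg fun n _ => passage_nonneg hm h0 hp n 1 a b) (hv b).le)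
    (Finset.mem_univ b)

lemma summable_passage {Bm B0 Bp : Matrix S S ℝ} (hm : ∀ a b, 0 ≤ Bm a b)
    (h0 : ∀ a b, 0 ≤ B0 a b)
    (hp : ∀ a b, 0 ≤ Bp a b) {v : S → ℝ} (hv : ∀ a, 0 < v a) {w : ℝ} (hw : 0 < w)
    (h : (w⁻¹ • Bm + B0 + w • Bp) *ᵥ v ≤ v) (a b : S) :
    Summable fun n => passage Bm B0 Bp n 1 a b :=
  summable_of_sum_range_le (fun n => passage_nonneg hm h0 hp n 1 a b)
    fun N => passage_sum_apply_le hm h0 hp hv hw h N a b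

attribute [local instance] Matrix.linftyOpNormedRing Matrix.linftyOpNormedAlgebra

lemma summable_norm_matrix {𝕜 : Type*} [RCLike 𝕜] {f : ℕ → Matrix S S 𝕜}
    (h : ∀ a b, Summable fun n => ‖f n a b‖) : Summable fun n => ‖f n‖ := by
  have h1 : Summable fun n => ∑ a, ∑ b, ‖f n a b‖ :=
    summable_sum fun a _ => summable_sum fun b _ => h a b
  refine Summable.of_nonneg_of_le (fun n => norm_nonneg _) (fun n => ?_) h1
  rw [Matrix.linfty_opNorm_def]
  have : (Finset.univ.sup fun i => ∑ j, ‖f n i j‖₊) ≤ ∑ a, ∑ b, ‖f n a b‖₊ :=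
    Finset.sup_le fun a _ => Finset.single_le_sum (f := fun a => ∑ b, ‖f n a b‖₊)
      (fun _ _ => zero_le) (Finset.mem_univ a)
  exact (NNReal.coe_le_coe.mpr this).trans_eq (by push_cast; rfl)

lemma tsum_matrix_apply {𝕜 : Type*} [RCLike 𝕜] {f : ℕ → Matrix S S 𝕜}
    (h : Summable f) (a b : S) : (∑' n, f n) a b = ∑' n, f n a b := by
  have h1 : HasSum (fun n => f n a) ((∑' n, f n) a) := (Pi.hasSum.mp h.hasSum) a
  exact ((Pi.hasSum.mp h1) b).tsum_eq.symm

/-- The generating sum of first passages solves the quadratic equation. -/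
lemma passage_tsum_quadratic {𝕜 : Type*} [RCLike 𝕜] {Bm B0 Bp : Matrix S S 𝕜}
    (h : ∀ a b, Summable fun n => ‖passage Bm B0 Bp n 1 a b‖) :
    Bm + B0 * (∑' n, passage Bm B0 Bp n 1) + Bp * (∑' n, passage Bm B0 Bp n 1) ^ 2
      = ∑' n, passage Bm B0 Bp n 1 := by
  have hn := summable_norm_matrix h
  have hs : Summable fun n => passage Bm B0 Bp n 1 := hn.of_norm
  have h2 : ∀ n, passage Bm B0 Bp n 2 = ∑ q ∈ Finset.HasAntidiagonal.antidiagonal n,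
      passage Bm B0 Bp q.1 1 * passage Bm B0 Bp q.2 1 := fun n => passage_add Bm B0 Bp n 1 1
  have hs2 : Summable fun n => passage Bm B0 Bp n 2 := by
    simp only [h2]
    exact (summable_norm_sum_mul_antidiagonal_of_summable_norm hn hn).of_norm
  -- By `passage_add`, the series for two levels is the Cauchy product of the series for one level
  -- with itself.
  have e2 : (∑' n, passage Bm B0 Bp n 1) ^ 2 = ∑' n, passage Bm B0 Bp n 2 := by
    rw [pow_two]
    exact (tsum_mul_tsum_eq_tsum_sum_antidiagonal_of_summable_norm hn hn).trans
      (tsum_congr fun n => (h2 n).symm)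
  have hs0 : HasSum (fun n => passage Bm B0 Bp n 0) 1 := by
    have := hasSum_single (f := fun n => passage Bm B0 Bp n 0) 0 (fun n hn => by
      obtain ⟨k, rfl⟩ := Nat.exists_eq_succ_of_ne_zero hn
      rw [passage])
    simpa [passage] using this
  rw [e2]
  have e0 : passage Bm B0 Bp 0 1 = 0 := by rw [passage]
  conv_rhs => rw [hs.tsum_eq_zero_add, e0, zero_add]
  simp only [passage_succ_succ]
  have hA := hs0.mul_left Bm
  have hB := hs.hasSum.mul_left B0
  have hC := hs2.hasSum.mul_left Bp
  rw [((hA.add hB).add hC).tsum_eq, mul_one]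

end Passage

/-! ### The path sums `D1` agree with the recursion -/

section PathSums
variable {S : Type*} [Fintype S] [DecidableEq S]

/-- First passage to the level `-m` at time `n`. -/
def hits (n : ℕ) (m : ℤ) (f : Fin n → ℤ) : Prop :=
  (∀ k : ℕ, k < n → 1 ≤ m + ∑ l : Fin n, if (l : ℕ) < k then f l else 0) ∧ ∑ l : Fin n, f l = -m

/-- The clause `k = 0` of `hits` says `1 ≤ m`; the later clauses are those of the path after its
first step, started at `m + i`. -/
lemma hits_cons (n : ℕ) (m i : ℤ) (f : Fin n → ℤ) :
    hits (n + 1) m (Fin.cons i f) ↔ 1 ≤ m ∧ hits n (m + i) f := by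
  have hs : ∀ k : ℕ, (∑ l : Fin (n + 1), if (l : ℕ) < k + 1 then (Fin.cons i f : Fin (n + 1) → ℤ) l
      else 0) = i + ∑ l : Fin n, if (l : ℕ) < k then f l else 0 := fun k => by
    rw [Fin.sum_univ_succ]
    simp
  simp only [hits]
  rw [Fin.sum_univ_succ]
  simp only [Fin.cons_zero, Fin.cons_succ]
  constructor
  · rintro ⟨h1, h2⟩
    refine ⟨by simpa using h1 0 (Nat.succ_pos n), fun k hk => ?_, by linarith⟩
    have := h1 (k + 1) (by omega)
    rw [hs] at this
    linarith
  · rintro ⟨h0, h1, h2⟩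
    refine ⟨fun k hk => ?_, by linarith⟩
    cases k with
    | zero => simpa using h0
    | succ k =>
      rw [hs]
      have := h1 k (by omega)
      linarith

lemma sum_piFinset_succ {M : Type*} [AddCommMonoid M] (n : ℕ) (g : (Fin (n + 1) → ℤ) → M) :
    ∑ f ∈ Fintype.piFinset (fun _ : Fin (n + 1) => H), g f
      = ∑ i ∈ H, ∑ f ∈ Fintype.piFinset (fun _ : Fin n => H), g (Fin.cons i f) := by
  rw [← Finset.sum_product']
  symm
  refine Finset.sum_nbij' (fun q => Fin.cons q.1 q.2) (fun f => (f 0, Fin.tail f)) ?_ ?_ ?_ ?_ ?_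
  · rintro ⟨i, f⟩ hq
    simp only [Finset.mem_product, Fintype.mem_piFinset] at hq ⊢
    intro l
    refine Fin.cases ?_ (fun l => ?_) l
    · simpa using hq.1
    · simpa using hq.2 l
  · intro f hf
    simp only [Finset.mem_product, Fintype.mem_piFinset] at hf ⊢
    exact ⟨hf 0, fun l => hf l.succ⟩
  · rintro ⟨i, f⟩ _
    simp
  · intro f _
    simp
  · rintro ⟨i, f⟩ _
    rfl

open Classical in
lemma pathSum_eq_passage (A : ℤ → ℤ → Matrix S S ℝ) (z : ℂ) (n m : ℕ) :
    ∑ f ∈ Fintype.piFinset (fun _ : Fin n => H), (if hits n m f then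
      (List.ofFn (fun l : Fin n => Astar A (f l) z)).prod else 0)
      = passage (Astar A (-1) z) (Astar A 0 z) (Astar A 1 z) n m := by
  induction n generalizing m with
  | zero =>
    cases m with
    | zero => simp [passage, hits]
    | succ m =>
      have : ¬ (0 : ℤ) = -1 + -(m : ℤ) := by omega
      simp [passage, hits, this]
  | succ n ih =>
    rw [sum_piFinset_succ]
    cases m with
    | zero => simp [hits_cons, passage]
    | succ m =>
      have h1 : ∀ i : ℤ, ∀ m' : ℕ, ((m + 1 : ℕ) : ℤ) + i = m' →
          ∑ f ∈ Fintype.piFinset (fun _ : Fin n => H),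
          (if hits (n + 1) ((m + 1 : ℕ) : ℤ) (Fin.cons i f) then
          (List.ofFn (fun l : Fin (n + 1) =>
            Astar A ((Fin.cons i f : Fin (n + 1) → ℤ) l) z)).prod else 0)
          = Astar A i z * passage (Astar A (-1) z) (Astar A 0 z) (Astar A 1 z) n m' := by
        intro i m' him
        rw [← ih, Finset.mul_sum]
        refine Finset.sum_congr rfl fun f _ => ?_
        rw [hits_cons, him, List.ofFn_succ, List.prod_cons]
        have : (1 : ℤ) ≤ ((m + 1 : ℕ) : ℤ) := by push_cast; omega
        simp only [this, true_and, Fin.cons_zero, Fin.cons_succ, mul_ite, mul_zero]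
      rw [sum_H, h1 (-1) m (by push_cast; ring), h1 0 (m + 1) (by simp),
        h1 1 (m + 2) (by push_cast; ring), passage_succ_succ]

/-- Starting at height one turns "partial sums nonnegative" into "height at least one", and the
extra clause at `k = 0` holds trivially. -/
lemma D1_eq_passage (A : ℤ → ℤ → Matrix S S ℝ) (n : ℕ) (z : ℂ) :
    D1 A n z = passage (Astar A (-1) z) (Astar A 0 z) (Astar A 1 z) n 1 := by
  classical
  rw [← pathSum_eq_passage, D1, downSeqs, Finset.sum_filter]
  refine Finset.sum_congr rfl fun f _ => ?_
  have : ((∀ k : ℕ, 1 ≤ k → k < n → 0 ≤ ∑ l : Fin n, if (l : ℕ) < k then f l else 0) ∧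
      ∑ l : Fin n, f l = -1) ↔ hits n ((1 : ℕ) : ℤ) f := by
    simp only [hits, Nat.cast_one]
    refine and_congr_left fun _ => ⟨fun h k hk => ?_, fun h k _ hk => ?_⟩
    · rcases Nat.eq_zero_or_pos k with rfl | hk0
      · simp
      · have := h k hk0 hk
        linarith
    · have := h k hk
      linarith
  simp only [this]

end PathSums

/-! ### Convergence, continuity and analyticity of `G₁` -/

section GMatrix
variable {S : Type*} [Fintype S] [DecidableEq S] {A : ℤ → ℤ → Matrix S S ℝ}

/-- Real first passage sums at the point `x`. -/
def passR (A : ℤ → ℤ → Matrix S S ℝ) (x : ℝ) (n m : ℕ) : Matrix S S ℝ :=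
  passage (astar A (-1) x) (astar A 0 x) (astar A 1 x) n m

/-- Complex first passage sums at the point `z`. -/
def passC (A : ℤ → ℤ → Matrix S S ℝ) (z : ℂ) (n m : ℕ) : Matrix S S ℂ :=
  passage (Astar A (-1) z) (Astar A 0 z) (Astar A 1 z) n m

/-- The real form of `G1`. -/
def greal (A : ℤ → ℤ → Matrix S S ℝ) (x : ℝ) : Matrix S S ℝ := ∑' n, passR A x n 1

lemma neg_one_mem_H : (-1 : ℤ) ∈ H := by simp [H]
lemma zero_mem_H : (0 : ℤ) ∈ H := by simp [H]
lemma one_mem_H : (1 : ℤ) ∈ H := by simp [H]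

lemma astar_apply (A : ℤ → ℤ → Matrix S S ℝ) (j : ℤ) (x : ℝ) (a b : S) :
    astar A j x a b = ∑ i ∈ H, x ^ i * A i j a b := by
  simp [astar, Matrix.sum_apply]

lemma Astar_apply (A : ℤ → ℤ → Matrix S S ℝ) (j : ℤ) (z : ℂ) (a b : S) :
    Astar A j z a b = ∑ i ∈ H, z ^ i * (A i j a b : ℂ) := by
  simp [Astar, Matrix.sum_apply]

lemma norm_Astar_le (hA : ∀ i ∈ H, ∀ j ∈ H, ∀ a b : S, 0 ≤ A i j a b) {j : ℤ} (hj : j ∈ H)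
    (z : ℂ) (a b : S) : ‖Astar A j z a b‖ ≤ astar A j ‖z‖ a b := by
  rw [Astar_apply, astar_apply]
  refine (norm_sum_le _ _).trans (Finset.sum_le_sum fun i hi => ?_)
  rw [norm_mul, norm_zpow, Complex.norm_real, Real.norm_of_nonneg (hA i hi j hj a b)]

lemma zpow_le_add {x₁ x x₂ : ℝ} (h0 : 0 < x₁) (h1 : x₁ ≤ x) (h2 : x ≤ x₂) (k : ℤ) :
    x ^ k ≤ x₁ ^ k + x₂ ^ k := by
  have hx : 0 < x := h0.trans_le h1
  have hx2 : 0 < x₂ := hx.trans_le h2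
  rcases le_or_gt 0 k with hk | hk
  · have := zpow_le_zpow_left₀ hk hx.le h2
    linarith [zpow_pos h0 k]
  · have : x ^ k ≤ x₁ ^ k := by
      rw [← neg_neg k, zpow_neg, zpow_neg x₁]
      exact inv_anti₀ (zpow_pos h0 _) (zpow_le_zpow_left₀ (by omega) h0.le h1)
    linarith [zpow_pos hx2 k]

/-- Nonnegative Laurent polynomials are dominated by their values at the ends of an interval. -/
lemma zpow_mul_passR_le (hA : ∀ i ∈ H, ∀ j ∈ H, ∀ a b : S, 0 ≤ A i j a b)
    {x₁ x x₂ : ℝ} (h0 : 0 < x₁) (h1 : x₁ ≤ x) (h2 : x ≤ x₂) (n m : ℕ) (a b : S) (k : ℤ) :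
    x ^ k * passR A x n m a b ≤ x₁ ^ k * passR A x₁ n m a b + x₂ ^ k * passR A x₂ n m a b := by
  have hx : 0 < x := h0.trans_le h1
  have hx2 : 0 < x₂ := hx.trans_le h2
  unfold passR
  -- The free exponent `k` absorbs the power `x ^ i` brought in by each step, so the induction
  -- closes on monomials.
  induction n generalizing m a b k with
  | zero =>
    cases m with
    | zero =>
      simp only [passage, Matrix.one_apply]
      split_ifs
      · simpa using zpow_le_add h0 h1 h2 k
      · simp
    | succ m => simp [passage]
  | succ n ih =>
    cases m with
    | zero => simp [passage]
    | succ m =>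
      have e : ∀ (j : ℤ) (m' : ℕ) (y : ℝ), 0 < y →
          y ^ k * (astar A j y * passR A y n m') a b
            = ∑ c, ∑ i ∈ H, A i j a c * (y ^ (k + i) * passR A y n m' c b) := by
        intro j m' y hy
        rw [Matrix.mul_apply, Finset.mul_sum]
        refine Finset.sum_congr rfl fun c _ => ?_
        rw [astar_apply, Finset.sum_mul, Finset.mul_sum]
        refine Finset.sum_congr rfl fun i _ => ?_
        rw [zpow_add₀ hy.ne']
        ring
      have key : ∀ j ∈ H, ∀ m' : ℕ, x ^ k * (astar A j x * passR A x n m') a b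
          ≤ x₁ ^ k * (astar A j x₁ * passR A x₁ n m') a b
            + x₂ ^ k * (astar A j x₂ * passR A x₂ n m') a b := by
        intro j hj m'
        rw [e j m' x hx, e j m' x₁ h0, e j m' x₂ hx2, ← Finset.sum_add_distrib]
        refine Finset.sum_le_sum fun c _ => ?_
        rw [← Finset.sum_add_distrib]
        refine Finset.sum_le_sum fun i hi => ?_
        rw [← mul_add]
        exact mul_le_mul_of_nonneg_left (ih m' c b (k + i)) (hA i hi j hj a c)
      have k1 := key (-1) neg_one_mem_H m
      have k2 := key 0 zero_mem_H (m + 1)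
      have k3 := key 1 one_mem_H (m + 2)
      unfold passR at k1 k2 k3
      simp only [passage_succ_succ, Matrix.add_apply, mul_add]
      linarith

lemma passR_nonneg (hA : ∀ i ∈ H, ∀ j ∈ H, ∀ a b : S, 0 ≤ A i j a b) {x : ℝ} (hx : 0 < x)
    (n m : ℕ) (a b : S) : 0 ≤ passR A x n m a b :=
  passage_nonneg (astar_nonneg hA neg_one_mem_H hx) (astar_nonneg hA zero_mem_H hx)
    (astar_nonneg hA one_mem_H hx) n m a b

lemma passR_le (hA : ∀ i ∈ H, ∀ j ∈ H, ∀ a b : S, 0 ≤ A i j a b)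
    {x₁ x x₂ : ℝ} (h0 : 0 < x₁) (h1 : x₁ ≤ x) (h2 : x ≤ x₂) (n m : ℕ) (a b : S) :
    passR A x n m a b ≤ passR A x₁ n m a b + passR A x₂ n m a b := by
  simpa using zpow_mul_passR_le hA h0 h1 h2 n m a b 0

lemma norm_passC_le (hA : ∀ i ∈ H, ∀ j ∈ H, ∀ a b : S, 0 ≤ A i j a b) (z : ℂ) (n m : ℕ) (a b : S) :
    ‖passC A z n m a b‖ ≤ passR A ‖z‖ n m a b :=
  norm_passage_le (norm_Astar_le hA neg_one_mem_H z) (norm_Astar_le hA zero_mem_H z)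
    (norm_Astar_le hA one_mem_H z) n m a b

lemma summable_passR_of (hA : ∀ i ∈ H, ∀ j ∈ H, ∀ a b : S, 0 ≤ A i j a b) {x w : ℝ}
    (hx : 0 < x) (hw : 0 < w) {v : S → ℝ} (hv : ∀ a, 0 < v a) (h : creal A x w *ᵥ v ≤ v) (a b : S) :
    Summable fun n => passR A x n 1 a b :=
  summable_passage (astar_nonneg hA neg_one_mem_H hx) (astar_nonneg hA zero_mem_H hx)
    (astar_nonneg hA one_mem_H hx) hv hw (by rwa [← creal_eq]) a b

variable [Nonempty S]

/-- The summable bound for the first passage series on the closed annulus. -/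
lemma summable_bound (hA : ∀ i ∈ H, ∀ j ∈ H, ∀ a b : S, 0 ≤ A i j a b)
    (hstoch : ∀ a : S, ∑ b : S, total A a b = 1)
    (hirr : ChainIrreducible (transition A)) (a b : S) :
    Summable fun n => passR A (zLow A) n 1 a b + passR A (zBar A) n 1 a b := by
  obtain ⟨⟨w, v, hw, hv, h⟩, ⟨w', v', hw', hv', h'⟩, -⟩ := gam_extremes hA hstoch hirr
  exact (summable_passR_of hA (zLow_pos A) hw' hv' h' a b).add
    (summable_passR_of hA (zBar_pos A) hw hv h a b)

lemma norm_passC_le_bound (hA : ∀ i ∈ H, ∀ j ∈ H, ∀ a b : S, 0 ≤ A i j a b) {z : ℂ}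
    (h1 : zLow A ≤ ‖z‖) (h2 : ‖z‖ ≤ zBar A) (n m : ℕ) (a b : S) :
    ‖passC A z n m a b‖ ≤ passR A (zLow A) n m a b + passR A (zBar A) n m a b :=
  (norm_passC_le hA z n m a b).trans (passR_le hA (zLow_pos A) h1 h2 n m a b)

lemma summable_passR (hA : ∀ i ∈ H, ∀ j ∈ H, ∀ a b : S, 0 ≤ A i j a b)
    (hstoch : ∀ a : S, ∑ b : S, total A a b = 1)
    (hirr : ChainIrreducible (transition A)) {x : ℝ} (h1 : zLow A ≤ x) (h2 : x ≤ zBar A) (a b : S) :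
    Summable fun n => passR A x n 1 a b :=
  Summable.of_nonneg_of_le (fun n => passR_nonneg hA ((zLow_pos A).trans_le h1) n 1 a b)
    (fun n => passR_le hA (zLow_pos A) h1 h2 n 1 a b) (summable_bound hA hstoch hirr a b)

lemma summable_norm_passC (hA : ∀ i ∈ H, ∀ j ∈ H, ∀ a b : S, 0 ≤ A i j a b)
    (hstoch : ∀ a : S, ∑ b : S, total A a b = 1)
    (hirr : ChainIrreducible (transition A)) {z : ℂ}
    (h1 : zLow A ≤ ‖z‖) (h2 : ‖z‖ ≤ zBar A) (a b : S) :
    Summable fun n => ‖passC A z n 1 a b‖ :=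
  Summable.of_nonneg_of_le (fun _ => norm_nonneg _)
    (fun n => norm_passC_le_bound hA h1 h2 n 1 a b) (summable_bound hA hstoch hirr a b)

attribute [local instance] Matrix.linftyOpNormedRing Matrix.linftyOpNormedAlgebra

/-- The series of `G1` starts at length one; the added term of length zero vanishes. -/
lemma G1_eq_tsum (hA : ∀ i ∈ H, ∀ j ∈ H, ∀ a b : S, 0 ≤ A i j a b)
    (hstoch : ∀ a : S, ∑ b : S, total A a b = 1)
    (hirr : ChainIrreducible (transition A)) {z : ℂ}
    (h1 : zLow A ≤ ‖z‖) (h2 : ‖z‖ ≤ zBar A) : G1 A z = ∑' n, passC A z n 1 := by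
  have hs : Summable fun n => passC A z n 1 :=
    (summable_norm_matrix (summable_norm_passC hA hstoch hirr h1 h2)).of_norm
  rw [hs.tsum_eq_zero_add, show passC A z 0 1 = 0 by rw [passC, passage], zero_add]
  simp only [G1, D1_eq_passage, passC]

lemma G1_apply (hA : ∀ i ∈ H, ∀ j ∈ H, ∀ a b : S, 0 ≤ A i j a b)
    (hstoch : ∀ a : S, ∑ b : S, total A a b = 1)
    (hirr : ChainIrreducible (transition A)) {z : ℂ}
    (h1 : zLow A ≤ ‖z‖) (h2 : ‖z‖ ≤ zBar A) (a b : S) : G1 A z a b = ∑' n, passC A z n 1 a b := by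
  have hs : Summable fun n => passC A z n 1 :=
    (summable_norm_matrix (summable_norm_passC hA hstoch hirr h1 h2)).of_norm
  rw [G1_eq_tsum hA hstoch hirr h1 h2, tsum_matrix_apply hs]

lemma summable_passR_matrix (hA : ∀ i ∈ H, ∀ j ∈ H, ∀ a b : S, 0 ≤ A i j a b)
    (hstoch : ∀ a : S, ∑ b : S, total A a b = 1)
    (hirr : ChainIrreducible (transition A)) {x : ℝ} (h1 : zLow A ≤ x) (h2 : x ≤ zBar A) :
    Summable fun n => passR A x n 1 :=
  (summable_norm_matrix fun a b => (summable_passR hA hstoch hirr h1 h2 a b).norm).of_norm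

lemma greal_apply (hA : ∀ i ∈ H, ∀ j ∈ H, ∀ a b : S, 0 ≤ A i j a b)
    (hstoch : ∀ a : S, ∑ b : S, total A a b = 1)
    (hirr : ChainIrreducible (transition A)) {x : ℝ} (h1 : zLow A ≤ x) (h2 : x ≤ zBar A) (a b : S) :
    greal A x a b = ∑' n, passR A x n 1 a b :=
  tsum_matrix_apply (summable_passR_matrix hA hstoch hirr h1 h2) a b

lemma greal_nonneg (hA : ∀ i ∈ H, ∀ j ∈ H, ∀ a b : S, 0 ≤ A i j a b)
    (hstoch : ∀ a : S, ∑ b : S, total A a b = 1)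
    (hirr : ChainIrreducible (transition A)) {x : ℝ} (h1 : zLow A ≤ x) (h2 : x ≤ zBar A) (a b : S) :
    0 ≤ greal A x a b := by
  rw [greal_apply hA hstoch hirr h1 h2]
  exact tsum_nonneg fun n => passR_nonneg hA ((zLow_pos A).trans_le h1) n 1 a b

lemma norm_G1_le (hA : ∀ i ∈ H, ∀ j ∈ H, ∀ a b : S, 0 ≤ A i j a b)
    (hstoch : ∀ a : S, ∑ b : S, total A a b = 1)
    (hirr : ChainIrreducible (transition A)) {z : ℂ}
    (h1 : zLow A ≤ ‖z‖) (h2 : ‖z‖ ≤ zBar A) (a b : S) : ‖G1 A z a b‖ ≤ greal A ‖z‖ a b := by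
  rw [G1_apply hA hstoch hirr h1 h2, greal_apply hA hstoch hirr h1 h2]
  exact tsum_of_norm_bounded (summable_passR hA hstoch hirr h1 h2 a b).hasSum
    fun n => norm_passC_le hA z n 1 a b

lemma G1_quadratic (hA : ∀ i ∈ H, ∀ j ∈ H, ∀ a b : S, 0 ≤ A i j a b)
    (hstoch : ∀ a : S, ∑ b : S, total A a b = 1)
    (hirr : ChainIrreducible (transition A)) {z : ℂ}
    (h1 : zLow A ≤ ‖z‖) (h2 : ‖z‖ ≤ zBar A) : SolvesQuadratic A z (G1 A z) := by
  rw [SolvesQuadratic, G1_eq_tsum hA hstoch hirr h1 h2]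
  exact passage_tsum_quadratic (summable_norm_passC hA hstoch hirr h1 h2)

lemma greal_quadratic (hA : ∀ i ∈ H, ∀ j ∈ H, ∀ a b : S, 0 ≤ A i j a b)
    (hstoch : ∀ a : S, ∑ b : S, total A a b = 1)
    (hirr : ChainIrreducible (transition A)) {x : ℝ} (h1 : zLow A ≤ x) (h2 : x ≤ zBar A) :
    astar A (-1) x + astar A 0 x * greal A x + astar A 1 x * greal A x ^ 2 = greal A x :=
  passage_tsum_quadratic fun a b => (summable_passR hA hstoch hirr h1 h2 a b).norm

lemma G1_ofReal (hA : ∀ i ∈ H, ∀ j ∈ H, ∀ a b : S, 0 ≤ A i j a b)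
    (hstoch : ∀ a : S, ∑ b : S, total A a b = 1)
    (hirr : ChainIrreducible (transition A)) {x : ℝ} (h1 : zLow A ≤ x) (h2 : x ≤ zBar A) :
    G1 A (x : ℂ) = (greal A x).map (fun a : ℝ => (a : ℂ)) := by
  have hx : ‖(x : ℂ)‖ = x := by
    rw [Complex.norm_real, Real.norm_of_nonneg ((zLow_pos A).le.trans h1)]
  ext a b
  rw [G1_apply hA hstoch hirr (by rwa [hx]) (by rwa [hx]), Matrix.map_apply,
    greal_apply hA hstoch hirr h1 h2, Complex.ofReal_tsum]
  refine tsum_congr fun n => ?_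
  rw [passC, Astar_ofReal, Astar_ofReal, Astar_ofReal, passage_map]
  rfl

/-- The limit of `sum_passage_le` at depth one. Equality is a separate matter, settled by
`greal_mulVec_eq` and, at `zBar`, by continuity. -/
lemma greal_mulVec_le (hA : ∀ i ∈ H, ∀ j ∈ H, ∀ a b : S, 0 ≤ A i j a b)
    (hstoch : ∀ a : S, ∑ b : S, total A a b = 1)
    (hirr : ChainIrreducible (transition A)) {x : ℝ} (h1 : zLow A ≤ x) (h2 : x ≤ zBar A)
    {w : ℝ} (hw : 0 < w) {v : S → ℝ} (hv : ∀ a, 0 < v a) (h : creal A x w *ᵥ v ≤ v) :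
    greal A x *ᵥ v ≤ w • v := by
  have hx := (zLow_pos A).trans_le h1
  intro a
  have hs : HasSum (fun n => ∑ b, passR A x n 1 a b * v b) ((greal A x *ᵥ v) a) := by
    refine hasSum_sum fun b _ => ?_
    have := (summable_passR hA hstoch hirr h1 h2 a b).hasSum.mul_right (v b)
    rwa [← greal_apply hA hstoch hirr h1 h2] at this
  refine le_of_tendsto' hs.tendsto_sum_nat fun N => ?_
  have := sum_passage_le (astar_nonneg hA neg_one_mem_H hx) (astar_nonneg hA zero_mem_H hx)
    (astar_nonneg hA one_mem_H hx) hv hw (by rwa [← creal_eq]) N 1 a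
  rw [pow_one] at this
  refine le_trans (le_of_eq ?_) this
  simp only [Matrix.mulVec, dotProduct, Matrix.sum_apply, Finset.sum_mul]
  rw [Finset.sum_comm]
  rfl

lemma differentiableAt_passC (A : ℤ → ℤ → Matrix S S ℝ) {z : ℂ} (hz : z ≠ 0) (n m : ℕ) (a b : S) :
    DifferentiableAt ℂ (fun z => passC A z n m a b) z := by
  have hAs : ∀ j a b, DifferentiableAt ℂ (fun z => Astar A j z a b) z := by
    intro j a b
    simp only [Astar_apply]
    exact DifferentiableAt.fun_sum fun i _ =>
      (differentiableAt_zpow.mpr (Or.inl hz)).mul_const _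
  unfold passC
  induction n generalizing m a b with
  | zero => cases m <;> simp [passage]
  | succ n ih =>
    cases m with
    | zero => simp [passage]
    | succ m =>
      simp only [passage_succ_succ, Matrix.add_apply, Matrix.mul_apply]
      refine DifferentiableAt.fun_add (DifferentiableAt.fun_add ?_ ?_) ?_ <;>
        exact DifferentiableAt.fun_sum fun c _ => (hAs _ _ _).mul (ih _ _ _)

/-- The open annulus of convergence. -/
def annulus (A : ℤ → ℤ → Matrix S S ℝ) : Set ℂ := {z | zLow A < ‖z‖ ∧ ‖z‖ < zBar A}

/-- The closed annulus of convergence. -/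
def cannulus (A : ℤ → ℤ → Matrix S S ℝ) : Set ℂ := {z | zLow A ≤ ‖z‖ ∧ ‖z‖ ≤ zBar A}

lemma isOpen_annulus (A : ℤ → ℤ → Matrix S S ℝ) : IsOpen (annulus A) :=
  (isOpen_lt continuous_const continuous_norm).inter (isOpen_lt continuous_norm continuous_const)

lemma ne_zero_of_zLow_le {z : ℂ} (h : zLow A ≤ ‖z‖) : z ≠ 0 := by
  rintro rfl
  rw [norm_zero] at h
  exact absurd h (not_le.mpr (zLow_pos A))

lemma G1_analyticOnNhd (hA : ∀ i ∈ H, ∀ j ∈ H, ∀ a b : S, 0 ≤ A i j a b)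
    (hstoch : ∀ a : S, ∑ b : S, total A a b = 1)
    (hirr : ChainIrreducible (transition A)) (a b : S) :
    AnalyticOnNhd ℂ (fun z => G1 A z a b) (annulus A) := by
  refine DifferentiableOn.analyticOnNhd ?_ (isOpen_annulus A)
  refine (Complex.differentiableOn_tsum_of_summable_norm (summable_bound hA hstoch hirr a b)
    (F := fun n z => passC A z n 1 a b) ?_ (isOpen_annulus A) ?_).congr ?_
  · exact fun n z hz => (differentiableAt_passC A (ne_zero_of_zLow_le hz.1.le)
      n 1 a b).differentiableWithinAt
  · exact fun n z hz => norm_passC_le_bound hA hz.1.le hz.2.le n 1 a b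
  · exact fun z hz => G1_apply hA hstoch hirr hz.1.le hz.2.le a b

lemma G1_continuousOn (hA : ∀ i ∈ H, ∀ j ∈ H, ∀ a b : S, 0 ≤ A i j a b)
    (hstoch : ∀ a : S, ∑ b : S, total A a b = 1)
    (hirr : ChainIrreducible (transition A)) : ContinuousOn (G1 A) (cannulus A) := by
  refine continuousOn_pi.mpr fun a => continuousOn_pi.mpr fun b => ?_
  refine (continuousOn_tsum (f := fun n z => passC A z n 1 a b) ?_
    (summable_bound hA hstoch hirr a b) ?_).congr ?_
  · exact fun n z hz => (differentiableAt_passC A (ne_zero_of_zLow_le hz.1)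
      n 1 a b).continuousAt.continuousWithinAt
  · exact fun n z hz => norm_passC_le_bound hA hz.1 hz.2 n 1 a b
  · exact fun z hz => G1_apply hA hstoch hirr hz.1 hz.2 a b

end GMatrix

/-! ### Transience of the censored chain, and the linearized equation -/

section Levels
variable {S : Type*} [Fintype S] [DecidableEq S]

lemma mul_apply_pos {X Y : Matrix S S ℝ} (hX : ∀ a b, 0 ≤ X a b) (hY : ∀ a b, 0 ≤ Y a b)
    {a c b : S} (h1 : 0 < X a c) (h2 : 0 < Y c b) : 0 < (X * Y) a b := by
  rw [Matrix.mul_apply]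
  exact Finset.sum_pos' (fun c _ => mul_nonneg (hX a c) (hY c b))
    ⟨c, Finset.mem_univ _, mul_pos h1 h2⟩

lemma mul_apply_nonneg {X Y : Matrix S S ℝ} (hX : ∀ a b, 0 ≤ X a b) (hY : ∀ a b, 0 ≤ Y a b)
    (a b : S) : 0 ≤ (X * Y) a b := by
  rw [Matrix.mul_apply]
  exact Finset.sum_nonneg fun c _ => mul_nonneg (hX a c) (hY c b)

/-- The first-step equation for descending `n + 1` levels: `G ^ n` plays the role of the passage
matrix at depth `n`. -/
lemma quadratic_pow {R : Type*} [Ring R] {Bm B0 Bp G : R}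
    (hq : Bm + B0 * G + Bp * G ^ 2 = G) (n : ℕ) :
    G ^ (n + 1) = Bm * G ^ n + B0 * G ^ (n + 1) + Bp * G ^ (n + 2) := by
  calc G ^ (n + 1) = (Bm + B0 * G + Bp * G ^ 2) * G ^ n := by rw [hq, pow_succ']
    _ = _ := by
      rw [add_mul, add_mul, mul_assoc, mul_assoc, ← pow_succ', ← pow_add, add_comm 2 n]

variable {Bm B0 Bp G : Matrix S S ℝ}

/-- The positivity of powers of `G` propagates along the paths of the level chain. -/
lemma pow_pos_step (hm : ∀ a b, 0 ≤ Bm a b) (h0 : ∀ a b, 0 ≤ B0 a b) (hp : ∀ a b, 0 ≤ Bp a b)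
    (hG : ∀ a b, 0 ≤ G a b) (hq : Bm + B0 * G + Bp * G ^ 2 = G) (n : ℕ) {c d e : S} :
    (0 < Bm c d → 0 < (G ^ n) d e → 0 < (G ^ (n + 1)) c e) ∧
    (0 < B0 c d → 0 < (G ^ (n + 1)) d e → 0 < (G ^ (n + 1)) c e) ∧
    (0 < Bp c d → 0 < (G ^ (n + 2)) d e → 0 < (G ^ (n + 1)) c e) := by
  have k1 := mul_apply_nonneg hm (pow_nonneg' hG n) c e
  have k2 := mul_apply_nonneg h0 (pow_nonneg' hG (n + 1)) c e
  have k3 := mul_apply_nonneg hp (pow_nonneg' hG (n + 2)) c e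
  have e1 : (G ^ (n + 1)) c e = (Bm * G ^ n) c e + (B0 * G ^ (n + 1)) c e
      + (Bp * G ^ (n + 2)) c e := by
    conv_lhs => rw [quadratic_pow hq n]
    rfl
  refine ⟨fun h h' => ?_, fun h h' => ?_, fun h h' => ?_⟩
  · have := mul_apply_pos hm (pow_nonneg' hG n) h h'
    linarith
  · have := mul_apply_pos h0 (pow_nonneg' hG (n + 1)) h h'
    linarith
  · have := mul_apply_pos hp (pow_nonneg' hG (n + 2)) h h'
    linarith

/-- The chain censored at the levels above the initial one is transient. -/
lemma censored_transient (hm : ∀ a b, 0 ≤ Bm a b) (h0 : ∀ a b, 0 ≤ B0 a b)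
    (hp : ∀ a b, 0 ≤ Bp a b) (hG : ∀ a b, 0 ≤ G a b) (hq : Bm + B0 * G + Bp * G ^ 2 = G)
    (hirr : LevelIrr Bm B0 Bp) {v : S → ℝ} (hv : ∀ a, 0 < v a) {w : ℝ} (hw : 0 < w)
    (hGv : G *ᵥ v ≤ w • v) (hC : (w⁻¹ • Bm + B0 + w • Bp) *ᵥ v ≤ v) {y : S → ℝ} (hy : 0 ≤ y)
    (h : y ≤ (B0 + Bp * G) *ᵥ y) : y = 0 := by
  by_contra hne
  obtain ⟨o, ho⟩ := Function.ne_iff.mp hne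
  have : Nonempty S := ⟨o⟩
  -- Maximum principle: the states where `y / v` is maximal will be shown to trap the chain above
  -- its initial level.
  obtain ⟨a₀, -, ha₀⟩ := Finset.exists_max_image Finset.univ (fun a => y a / v a)
    Finset.univ_nonempty
  set m := y a₀ / v a₀
  have hmle : ∀ b, y b ≤ m * v b := fun b => by
    have := ha₀ b (Finset.mem_univ _)
    rwa [div_le_iff₀ (hv b)] at this
  have hm0 : 0 < m := by
    have h1 := hmle o
    have h2 : 0 < y o := lt_of_le_of_ne (hy o) (Ne.symm ho)
    by_contra h3
    nlinarith [hv o]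
  set U := B0 + Bp * G with hU
  have hUnn : ∀ a b, 0 ≤ U a b := fun a b => add_nonneg (h0 a b) (mul_apply_nonneg hp hG a b)
  have hUv : ∀ a, (U *ᵥ v) a + w⁻¹ * (Bm *ᵥ v) a ≤ v a := by
    intro a
    have h1 := hC a
    have h2 := mulVec_mono hp hGv a
    simp only [Matrix.add_mulVec, Matrix.smul_mulVec, Matrix.mulVec_smul, Pi.add_apply,
      Pi.smul_apply, smul_eq_mul] at h1 h2
    rw [hU, Matrix.add_mulVec, Pi.add_apply, ← Matrix.mulVec_mulVec]
    linarith
  have hUy : ∀ a, (U *ᵥ y) a ≤ m * (U *ᵥ v) a := by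
    intro a
    have := mulVec_mono hUnn (show y ≤ m • v from fun b => hmle b) a
    rwa [Matrix.mulVec_smul] at this
  have hBmnn : ∀ a, 0 ≤ (Bm *ᵥ v) a := mulVec_nonneg' hm fun a => (hv a).le
  -- At a maximal state, `y ≤ U y ≤ m U v ≤ m (v - w⁻¹ Bm v)` leaves no room for a step down.
  have hM1 : ∀ a, y a = m * v a → ∀ b, ¬ 0 < Bm a b := by
    intro a ha b hb
    have h1 : 0 < (Bm *ᵥ v) a := Finset.sum_pos' (fun b _ => mul_nonneg (hm a b) (hv b).le)
      ⟨b, Finset.mem_univ _, mul_pos hb (hv b)⟩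
    have h2 : 0 < w⁻¹ * (Bm *ᵥ v) a := mul_pos (inv_pos.mpr hw) h1
    have h3 := h a
    have h4 := hUy a
    have h5 := hUv a
    nlinarith
  have hM2 : ∀ a, y a = m * v a → ∀ b, 0 < U a b → y b = m * v b := by
    intro a ha b hb
    have h3 := h a
    have h5 := hUv a
    have h6 := mul_nonneg (inv_pos.mpr hw).le (hBmnn a)
    have h7 : ∑ c, U a c * (m * v c - y c) = m * (U *ᵥ v) a - (U *ᵥ y) a := by
      simp only [Matrix.mulVec, dotProduct, Finset.mul_sum, ← Finset.sum_sub_distrib]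
      exact Finset.sum_congr rfl fun c _ => by ring
    have h8 : ∑ c, U a c * (m * v c - y c) ≤ 0 := by
      rw [h7]; nlinarith
    have hnn : ∀ c ∈ Finset.univ, 0 ≤ U a c * (m * v c - y c) := fun c _ =>
      mul_nonneg (hUnn a c) (sub_nonneg.mpr (hmle c))
    have h9 := (Finset.sum_eq_zero_iff_of_nonneg hnn).mp
      (le_antisymm h8 (Finset.sum_nonneg hnn)) b (Finset.mem_univ _)
    have := (mul_eq_zero.mp h9).resolve_left hb.ne'
    linarith
  have hone : ∀ d b : S, 0 < (1 : Matrix S S ℝ) d b → d = b := fun d b hdb => by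
    rw [Matrix.one_apply] at hdb
    by_contra hne
    simp [hne] at hdb
  -- The invariant says that the level is nonnegative and every descent to level zero ends in a
  -- maximal state. Level `-1` would then be unreachable, against irreducibility.
  have key := hirr (fun l c => 0 ≤ l ∧ ∀ b, 0 < (G ^ l.toNat) c b → y b = m * v b) (by
    rintro l c d ⟨hl, hc⟩
    obtain ⟨n, rfl⟩ := Int.eq_ofNat_of_zero_le hl
    rw [Int.toNat_natCast] at hc
    cases n with
    | zero =>
      have hcM : y c = m * v c := hc c (by simp)
      refine ⟨fun hb => absurd hb (hM1 c hcM d), fun hb => ⟨le_rfl, fun b hdb => ?_⟩,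
        fun hb => ⟨by norm_num, fun b hdb => ?_⟩⟩
      · obtain rfl := hone d b (by simpa using hdb)
        refine hM2 c hcM d ?_
        rw [hU, Matrix.add_apply]
        exact add_pos_of_pos_of_nonneg hb (mul_apply_nonneg hp hG c d)
      · refine hM2 c hcM b ?_
        rw [hU, Matrix.add_apply]
        exact add_pos_of_nonneg_of_pos (h0 c b) (mul_apply_pos hp hG hb (by simpa using hdb))
    | succ n =>
      refine ⟨fun hb => ⟨by push_cast; omega, fun b hdb => hc b ?_⟩,
        fun hb => ⟨by omega, fun b hdb => hc b ?_⟩,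
        fun hb => ⟨by omega, fun b hdb => hc b ?_⟩⟩
      · refine (pow_pos_step hm h0 hp hG hq n).1 hb ?_
        rwa [show (((n + 1 : ℕ) : ℤ) - 1).toNat = n by omega] at hdb
      · refine (pow_pos_step hm h0 hp hG hq n).2.1 hb ?_
        rwa [show (((n + 1 : ℕ) : ℤ)).toNat = n + 1 by omega] at hdb
      · refine (pow_pos_step hm h0 hp hG hq n).2.2 hb ?_
        rwa [show (((n + 1 : ℕ) : ℤ) + 1).toNat = n + 2 by omega] at hdb)
    0 a₀ ⟨le_rfl, fun b hb => by
      obtain rfl := hone a₀ b (by simpa using hb)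
      exact (div_mul_cancel₀ _ (hv a₀).ne').symm⟩ (-1) a₀
  exact absurd key.1 (by norm_num)

/-- Some power of `G` has a positive column. -/
lemma exists_pow_col_pos [Nonempty S] (hm : ∀ a b, 0 ≤ Bm a b) (h0 : ∀ a b, 0 ≤ B0 a b)
    (hp : ∀ a b, 0 ≤ Bp a b) (hG : ∀ a b, 0 ≤ G a b) (hq : Bm + B0 * G + Bp * G ^ 2 = G)
    (hirr : LevelIrr Bm B0 Bp) {v : S → ℝ} (hv : ∀ a, 0 < v a) {w : ℝ} (hw : 0 < w)
    (hGv : G *ᵥ v = w • v) : ∃ (N : ℕ) (e : S), ∀ a, 0 < (G ^ N) a e := by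
  obtain ⟨o⟩ := id ‹Nonempty S›
  -- For large `n`, the support of row `o` of `G ^ n` lies in that of row `a`: follow a path from
  -- `(0, a)` to `(0, o)`, with `n` large enough that the height stays positive. The `+ 0` is the
  -- final level of the induction.
  have key : ∀ a : S, ∃ n₀ : ℕ, ∀ n : ℕ, n₀ ≤ n → 0 ≤ (n : ℤ) + 0 ∧
      ∀ e, 0 < (G ^ ((n : ℤ) + 0).toNat) o e → 0 < (G ^ n) a e := by
    intro a
    refine hirr (fun l c => ∃ n₀ : ℕ, ∀ n : ℕ, n₀ ≤ n → 0 ≤ (n : ℤ) + l ∧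
      ∀ e, 0 < (G ^ ((n : ℤ) + l).toNat) c e → 0 < (G ^ n) a e) ?_ 0 a
      ⟨0, fun n _ => ⟨by omega, fun e he => by simpa using he⟩⟩ 0 o
    rintro l c d ⟨n₀, hn₀⟩
    have hpos : ∀ n : ℕ, n₀ + 1 ≤ n → ∃ k : ℕ, (n : ℤ) + l = k + 1 := by
      intro n hn
      have := (hn₀ (n - 1) (by omega)).1
      exact ⟨((n : ℤ) + l - 1).toNat, by omega⟩
    refine ⟨fun hb => ⟨n₀ + 1, fun n hn => ?_⟩, fun hb => ⟨n₀ + 1, fun n hn => ?_⟩,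
      fun hb => ⟨n₀ + 1, fun n hn => ?_⟩⟩ <;> obtain ⟨k, hk⟩ := hpos n hn
    · refine ⟨by omega, fun e he => (hn₀ n (by omega)).2 e ?_⟩
      rw [show ((n : ℤ) + l).toNat = k + 1 by omega]
      rw [show ((n : ℤ) + (l - 1)).toNat = k by omega] at he
      exact (pow_pos_step hm h0 hp hG hq k).1 hb he
    · refine ⟨by omega, fun e he => (hn₀ n (by omega)).2 e ?_⟩
      rw [show ((n : ℤ) + l).toNat = k + 1 by omega] at he ⊢
      exact (pow_pos_step hm h0 hp hG hq k).2.1 hb he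
    · refine ⟨by omega, fun e he => (hn₀ n (by omega)).2 e ?_⟩
      rw [show ((n : ℤ) + l).toNat = k + 1 by omega]
      rw [show ((n : ℤ) + (l + 1)).toNat = k + 2 by omega] at he
      exact (pow_pos_step hm h0 hp hG hq k).2.2 hb he
  choose f hf using key
  set N := Finset.univ.sup f
  -- `G ^ N` maps `v` to a positive multiple of itself, so no row is zero; a positive entry in row
  -- `o` then gives a positive column.
  have hrow : ∃ e, 0 < (G ^ N) o e := by
    by_contra hcon
    push Not at hcon
    have h1 := congrFun (pow_mulVec_eq hGv N) o
    have h2 : ((G ^ N) *ᵥ v) o ≤ 0 :=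
      Finset.sum_nonpos fun e _ => mul_nonpos_of_nonpos_of_nonneg (hcon e) (hv e).le
    rw [h1] at h2
    exact absurd (mul_pos (pow_pos hw N) (hv o)) (not_lt.mpr h2)
  obtain ⟨e, he⟩ := hrow
  exact ⟨N, e, fun a => (hf a N (Finset.le_sup (Finset.mem_univ a))).2 e (by simpa using he)⟩

/-- Uniqueness for the linearized equation, from a contraction property of the right factor. -/
lemma linearized_eq_zero {U : Matrix S S ℝ} {Uz Bz Gz X : Matrix S S ℂ}
    (hU : ∀ a b, ‖Uz a b‖ ≤ U a b) (hB : ∀ a b, ‖Bz a b‖ ≤ Bp a b)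
    (hGz : ∀ a b, ‖Gz a b‖ ≤ G a b) {v π : S → ℝ} (hv : ∀ a, 0 < v a) (hπ : ∀ a, 0 < π a) {w : ℝ}
    (hw : 0 < w) (hGv : G *ᵥ v = w • v) (hl : π ᵥ* (U + w • Bp) = π)
    (htr : ∀ y : S → ℝ, 0 ≤ y → y ≤ U *ᵥ y → y = 0) (hX : X = Uz * X + Bz * X * Gz)
    {n : ℕ} {c : ℝ} (hc : c < w ^ n)
    (hcon : ∀ a, ∑ b, ‖(X * Gz ^ n) a b‖ * v b ≤ c * ∑ b, ‖X a b‖ * v b) : X = 0 := by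
  have hUnn : ∀ a b, 0 ≤ U a b := fun a b => (norm_nonneg _).trans (hU a b)
  have hBnn : ∀ a b, 0 ≤ Bp a b := fun a b => (norm_nonneg _).trans (hB a b)
  -- The weighted norms of the rows of `X Gzᵏ`.
  set Y : ℕ → S → ℝ := fun k a => ∑ b, ‖(X * Gz ^ k) a b‖ * v b with hY
  have hYnn : ∀ k, 0 ≤ Y k := fun k a =>
    Finset.sum_nonneg fun b _ => mul_nonneg (norm_nonneg _) (hv b).le
  have hleft : ∀ (T : Matrix S S ℝ) (Tz Z : Matrix S S ℂ), (∀ a b, ‖Tz a b‖ ≤ T a b) → ∀ a,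
      ∑ b, ‖(Tz * Z) a b‖ * v b ≤ (T *ᵥ fun a => ∑ b, ‖Z a b‖ * v b) a := by
    intro T Tz Z hT a
    simp only [Matrix.mulVec, dotProduct, Finset.mul_sum]
    rw [Finset.sum_comm]
    refine Finset.sum_le_sum fun b _ => ?_
    rw [Matrix.mul_apply]
    refine (mul_le_mul_of_nonneg_right (norm_sum_le _ _) (hv b).le).trans ?_
    rw [Finset.sum_mul]
    refine Finset.sum_le_sum fun c _ => ?_
    rw [norm_mul, mul_assoc]
    exact mul_le_mul_of_nonneg_right (hT a c) (mul_nonneg (norm_nonneg _) (hv b).le)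
  have hright : ∀ k, Y (k + 1) ≤ w • Y k := by
    intro k a
    simp only [hY, Pi.smul_apply, smul_eq_mul]
    rw [pow_succ, ← mul_assoc]
    calc ∑ b, ‖(X * Gz ^ k * Gz) a b‖ * v b
        ≤ ∑ b, (∑ c, ‖(X * Gz ^ k) a c‖ * G c b) * v b := by
          refine Finset.sum_le_sum fun b _ => mul_le_mul_of_nonneg_right ?_ (hv b).le
          rw [Matrix.mul_apply (M := X * Gz ^ k)]
          refine (norm_sum_le _ _).trans (Finset.sum_le_sum fun c _ => ?_)
          rw [norm_mul]
          exact mul_le_mul_of_nonneg_left (hGz c b) (norm_nonneg _)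
      _ = ∑ c, ‖(X * Gz ^ k) a c‖ * (G *ᵥ v) c := by
          simp only [Finset.sum_mul, Matrix.mulVec, dotProduct, Finset.mul_sum]
          rw [Finset.sum_comm]
          exact Finset.sum_congr rfl fun c _ => Finset.sum_congr rfl fun b _ => by ring
      _ = w * ∑ c, ‖(X * Gz ^ k) a c‖ * v c := by
          rw [hGv, Finset.mul_sum]
          refine Finset.sum_congr rfl fun c _ => ?_
          simp only [Pi.smul_apply, smul_eq_mul]; ring
  have hstep : ∀ k, Y k ≤ U *ᵥ Y k + Bp *ᵥ Y (k + 1) := by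
    intro k a
    have e : X * Gz ^ k = Uz * (X * Gz ^ k) + Bz * (X * Gz ^ (k + 1)) := by
      conv_lhs => rw [hX]
      rw [add_mul, pow_succ']
      simp only [mul_assoc]
    calc Y k a = ∑ b, ‖(Uz * (X * Gz ^ k)) a b + (Bz * (X * Gz ^ (k + 1))) a b‖ * v b := by
          simp only [hY]
          refine Finset.sum_congr rfl fun b _ => ?_
          rw [← Matrix.add_apply, ← e]
      _ ≤ ∑ b, ‖(Uz * (X * Gz ^ k)) a b‖ * v b + ∑ b, ‖(Bz * (X * Gz ^ (k + 1))) a b‖ * v b := by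
          rw [← Finset.sum_add_distrib]
          refine Finset.sum_le_sum fun b _ => ?_
          rw [← add_mul]
          exact mul_le_mul_of_nonneg_right (norm_add_le _ _) (hv b).le
      _ ≤ _ := add_le_add (hleft U Uz _ hU a) (hleft Bp Bz _ hB a)
  have hdot_mono : ∀ x y : S → ℝ, x ≤ y → π ⬝ᵥ x ≤ π ⬝ᵥ y := fun x y hxy =>
    Finset.sum_le_sum fun a _ => mul_le_mul_of_nonneg_left (hxy a) (hπ a).le
  have hl' : ∀ y : S → ℝ, π ⬝ᵥ y = π ⬝ᵥ U *ᵥ y + w * (π ⬝ᵥ Bp *ᵥ y) := by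
    intro y
    conv_lhs => rw [← hl]
    rw [← Matrix.dotProduct_mulVec, Matrix.add_mulVec, Matrix.smul_mulVec, dotProduct_add,
      dotProduct_smul, smul_eq_mul]
  -- Pairing `Y k ≤ U Y k + Bp Y (k + 1)` with `π = π (U + w Bp)` cancels the `U` terms and gains a
  -- factor `w` at each step.
  have hgeom : ∀ k, w ^ k * (π ⬝ᵥ Bp *ᵥ Y 0) ≤ π ⬝ᵥ Bp *ᵥ Y k := by
    intro k
    induction k with
    | zero => simp
    | succ k ih =>
      have h1 := hdot_mono _ _ (hstep k)
      rw [dotProduct_add, hl' (Y k)] at h1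
      have h2 : w * (w ^ k * (π ⬝ᵥ Bp *ᵥ Y 0)) ≤ w * (π ⬝ᵥ Bp *ᵥ Y k) :=
        mul_le_mul_of_nonneg_left ih hw.le
      rw [pow_succ]
      linarith
  have hYn : Y n ≤ c • Y 0 := fun a => by
    simpa [hY] using hcon a
  have hBY0 : 0 ≤ Bp *ᵥ Y 0 := mulVec_nonneg' hBnn (hYnn 0)
  -- Growth by `w ^ n` meets the contraction by `c < w ^ n`.
  have hzero : π ⬝ᵥ Bp *ᵥ Y 0 = 0 := by
    have h1 := hgeom n
    have h2 := hdot_mono _ _ (mulVec_mono hBnn hYn)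
    rw [Matrix.mulVec_smul, dotProduct_smul, smul_eq_mul] at h2
    have h3 : 0 ≤ π ⬝ᵥ Bp *ᵥ Y 0 := by
      have := hdot_mono _ _ hBY0
      simpa using this
    by_contra h4
    have h5 : 0 < π ⬝ᵥ Bp *ᵥ Y 0 := lt_of_le_of_ne h3 (Ne.symm h4)
    nlinarith
  have hB0 : Bp *ᵥ Y 0 = 0 := by
    ext a
    have := (Finset.sum_eq_zero_iff_of_nonneg fun a _ => mul_nonneg (hπ a).le (hBY0 a)).mp hzero a
      (Finset.mem_univ _)
    exact (mul_eq_zero.mp this).resolve_left (hπ a).ne'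
  have hB1 : Bp *ᵥ Y 1 ≤ 0 := by
    have := mulVec_mono hBnn (hright 0)
    rwa [Matrix.mulVec_smul, hB0, smul_zero] at this
  -- With the `Bp` term gone, `Y 0 ≤ U Y 0`, and transience applies.
  have hY0 : Y 0 = 0 := htr _ (hYnn 0) (by
    refine (hstep 0).trans ?_
    have := add_le_add_right hB1 (U *ᵥ Y 0)
    simpa using this)
  ext a b
  have h1 := congrFun hY0 a
  simp only [hY, pow_zero, mul_one, Pi.zero_apply] at h1
  have h2 := (Finset.sum_eq_zero_iff_of_nonneg fun b _ =>
    mul_nonneg (norm_nonneg (X a b)) (hv b).le).mp h1 b (Finset.mem_univ _)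
  have := (mul_eq_zero.mp h2).resolve_right (hv b).ne'
  simpa using this

lemma contraction_of_row_lt [Nonempty S] {P : Matrix S S ℂ} {v : S → ℝ} (hv : ∀ a, 0 < v a) {c₀ : ℝ}
    (h : ∀ a, ∑ b, ‖P a b‖ * v b < c₀ * v a) :
    ∃ c < c₀, ∀ (X : Matrix S S ℂ) (a : S), ∑ b, ‖(X * P) a b‖ * v b ≤ c * ∑ b, ‖X a b‖ * v b := by
  obtain ⟨a₀, -, ha₀⟩ := Finset.exists_max_image Finset.univ
    (fun a => (∑ b, ‖P a b‖ * v b) / v a) Finset.univ_nonempty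
  refine ⟨(∑ b, ‖P a₀ b‖ * v b) / v a₀, by rw [div_lt_iff₀ (hv a₀)]; exact h a₀, fun X a => ?_⟩
  set c := (∑ b, ‖P a₀ b‖ * v b) / v a₀
  calc ∑ b, ‖(X * P) a b‖ * v b ≤ ∑ b, (∑ d, ‖X a d‖ * ‖P d b‖) * v b := by
        refine Finset.sum_le_sum fun b _ => mul_le_mul_of_nonneg_right ?_ (hv b).le
        rw [Matrix.mul_apply]
        refine (norm_sum_le _ _).trans (Finset.sum_le_sum fun d _ => (norm_mul _ _).le)
    _ = ∑ d, ‖X a d‖ * ∑ b, ‖P d b‖ * v b := by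
        simp only [Finset.sum_mul, Finset.mul_sum]
        rw [Finset.sum_comm]
        exact Finset.sum_congr rfl fun d _ => Finset.sum_congr rfl fun b _ => by ring
    _ ≤ ∑ d, ‖X a d‖ * (c * v d) := by
        refine Finset.sum_le_sum fun d _ => mul_le_mul_of_nonneg_left ?_ (norm_nonneg _)
        have := ha₀ d (Finset.mem_univ _)
        rwa [div_le_iff₀ (hv d)] at this
    _ = c * ∑ b, ‖X a b‖ * v b := by
        rw [Finset.mul_sum]
        exact Finset.sum_congr rfl fun d _ => by ring

end Levels

/-! ### Equality in the triangle inequality -/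

section Phase

/-- Equality in the triangle inequality forces aligned phases. -/
lemma aligned_of_norm_sum_eq {ι : Type*} {s : Finset ι} {f : ι → ℂ} {F : ι → ℝ}
    (hf : ∀ i ∈ s, ‖f i‖ ≤ F i) (h : ‖∑ i ∈ s, f i‖ = ∑ i ∈ s, F i) {i : ι} (hi : i ∈ s) :
    f i * ((∑ i ∈ s, F i : ℝ) : ℂ) = F i * ∑ i ∈ s, f i := by
  set T := ∑ i ∈ s, f i with hT
  have hF : ∀ i ∈ s, 0 ≤ F i := fun i hi => (norm_nonneg _).trans (hf i hi)
  rcases eq_or_ne T 0 with h0 | h0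
  · have hs : ∑ i ∈ s, F i = 0 := by rw [← h, h0, norm_zero]
    have := (Finset.sum_eq_zero_iff_of_nonneg hF).mp hs i hi
    rw [hs, this, h0]; simp
  have hTpos : 0 < ‖T‖ := norm_pos_iff.mpr h0
  -- After rotation the sum is the real number `‖T‖ * ‖T‖`, so the termwise bounds on real parts
  -- must all be equalities.
  set g : ι → ℂ := fun i => (starRingEnd ℂ) T * f i with hg
  have hgn : ∀ i ∈ s, ‖g i‖ ≤ ‖T‖ * F i := fun i hi => by
    simp only [hg, norm_mul, RCLike.norm_conj]
    exact mul_le_mul_of_nonneg_left (hf i hi) (norm_nonneg _)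
  have hgre : ∀ i ∈ s, (g i).re ≤ ‖T‖ * F i := fun i hi =>
    (Complex.re_le_norm _).trans (hgn i hi)
  have hsum : ∑ i ∈ s, (g i).re = ∑ i ∈ s, ‖T‖ * F i := by
    rw [← Complex.re_sum, ← Finset.mul_sum, ← Finset.mul_sum, ← h, ← hT, mul_comm,
      Complex.mul_conj, Complex.ofReal_re, Complex.normSq_eq_norm_sq, pow_two]
  have heq := (Finset.sum_eq_sum_iff_of_le hgre).mp hsum i hi
  have hgi : g i = ((‖T‖ * F i : ℝ) : ℂ) := by
    have h1 : ‖g i‖ = (g i).re :=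
      le_antisymm ((hgn i hi).trans heq.ge) (Complex.re_le_norm _)
    have h3 : (g i).im = 0 := by
      exact Complex.abs_re_eq_norm.mp (by rw [← h1, abs_of_nonneg (norm_nonneg _)])
    exact Complex.ext (by simpa using heq) (by simpa using h3)
  have hTT : (starRingEnd ℂ) T * T = ((‖T‖ * ‖T‖ : ℝ) : ℂ) := by
    rw [mul_comm, Complex.mul_conj, Complex.normSq_eq_norm_sq, pow_two]
  have hT' : (starRingEnd ℂ) T ≠ 0 := (map_ne_zero _).mpr h0
  refine mul_left_cancel₀ hT' ?_
  rw [← mul_assoc, show (starRingEnd ℂ) T * f i = g i from rfl, hgi, mul_left_comm, hTT, ← h]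
  push_cast; ring

end Phase

/-! ### Strict domination of powers of `G₁` off the positive axis -/

section Circle
variable {S : Type*} [Fintype S] [DecidableEq S] {A : ℤ → ℤ → Matrix S S ℝ}

/-- One-step transitions out of a state. -/
def steps (S : Type*) [Fintype S] : Finset (ℤ × ℤ × S) := H ×ˢ H ×ˢ Finset.univ

lemma sum_steps {M : Type*} [AddCommMonoid M] (f : ℤ × ℤ × S → M) :
    ∑ q ∈ steps S, f q = ∑ j ∈ H, ∑ d, ∑ i ∈ H, f (i, j, d) := by
  rw [steps, Finset.sum_product, Finset.sum_congr rfl fun i _ => Finset.sum_product _ _ _,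
    Finset.sum_comm]
  exact Finset.sum_congr rfl fun j _ => Finset.sum_comm

lemma pow_expand_complex {z : ℂ} {g : Matrix S S ℂ} (hq : SolvesQuadratic A z g) (n : ℕ) (c e : S) :
    (g ^ (n + 1)) c e = ∑ q ∈ steps S,
      z ^ q.1 * (A q.1 q.2.1 c q.2.2 : ℂ) * (g ^ (((n + 1 : ℕ) : ℤ) + q.2.1).toNat) q.2.2 e := by
  have e1 : (g ^ (n + 1)) c e = (Astar A (-1) z * g ^ n) c e + (Astar A 0 z * g ^ (n + 1)) c e
      + (Astar A 1 z * g ^ (n + 2)) c e := by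
    conv_lhs => rw [quadratic_pow hq n]
    rfl
  rw [e1, sum_steps, sum_H]
  simp only [Matrix.mul_apply, Astar_apply, Finset.sum_mul]
  rw [show (((n + 1 : ℕ) : ℤ) + -1).toNat = n by omega,
    show (((n + 1 : ℕ) : ℤ) + 0).toNat = n + 1 by omega,
    show (((n + 1 : ℕ) : ℤ) + 1).toNat = n + 2 by omega]

lemma pow_expand_real {x : ℝ} {g : Matrix S S ℝ}
    (hq : astar A (-1) x + astar A 0 x * g + astar A 1 x * g ^ 2 = g) (n : ℕ) (c e : S) :
    (g ^ (n + 1)) c e = ∑ q ∈ steps S,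
      x ^ q.1 * A q.1 q.2.1 c q.2.2 * (g ^ (((n + 1 : ℕ) : ℤ) + q.2.1).toNat) q.2.2 e := by
  have e1 : (g ^ (n + 1)) c e = (astar A (-1) x * g ^ n) c e + (astar A 0 x * g ^ (n + 1)) c e
      + (astar A 1 x * g ^ (n + 2)) c e := by
    conv_lhs => rw [quadratic_pow hq n]
    rfl
  rw [e1, sum_steps, sum_H]
  simp only [Matrix.mul_apply, astar_apply, Finset.sum_mul]
  rw [show (((n + 1 : ℕ) : ℤ) + -1).toNat = n by omega,
    show (((n + 1 : ℕ) : ℤ) + 0).toNat = n + 1 by omega,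
    show (((n + 1 : ℕ) : ℤ) + 1).toNat = n + 2 by omega]

lemma norm_pow_apply_le {g : Matrix S S ℂ} {G : Matrix S S ℝ} (h : ∀ a b, ‖g a b‖ ≤ G a b)
    (n : ℕ) (a b : S) : ‖(g ^ n) a b‖ ≤ (G ^ n) a b := by
  induction n generalizing a b with
  | zero => simp only [pow_zero, Matrix.one_apply]; split_ifs <;> simp
  | succ n ih => rw [pow_succ, pow_succ]; exact norm_mul_apply_le ih h a b

/-- Off the positive real axis, large powers of `G₁` are strictly dominated. -/
lemma norm_pow_lt (hA : ∀ i ∈ H, ∀ j ∈ H, ∀ a b : S, 0 ≤ A i j a b)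
    (hirr : ChainIrreducible (transition A)) {z : ℂ} (hz0 : z ≠ 0) (hz : z ≠ (‖z‖ : ℂ))
    {g : Matrix S S ℂ} {G : Matrix S S ℝ} (hg : SolvesQuadratic A z g)
    (hG : astar A (-1) ‖z‖ + astar A 0 ‖z‖ * G + astar A 1 ‖z‖ * G ^ 2 = G)
    (hle : ∀ a b, ‖g a b‖ ≤ G a b) (a : S) :
    ∃ n₀ : ℕ, ∀ n : ℕ, n₀ ≤ n → ∀ e, 0 < (G ^ n) a e → ‖(g ^ n) a e‖ < (G ^ n) a e := by
  set x := ‖z‖ with hx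
  have hx0 : 0 < x := norm_pos_iff.mpr hz0
  have hxC : (x : ℂ) ≠ 0 := by exact_mod_cast hx0.ne'
  set θ : ℂ := z / x with hθ
  have hθ0 : θ ≠ 0 := div_ne_zero hz0 hxC
  have hGnn : ∀ a b, 0 ≤ G a b := fun a b => (norm_nonneg _).trans (hle a b)
  have hpnn := fun n => pow_nonneg' hGnn n
  have hple := norm_pow_apply_le hle
  -- Here `k` and `l` are the horizontal and vertical displacements from `a`. Maximal modulus at
  -- entry `(a, e)` of `g ^ n` passes to entry `(c, e)` of `g ^ (n + l)`, with phases related by `θ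
  -- ^ k`.
  have key := path_induct hirr (fun k l c => ∃ n₀ : ℕ, ∀ n : ℕ, n₀ ≤ n → 0 ≤ (n : ℤ) + l ∧
      ∀ e, 0 < (G ^ n) a e → ‖(g ^ n) a e‖ = (G ^ n) a e → 0 < (G ^ ((n : ℤ) + l).toNat) c e →
        (g ^ n) a e * ((G ^ ((n : ℤ) + l).toNat) c e : ℂ)
            = θ ^ k * (g ^ ((n : ℤ) + l).toNat) c e * ((G ^ n) a e : ℂ) ∧
        ‖(g ^ ((n : ℤ) + l).toNat) c e‖ = (G ^ ((n : ℤ) + l).toNat) c e) (by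
    rintro k l c i j d hi hj hp ⟨n₀, hn₀⟩
    refine ⟨n₀ + 1, fun n hn => ?_⟩
    obtain ⟨m, hm⟩ : ∃ m : ℕ, (n : ℤ) + l = ((m + 1 : ℕ) : ℤ) := by
      have := (hn₀ (n - 1) (by omega)).1
      exact ⟨((n : ℤ) + l - 1).toNat, by omega⟩
    have hj1 : -1 ≤ j := by
      simp only [H, Finset.mem_insert, Finset.mem_singleton] at hj
      omega
    refine ⟨by omega, fun e he heq hd => ?_⟩
    have hn' := (hn₀ n (by omega)).2 e he heq
    rw [hm, Int.toNat_natCast] at hn'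
    rw [show (n : ℤ) + (l + j) = ((m + 1 : ℕ) : ℤ) + j by rw [← hm]; ring] at hd ⊢
    set M := (((m + 1 : ℕ) : ℤ) + j).toNat with hM
    have hexC := pow_expand_complex hg m c e
    have hexR := pow_expand_real hG m c e
    have hmem : ((i, j, d) : ℤ × ℤ × S) ∈ steps S := by simp [steps, hi, hj]
    have hFnn : ∀ q ∈ steps S, 0 ≤ x ^ q.1 * A q.1 q.2.1 c q.2.2
        * (G ^ (((m + 1 : ℕ) : ℤ) + q.2.1).toNat) q.2.2 e := by
      intro q hq
      simp only [steps, Finset.mem_product, Finset.mem_univ, and_true] at hq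
      exact mul_nonneg (mul_nonneg (zpow_pos hx0 _).le (hA _ hq.1 _ hq.2 _ _)) (hpnn _ _ _)
    have hcpos : 0 < (G ^ (m + 1)) c e := by
      rw [hexR]
      exact Finset.sum_pos' hFnn ⟨_, hmem, mul_pos (mul_pos (zpow_pos hx0 _) hp) hd⟩
    obtain ⟨h1, h2⟩ := hn' hcpos
    -- Maximal modulus of the first-step sum forces each summand with positive weight to be maximal
    -- and aligned.
    have hal := aligned_of_norm_sum_eq (s := steps S)
      (f := fun q => z ^ q.1 * (A q.1 q.2.1 c q.2.2 : ℂ)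
        * (g ^ (((m + 1 : ℕ) : ℤ) + q.2.1).toNat) q.2.2 e)
      (F := fun q => x ^ q.1 * A q.1 q.2.1 c q.2.2
        * (G ^ (((m + 1 : ℕ) : ℤ) + q.2.1).toNat) q.2.2 e) (by
        intro q hq
        simp only [steps, Finset.mem_product, Finset.mem_univ, and_true] at hq
        rw [norm_mul, norm_mul, norm_zpow, Complex.norm_real,
          Real.norm_of_nonneg (hA _ hq.1 _ hq.2 _ _)]
        exact mul_le_mul_of_nonneg_left (hple _ _ _)
          (mul_nonneg (zpow_pos hx0 _).le (hA _ hq.1 _ hq.2 _ _)))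
      (by rw [← hexC, ← hexR, h2]) hmem
    rw [← hexC, ← hexR] at hal
    dsimp only at hal
    rw [← hM] at hal
    have hAne : (A i j c d : ℂ) ≠ 0 := by exact_mod_cast hp.ne'
    have hcne : ((G ^ (m + 1)) c e : ℂ) ≠ 0 := by exact_mod_cast hcpos.ne'
    have hxi : (x : ℂ) ^ i ≠ 0 := zpow_ne_zero _ hxC
    have hzi : z ^ i = θ ^ i * (x : ℂ) ^ i := by
      rw [hθ, div_zpow]; field_simp
    have h3 : θ ^ i * (g ^ M) d e * ((G ^ (m + 1)) c e : ℂ)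
        = ((G ^ M) d e : ℂ) * (g ^ (m + 1)) c e := by
      rw [hzi] at hal
      push_cast at hal
      refine mul_left_cancel₀ (mul_ne_zero hxi hAne) ?_
      linear_combination hal
    refine ⟨?_, ?_⟩
    · refine mul_right_cancel₀ hcne ?_
      rw [zpow_add₀ hθ0]
      linear_combination ((G ^ M) d e : ℂ) * h1 - θ ^ k * ((G ^ n) a e : ℂ) * h3
    · have hθn : ‖θ‖ = 1 := by
        rw [hθ, norm_div, Complex.norm_real, Real.norm_of_nonneg hx0.le, ← hx, div_self hx0.ne']
      have h4 := congrArg norm h3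
      rw [norm_mul, norm_mul, norm_mul, norm_zpow, hθn, one_zpow, one_mul, h2, Complex.norm_real,
        Complex.norm_real, Real.norm_of_nonneg hcpos.le, Real.norm_of_nonneg hd.le] at h4
      exact mul_right_cancel₀ hcpos.ne' h4)
    (k := 0) (l := 0) (a := a) ⟨0, fun n _ => ⟨by omega, fun e _ heq _ => by
      simp only [add_zero, Int.toNat_natCast, zpow_zero, one_mul]
      exact ⟨trivial, heq⟩⟩⟩ 1 0 a
  obtain ⟨n₀, hn₀⟩ := key
  refine ⟨n₀, fun n hn e he => lt_of_le_of_ne (hple n a e) fun heq => ?_⟩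
  -- The path ends at `(1, 0, a)`: the same entry, compared with itself after one factor `θ`. Hence
  -- `θ = 1`, against `z ≠ ‖z‖`.
  have h1 := ((hn₀ n hn).2 e he heq (by simpa using he)).1
  simp only [add_zero, Int.toNat_natCast, zpow_one] at h1
  have hGne : ((G ^ n) a e : ℂ) ≠ 0 := by exact_mod_cast he.ne'
  have hgne : (g ^ n) a e ≠ 0 := by
    rw [← norm_pos_iff, heq]; exact he
  have h2 := mul_right_cancel₀ hGne h1
  have h3 : θ = 1 := by
    refine mul_right_cancel₀ hgne ?_
    rw [one_mul]; exact h2.symm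
  rw [hθ, div_eq_one_iff_eq hxC] at h3
  exact hz h3

end Circle

/-! ### Implicit functions and the blow-up of a square-root branch -/

section Implicit
open scoped ContDiff

/-- The analytic implicit function theorem in finite dimension, with local uniqueness. -/
lemma exists_analytic_implicit {E F : Type*} [NormedAddCommGroup E] [NormedSpace ℂ E]
    [FiniteDimensional ℂ E] [NormedAddCommGroup F] [NormedSpace ℂ F] [FiniteDimensional ℂ F]
    (hdim : Module.finrank ℂ E = Module.finrank ℂ F) {f : ℂ × E → F} {z₀ : ℂ} {e₀ : E}
    (hf' : ContDiffAt ℂ ω f (z₀, e₀)) (h0 : f (z₀, e₀) = 0) {D : E → F}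
    (hD : ∀ d, HasDerivAt (fun t : ℂ => f (z₀, e₀ + t • d)) (D d) 0)
    (hinj : ∀ d, D d = 0 → d = 0) :
    ∃ g : ℂ → E, AnalyticAt ℂ g z₀ ∧ g z₀ = e₀ ∧ (∀ᶠ z in 𝓝 z₀, f (z, g z) = 0) ∧
      ∀ᶠ q in 𝓝 (z₀, e₀), f q = 0 → g q.1 = q.2 := by
  have : CompleteSpace E := FiniteDimensional.complete ℂ E
  have : CompleteSpace F := FiniteDimensional.complete ℂ F
  -- The partial derivative in the second variable. Directional derivatives determine it, and equal
  -- dimensions turn injectivity into invertibility.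
  set T := fderiv ℂ f (z₀, e₀) ∘L ContinuousLinearMap.inr ℂ ℂ E with hT
  have hTD : ∀ d, T d = D d := by
    intro d
    have h1 : HasFDerivAt f (fderiv ℂ f (z₀, e₀)) (z₀, e₀ + (0 : ℂ) • d) := by
      rw [zero_smul, add_zero]
      exact (hf'.differentiableAt (by simp)).hasFDerivAt
    have h2 : HasDerivAt (fun t : ℂ => ((z₀, e₀ + t • d) : ℂ × E)) (0, d) 0 := by
      refine (hasDerivAt_const _ _).prodMk ?_
      simpa using ((hasDerivAt_id (0 : ℂ)).smul_const d).const_add e₀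
    exact (h1.comp_hasDerivAt (0 : ℂ) h2).unique (hD d)
  have hTinj : Function.Injective T := by
    refine (injective_iff_map_eq_zero T).mpr fun d hd => hinj d ?_
    rw [← hTD, hd]
  have hinv : T.IsInvertible := by
    let e' := (LinearMap.linearEquivOfInjective (T : E →ₗ[ℂ] F) hTinj hdim).toContinuousLinearEquiv
    exact ⟨e', by ext d; rfl⟩
  refine ⟨hf'.implicitFunction (by simp) hinv, ?_, hf'.implicitFunction_apply_self _ _, ?_, ?_⟩
  · exact (hf'.contDiffAt_implicitFunction (by simp) hinv).analyticAt
  · filter_upwards [hf'.eventually_apply_implicitFunction (by simp) hinv] with z hz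
    rw [hz, h0]
  · filter_upwards [hf'.eventually_apply_eq_iff_implicitFunction (by simp) hinv] with q hq hq0
    exact hq.mp (by rw [hq0, h0])

variable {S : Type*} [Fintype S] [DecidableEq S]

lemma contDiff_mulVec {E : Type*} [NormedAddCommGroup E] [NormedSpace ℂ E] (M : Matrix S S ℂ)
    {f : E → S → ℂ} (hf : ContDiff ℂ ω f) : ContDiff ℂ ω fun x => M *ᵥ f x :=
  (LinearMap.toContinuousLinearMap M.mulVecLin).contDiff.comp hf

/-- The complexification of a real matrix. -/
def cm (M : Matrix S S ℝ) : Matrix S S ℂ := M.map (fun a : ℝ => (a : ℂ))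

/-- The complexification of a real vector. -/
def cv (v : S → ℝ) : S → ℂ := fun a => (v a : ℂ)

lemma cm_mulVec_cv (M : Matrix S S ℝ) (v : S → ℝ) : cm M *ᵥ cv v = cv (M *ᵥ v) := by
  ext a; simp [cm, cv, Matrix.mulVec, dotProduct]

lemma cv_dotProduct_cv (u v : S → ℝ) : cv u ⬝ᵥ cv v = ((u ⬝ᵥ v : ℝ) : ℂ) := by
  simp [cv, dotProduct]

lemma cv_vecMul_cm (M : Matrix S S ℝ) (v : S → ℝ) : cv v ᵥ* cm M = cv (v ᵥ* M) := by
  ext a; simp [cm, cv, Matrix.vecMul, dotProduct]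

lemma star_cm_mulVec (M : Matrix S S ℝ) (x : S → ℂ) : star (cm M *ᵥ x) = cm M *ᵥ star x := by
  ext a; simp [cm, Matrix.mulVec, dotProduct]

/-- The matrix polynomial `M₀ + s M₁ + s² M₂ - ζ² (D₀ + s D₁ + s² D₂) + ζ⁴ (E₀ + s E₁ + s² E₂)`. -/
def blowPoly (M D E : Fin 3 → Matrix S S ℝ) (ζ s : ℂ) : Matrix S S ℂ :=
  cm (M 0) + s • cm (M 1) + s ^ 2 • cm (M 2)
    - ζ ^ 2 • (cm (D 0) + s • cm (D 1) + s ^ 2 • cm (D 2))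
    + ζ ^ 4 • (cm (E 0) + s • cm (E 1) + s ^ 2 • cm (E 2))

/-- The equation for `y`, `W` obtained from `blowPoly ζ (ζ y) (v₀ + ζ y v₁ + ζ² W) = 0` after
division by `ζ²`. -/
def blowEq (M D E : Fin 3 → Matrix S S ℝ) (v₀ v₁ : S → ℝ) (q : ℂ × ℂ × (S → ℂ)) : S → ℂ :=
  cm (M 0) *ᵥ q.2.2 + q.2.1 ^ 2 • (cm (M 1) *ᵥ cv v₁) + (q.1 * q.2.1) • (cm (M 1) *ᵥ q.2.2)
    + q.2.1 ^ 2 • (cm (M 2) *ᵥ (cv v₀ + (q.1 * q.2.1) • cv v₁ + q.1 ^ 2 • q.2.2))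
    - (cm (D 0) *ᵥ (cv v₀ + (q.1 * q.2.1) • cv v₁ + q.1 ^ 2 • q.2.2)
      + (q.1 * q.2.1) • (cm (D 1) *ᵥ (cv v₀ + (q.1 * q.2.1) • cv v₁ + q.1 ^ 2 • q.2.2))
      + (q.1 * q.2.1) ^ 2 • (cm (D 2) *ᵥ (cv v₀ + (q.1 * q.2.1) • cv v₁ + q.1 ^ 2 • q.2.2)))
    + q.1 ^ 2 • (cm (E 0) *ᵥ (cv v₀ + (q.1 * q.2.1) • cv v₁ + q.1 ^ 2 • q.2.2)
      + (q.1 * q.2.1) • (cm (E 1) *ᵥ (cv v₀ + (q.1 * q.2.1) • cv v₁ + q.1 ^ 2 • q.2.2))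
      + (q.1 * q.2.1) ^ 2 • (cm (E 2) *ᵥ (cv v₀ + (q.1 * q.2.1) • cv v₁ + q.1 ^ 2 • q.2.2)))

/-- The orders zero and one in `ζ` vanish by `h0` and `h1`, so `ζ²` divides out and leaves an
equation that is regular at `ζ = 0`. -/
lemma blowPoly_mulVec {M D E : Fin 3 → Matrix S S ℝ} {v₀ v₁ : S → ℝ} (h0 : M 0 *ᵥ v₀ = 0)
    (h1 : M 0 *ᵥ v₁ + M 1 *ᵥ v₀ = 0) (ζ y : ℂ) (W : S → ℂ) :
    blowPoly M D E ζ (ζ * y) *ᵥ (cv v₀ + (ζ * y) • cv v₁ + ζ ^ 2 • W)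
      = ζ ^ 2 • blowEq M D E v₀ v₁ (ζ, y, W) := by
  have h0' : cm (M 0) *ᵥ cv v₀ = 0 := by rw [cm_mulVec_cv, h0]; ext a; simp [cv]
  have h1' : cm (M 0) *ᵥ cv v₁ + cm (M 1) *ᵥ cv v₀ = 0 := by
    rw [cm_mulVec_cv, cm_mulVec_cv]
    ext a
    have := congrFun h1 a
    simp only [Pi.add_apply, Pi.zero_apply] at this
    simp only [cv, Pi.add_apply, Pi.zero_apply]
    exact_mod_cast this
  set u := cv v₀ + (ζ * y) • cv v₁ + ζ ^ 2 • W with hu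
  have e0 : cm (M 0) *ᵥ u = (ζ * y) • (cm (M 0) *ᵥ cv v₁) + ζ ^ 2 • (cm (M 0) *ᵥ W) := by
    rw [hu]; simp only [Matrix.mulVec_add, Matrix.mulVec_smul, h0', zero_add]
  have e1 : cm (M 1) *ᵥ u = cm (M 1) *ᵥ cv v₀ + (ζ * y) • (cm (M 1) *ᵥ cv v₁)
      + ζ ^ 2 • (cm (M 1) *ᵥ W) := by
    rw [hu]; simp only [Matrix.mulVec_add, Matrix.mulVec_smul]
  have e1' : cm (M 0) *ᵥ cv v₁ = - (cm (M 1) *ᵥ cv v₀) := eq_neg_of_add_eq_zero_left h1'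
  simp only [blowPoly, blowEq, Matrix.add_mulVec, Matrix.sub_mulVec, Matrix.smul_mulVec]
  rw [← hu, e0, e1, e1']
  module

lemma contDiff_blowEq (M D E : Fin 3 → Matrix S S ℝ) (v₀ v₁ : S → ℝ) :
    ContDiff ℂ ω (blowEq M D E v₀ v₁) := by
  have h1 : ContDiff ℂ ω fun q : ℂ × ℂ × (S → ℂ) => q.1 := contDiff_fst
  have h2 : ContDiff ℂ ω fun q : ℂ × ℂ × (S → ℂ) => q.2.1 := contDiff_fst.comp contDiff_snd
  have h3 : ContDiff ℂ ω fun q : ℂ × ℂ × (S → ℂ) => q.2.2 := contDiff_snd.comp contDiff_snd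
  have h12 := h1.mul h2
  have hu : ContDiff ℂ ω fun q : ℂ × ℂ × (S → ℂ) =>
      cv v₀ + (q.1 * q.2.1) • cv v₁ + q.1 ^ 2 • q.2.2 :=
    (contDiff_const.add (h12.smul contDiff_const)).add ((h1.pow 2).smul h3)
  unfold blowEq
  refine ContDiff.add (ContDiff.sub (ContDiff.add (ContDiff.add (ContDiff.add ?_ ?_) ?_) ?_) ?_) ?_
  · exact contDiff_mulVec _ h3
  · exact (h2.pow 2).smul contDiff_const
  · exact h12.smul (contDiff_mulVec _ h3)
  · exact (h2.pow 2).smul (contDiff_mulVec _ hu)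
  · exact ((contDiff_mulVec _ hu).add (h12.smul (contDiff_mulVec _ hu))).add
      ((h12.pow 2).smul (contDiff_mulVec _ hu))
  · exact (h1.pow 2).smul (((contDiff_mulVec _ hu).add (h12.smul (contDiff_mulVec _ hu))).add
      ((h12.pow 2).smul (contDiff_mulVec _ hu)))

lemma star_blowEq (M D E : Fin 3 → Matrix S S ℝ) (v₀ v₁ : S → ℝ) (t : ℝ) (y : ℂ) (W : S → ℂ) :
    star (blowEq M D E v₀ v₁ (t, y, W)) = blowEq M D E v₀ v₁ (t, star y, star W) := by
  have hcv : ∀ v : S → ℝ, star (cv v) = cv v := fun v => by ext a; simp [cv]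
  have ht : star (t : ℂ) = t := Complex.conj_ofReal t
  simp only [blowEq, star_add, star_sub, star_smul, star_mul, star_pow, star_cm_mulVec, hcv, ht]
  simp only [mul_comm]

/-- The two branches of the eigenvalue problem at a branch point of order one. -/
lemma exists_blow_up {M D E : Fin 3 → Matrix S S ℝ} {v₀ v₁ π : S → ℝ} (h0 : M 0 *ᵥ v₀ = 0)
    (h1 : M 0 *ᵥ v₁ + M 1 *ᵥ v₀ = 0) (hl : π ᵥ* M 0 = 0)
    (hker : ∀ x : S → ℂ, cm (M 0) *ᵥ x = 0 → cv π ⬝ᵥ x = 0 → x = 0)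
    (hsec : π ⬝ᵥ (M 1 *ᵥ v₁ + M 2 *ᵥ v₀) ≠ 0) {y₀ : ℝ} {W₀ : S → ℝ} (hy₀ : y₀ ≠ 0)
    (hW₀ : M 0 *ᵥ W₀ + y₀ ^ 2 • (M 1 *ᵥ v₁ + M 2 *ᵥ v₀) = D 0 *ᵥ v₀) :
    ∃ (y : ℂ → ℂ) (v : ℂ → S → ℂ), AnalyticAt ℂ y 0 ∧ AnalyticAt ℂ v 0 ∧ y 0 = y₀ ∧ v 0 = cv v₀ ∧
      (∀ᶠ ζ in 𝓝 (0 : ℂ), blowPoly M D E ζ (ζ * y ζ) *ᵥ v ζ = 0) ∧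
      ∀ᶠ t : ℝ in 𝓝 0, star (y t) = y t ∧ star (v t) = v t := by
  -- The second component fixes the multiple of the kernel vector contained in `W`, so that unknowns
  -- and equations match in number.
  set f : ℂ × ℂ × (S → ℂ) → (S → ℂ) × ℂ := fun q =>
    (blowEq M D E v₀ v₁ q, cv π ⬝ᵥ q.2.2 - cv π ⬝ᵥ cv W₀) with hf
  have hfs : ContDiff ℂ ω f := by
    refine (contDiff_blowEq M D E v₀ v₁).prodMk ?_
    refine ContDiff.sub ?_ contDiff_const
    simp only [dotProduct]
    refine ContDiff.sum fun a _ => contDiff_const.mul ?_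
    fun_prop
  have cvadd : ∀ u u' : S → ℝ, cv (u + u') = cv u + cv u' := fun u u' => by ext a; simp [cv]
  have cvsmul : ∀ (c : ℝ) (u : S → ℝ), cv (c • u) = (c : ℂ) • cv u := fun c u => by
    ext a; simp [cv]
  have hzero : f (0, ((y₀ : ℂ), cv W₀)) = 0 := by
    simp only [hf, sub_self, Prod.mk_eq_zero, and_true]
    have := congrArg cv hW₀
    rw [cvadd, cvsmul, cvadd] at this
    simp only [blowEq, zero_mul, zero_smul, add_zero, ne_eq, OfNat.ofNat_ne_zero, not_false_eq_true,
      zero_pow, cm_mulVec_cv, ← this]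
    push_cast
    module
  set D' : ℂ × (S → ℂ) → (S → ℂ) × ℂ := fun d =>
    (cm (M 0) *ᵥ d.2 + (2 * y₀ * d.1) • cv (M 1 *ᵥ v₁ + M 2 *ᵥ v₀), cv π ⬝ᵥ d.2) with hD'
  have hder : ∀ d, HasDerivAt (fun t : ℂ => f (0, ((y₀ : ℂ), cv W₀) + t • d)) (D' d) 0 := by
    rintro ⟨dy, dW⟩
    have e : (fun t : ℂ => f (0, ((y₀ : ℂ), cv W₀) + t • (dy, dW))) = fun t : ℂ =>
        (blowEq M D E v₀ v₁ (0, (y₀ : ℂ), cv W₀) + t • (D' (dy, dW)).1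
          + t ^ 2 • (dy ^ 2 • cv (M 1 *ᵥ v₁ + M 2 *ᵥ v₀)), t * (cv π ⬝ᵥ dW)) := by
      ext1 t
      simp only [hf, hD', Prod.smul_mk, Prod.mk_add_mk, dotProduct_add, dotProduct_smul,
        smul_eq_mul, add_sub_cancel_left, Prod.mk.injEq, and_true]
      simp only [blowEq, zero_mul, zero_smul, add_zero, ne_eq, OfNat.ofNat_ne_zero,
        not_false_eq_true, zero_pow, Matrix.mulVec_add, Matrix.mulVec_smul, cvadd, ← cm_mulVec_cv]
      module
    rw [e]
    refine HasDerivAt.prodMk ?_ ?_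
    · have a1 := ((hasDerivAt_id (0 : ℂ)).smul_const (D' (dy, dW)).1).const_add
        (blowEq M D E v₀ v₁ (0, (y₀ : ℂ), cv W₀))
      have a2 := ((hasDerivAt_id (0 : ℂ)).pow 2).smul_const
        (dy ^ 2 • cv (M 1 *ᵥ v₁ + M 2 *ᵥ v₀))
      have := a1.add a2
      refine this.congr_deriv ?_
      simp [hD']
    · simpa using (hasDerivAt_id (0 : ℂ)).mul_const (cv π ⬝ᵥ dW)
  -- Pairing with `π` removes `M 0` and leaves `2 y₀ dy` times the nonzero second-order coefficient;
  -- then `hker` disposes of `dW`.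
  have hinj : ∀ d, D' d = 0 → d = 0 := by
    rintro ⟨dy, dW⟩ hd
    simp only [hD', Prod.mk_eq_zero] at hd
    obtain ⟨hd1, hd2⟩ := hd
    have h3 : cv π ⬝ᵥ cm (M 0) *ᵥ dW = 0 := by
      rw [Matrix.dotProduct_mulVec, cv_vecMul_cm, hl]
      simp [cv, dotProduct]
    have h4 := congrArg (fun x => cv π ⬝ᵥ x) hd1
    simp only [dotProduct_add, dotProduct_smul, h3, zero_add, dotProduct_zero, smul_eq_mul,
      cv_dotProduct_cv] at h4
    have h5 : dy = 0 := by
      have hs : ((π ⬝ᵥ (M 1 *ᵥ v₁ + M 2 *ᵥ v₀) : ℝ) : ℂ) ≠ 0 := by exact_mod_cast hsec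
      have hy : (y₀ : ℂ) ≠ 0 := by exact_mod_cast hy₀
      rw [← dotProduct_add] at h4
      have := (mul_eq_zero.mp h4).resolve_right hs
      simpa [hy] using this
    rw [h5, mul_zero, zero_smul, add_zero] at hd1
    rw [h5, hker dW hd1 hd2]
    rfl
  obtain ⟨g, hg, hg0, hgz, hgu⟩ := exists_analytic_implicit (E := ℂ × (S → ℂ))
    (F := (S → ℂ) × ℂ) (by simp [add_comm]) hfs.contDiffAt hzero hder hinj
  have hy : AnalyticAt ℂ (fun ζ => (g ζ).1) 0 := analyticAt_fst.comp hg
  have hW : AnalyticAt ℂ (fun ζ => (g ζ).2) 0 := analyticAt_snd.comp hg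
  refine ⟨fun ζ => (g ζ).1, fun ζ => cv v₀ + (ζ * (g ζ).1) • cv v₁ + ζ ^ 2 • (g ζ).2, hy, ?_,
    by simp [hg0], by simp, ?_, ?_⟩
  · exact (analyticAt_const.add ((analyticAt_id.mul hy).smul analyticAt_const)).add
      ((analyticAt_id.pow 2).smul hW)
  · filter_upwards [hgz] with ζ hζ
    rw [blowPoly_mulVec h0 h1]
    have : blowEq M D E v₀ v₁ (ζ, g ζ) = 0 := (Prod.mk_eq_zero.mp hζ).1
    rw [show (ζ, (g ζ).1, (g ζ).2) = (ζ, g ζ) from rfl, this, smul_zero]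
  -- The coefficients are real, so at real `t` the conjugate is again a nearby solution; local
  -- uniqueness makes it equal.
  · have hcoe : Filter.Tendsto (fun t : ℝ => (t : ℂ)) (𝓝 0) (𝓝 0) := by
      have := Complex.continuous_ofReal.tendsto (0 : ℝ)
      simpa using this
    have hgt : Filter.Tendsto (fun t : ℝ => g t) (𝓝 0) (𝓝 ((y₀ : ℂ), cv W₀)) := by
      rw [← hg0]; exact hg.continuousAt.tendsto.comp hcoe
    have hst : Filter.Tendsto (fun t : ℝ => ((t : ℂ), (star (g t).1, star (g t).2))) (𝓝 0)
        (𝓝 ((0 : ℂ), ((y₀ : ℂ), cv W₀))) := by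
      refine hcoe.prodMk_nhds (Filter.Tendsto.prodMk_nhds ?_ ?_)
      · have h1 : Filter.Tendsto (fun t : ℝ => (g t).1) (𝓝 0) (𝓝 (y₀ : ℂ)) :=
          (continuous_fst.tendsto _).comp hgt
        have := h1.star
        rwa [show star (y₀ : ℂ) = y₀ from Complex.conj_ofReal y₀] at this
      · have h1 : Filter.Tendsto (fun t : ℝ => (g t).2) (𝓝 0) (𝓝 (cv W₀)) :=
          (continuous_snd.tendsto _).comp hgt
        have := h1.star
        rwa [show star (cv W₀) = cv W₀ by ext a; simp [cv]] at this
    filter_upwards [hst.eventually hgu, hcoe.eventually hgz] with t ht1 ht2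
    have ht3 : blowEq M D E v₀ v₁ ((t : ℂ), g t) = 0 := (Prod.mk_eq_zero.mp ht2).1
    have ht4 : cv π ⬝ᵥ (g t).2 - cv π ⬝ᵥ cv W₀ = 0 := (Prod.mk_eq_zero.mp ht2).2
    have ht5 : g t = (star (g t).1, star (g t).2) := by
      refine ht1 ?_
      simp only [hf, Prod.mk_eq_zero]
      constructor
      · rw [← star_blowEq, show ((t : ℂ), (g t).1, (g t).2) = ((t : ℂ), g t) from rfl, ht3,
          star_zero]
      · have := congrArg star ht4
        simp only [star_sub, star_zero, dotProduct, star_sum, star_mul'] at this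
        simpa [cv, dotProduct] using this
    have e1 : star (g t).1 = (g t).1 := (congrArg Prod.fst ht5).symm
    have e2 : star (g t).2 = (g t).2 := (congrArg Prod.snd ht5).symm
    refine ⟨e1, ?_⟩
    simp only [star_add, star_smul, star_mul', star_pow, e1, e2]
    rw [show star (cv v₀) = cv v₀ by ext a; simp [cv], show star (cv v₁) = cv v₁ by ext a; simp [cv],
      show star (t : ℂ) = t from Complex.conj_ofReal t]

end Implicit

/-! ### The two eigenvalue branches at the extreme point -/

section Branches
variable {S : Type*} [Fintype S] [DecidableEq S] {A : ℤ → ℤ → Matrix S S ℝ}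

/-- The polynomial `a + s b + s² c` in powers of `s - w`: its Taylor coefficients at `w`. -/
def taylor (w : ℝ) (a b c : Matrix S S ℝ) : Fin 3 → Matrix S S ℝ :=
  ![a + w • b + w ^ 2 • c, b + (2 * w) • c, c]

/-- The coefficients of the expansion of `Lmat A (p - ζ²) (w + s)`, of order `0` in `ζ`. -/
def expand₀ (A : ℤ → ℤ → Matrix S S ℝ) (p w : ℝ) : Fin 3 → Matrix S S ℝ :=
  taylor w (A (-1) (-1) + p • A 0 (-1) + p ^ 2 • A 1 (-1))
    (A (-1) 0 + p • A 0 0 + p ^ 2 • A 1 0 - p • 1) (A (-1) 1 + p • A 0 1 + p ^ 2 • A 1 1)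

/-- The coefficients of the expansion of `Lmat A (p - ζ²) (w + s)`, of order `2` in `ζ`. -/
def expand₂ (A : ℤ → ℤ → Matrix S S ℝ) (p w : ℝ) : Fin 3 → Matrix S S ℝ :=
  taylor w (A 0 (-1) + (2 * p) • A 1 (-1)) (A 0 0 + (2 * p) • A 1 0 - 1) (A 0 1 + (2 * p) • A 1 1)

/-- The coefficients of the expansion of `Lmat A (p - ζ²) (w + s)`, of order `4` in `ζ`. -/
def expand₄ (A : ℤ → ℤ → Matrix S S ℝ) (w : ℝ) : Fin 3 → Matrix S S ℝ :=
  taylor w (A 1 (-1)) (A 1 0) (A 1 1)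

lemma smul_Astar {z : ℂ} (hz : z ≠ 0) (j : ℤ) :
    z • Astar A j z = cm (A (-1) j) + z • cm (A 0 j) + z ^ 2 • cm (A 1 j) := by
  simp only [Astar, sum_H, smul_add, smul_smul, zpow_neg_one, mul_inv_cancel₀ hz, zpow_zero,
    zpow_one, one_smul, cm, sq]

lemma Lmat_eq_blowPoly {p w : ℝ} {ζ s : ℂ} (hz : (p : ℂ) - ζ ^ 2 ≠ 0) :
    Lmat A (p - ζ ^ 2) (w + s) = blowPoly (expand₀ A p w) (expand₂ A p w) (expand₄ A w) ζ s := by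
  have h : ∀ j, ((p : ℂ) - ζ ^ 2) • Astar A j (p - ζ ^ 2) = cm (A (-1) j)
      + ((p : ℂ) - ζ ^ 2) • cm (A 0 j) + ((p : ℂ) - ζ ^ 2) ^ 2 • cm (A 1 j) :=
    smul_Astar hz
  have e : Lmat A (p - ζ ^ 2) (w + s) = ((p : ℂ) - ζ ^ 2) • Astar A (-1) (p - ζ ^ 2)
      + ((w : ℂ) + s) • (((p : ℂ) - ζ ^ 2) • Astar A 0 (p - ζ ^ 2) - ((p : ℂ) - ζ ^ 2) • 1)
      + ((w : ℂ) + s) ^ 2 • (((p : ℂ) - ζ ^ 2) • Astar A 1 (p - ζ ^ 2)) := by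
    rw [Lmat]; module
  rw [e, h, h, h]
  ext a b
  simp only [blowPoly, expand₀, expand₂, expand₄, taylor, cm, Matrix.add_apply, Matrix.sub_apply,
    Matrix.smul_apply, Matrix.map_apply, smul_eq_mul, Matrix.cons_val_zero, Matrix.cons_val_one,
    Matrix.cons_val, Matrix.one_apply]
  push_cast
  split_ifs <;> push_cast <;> ring

lemma smul_astar {x : ℝ} (hx : x ≠ 0) (j : ℤ) :
    x • astar A j x = A (-1) j + x • A 0 j + x ^ 2 • A 1 j := by
  simp only [astar, sum_H, smul_add, smul_smul, zpow_neg_one, mul_inv_cancel₀ hx, zpow_zero,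
    zpow_one, one_smul, sq]

lemma expand₀_zero {p w : ℝ} (hp : p ≠ 0) (hw : w ≠ 0) :
    expand₀ A p w 0 = (p * w) • (creal A p w - 1) := by
  simp only [expand₀, taylor, Matrix.cons_val_zero, ← smul_astar hp, creal_eq, smul_sub, smul_add,
    smul_smul]
  rw [show p * w * w⁻¹ = p by field_simp]
  module

lemma expand₀_one {p : ℝ} (hp : p ≠ 0) (w : ℝ) :
    expand₀ A p w 1 = p • (creal A p w - 1) + p • cderiv A p w := by
  simp only [expand₀, taylor, Matrix.cons_val_one, Matrix.cons_val_zero, ← smul_astar hp, creal_eq,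
    cderiv]
  module

lemma expand₀_two {p w : ℝ} (hp : p ≠ 0) : expand₀ A p w 2 = p • astar A 1 p := by
  simp [expand₀, taylor, smul_astar hp]

/-- The `z`-derivative of `z w (C - I)` is `w (C - I)` plus `w` times `z ∂C/∂z`; the first part
kills `v`, and the second pairs to the horizontal drift. -/
lemma dotProduct_expand₂ {p w : ℝ} (hp : p ≠ 0) (hw : w ≠ 0) {v : S → ℝ} (π : S → ℝ)
    (h : creal A p w *ᵥ v = v) : π ⬝ᵥ expand₂ A p w 0 *ᵥ v = w * drift₁ A p w π v := by
  have e : expand₂ A p w 0 *ᵥ v = expand₂ A p w 0 *ᵥ v - w • (creal A p w *ᵥ v - v) := by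
    rw [h, sub_self, smul_zero, sub_zero]
  have e2 : expand₂ A p w 0 *ᵥ v - w • (creal A p w *ᵥ v - v)
      = (expand₂ A p w 0 - w • (creal A p w - 1)) *ᵥ v := by
    simp only [Matrix.sub_mulVec, Matrix.smul_mulVec, Matrix.one_mulVec]
  rw [e, e2, drift₁, sum_trans]
  simp only [wt, Matrix.mulVec, dotProduct, Finset.mul_sum]
  refine Finset.sum_congr rfl fun a _ => Finset.sum_congr rfl fun b _ => ?_
  simp only [Matrix.sub_apply, Matrix.smul_apply, creal_apply, sum_H, expand₂, taylor,
    Matrix.cons_val_zero, Matrix.add_apply, smul_eq_mul, zpow_neg_one, zpow_zero, zpow_one]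
  push_cast
  field_simp
  ring

/-- Strict convexity at the extreme point. -/
lemma second_variation_pos [Nonempty S] (hA : ∀ i ∈ H, ∀ j ∈ H, ∀ a b : S, 0 ≤ A i j a b)
    (hirr : ChainIrreducible (transition A)) {p w : ℝ} (hp : 0 < p) (hw : 0 < w)
    {v π d : S → ℝ} (hv : ∀ a, 0 < v a) (hπ : ∀ a, 0 < π a) (h : creal A p w *ᵥ v = v)
    (hl : π ᵥ* creal A p w = π) (hdr : drift₂ A p w π v = 0)
    (hd : creal A p w *ᵥ d - d = -cderiv A p w *ᵥ v) :
    0 < π ⬝ᵥ (cderiv A p w *ᵥ d) + π ⬝ᵥ ((w • astar A 1 p) *ᵥ v) := by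
  set g : S → ℝ := fun a => d a / v a with hg
  have hdg : d = fun a => v a * g a := by
    ext a; simp only [hg]; field_simp [(hv a).ne']
  have key : ∀ f k : S → ℝ, ∑ q ∈ trans S, wt A p w π v q * ((q.2.1 : ℝ) * (f q.2.2.1 * k q.2.2.2))
      = ∑ a, π a * f a * (cderiv A p w *ᵥ (fun b => v b * k b)) a := by
    intro f k
    have := drift₂_eq (A := A) p w (fun a => π a * f a) (fun b => v b * k b)
    rw [dotProduct] at this
    rw [← this, drift₂]
    refine Finset.sum_congr rfl fun q _ => ?_
    simp only [wt]; ring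
  have key2 : ∑ q ∈ trans S, wt A p w π v q * (g q.2.2.1 * g q.2.2.2)
      = ∑ a, π a * g a * (creal A p w *ᵥ d) a := by
    have := sum_wt_left (A := A) p w π (fun b => v b * g b) g
    rw [← hdg] at this
    rw [← this]
    refine Finset.sum_congr rfl fun q _ => ?_
    simp only [wt, hdg]; ring
  have k1 := key g (fun _ => 1)
  have k2 := key (fun _ => 1) g
  rw [← hdg] at k2
  simp only [mul_one, one_mul] at k1 k2
  have k3 := sum_wt_left (A := A) p w π v (fun a => g a ^ 2)
  have k4 := sum_wt_right (A := A) p w π v (fun a => g a ^ 2)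
  rw [h] at k3
  rw [hl] at k4
  -- Adding the vanishing drift turns `j²` into `j² + j`, which is `2` for `j = 1` and `0`
  -- otherwise.
  have k5 : ∑ q ∈ trans S, wt A p w π v q * ((q.2.1 : ℝ)) ^ 2
      = 2 * π ⬝ᵥ ((w • astar A 1 p) *ᵥ v) := by
    have e : ∑ q ∈ trans S, wt A p w π v q * ((q.2.1 : ℝ)) ^ 2 = ∑ q ∈ trans S,
        wt A p w π v q * ((q.2.1 : ℝ)) ^ 2 + drift₂ A p w π v := by rw [hdr, add_zero]
    rw [e, drift₂, ← Finset.sum_add_distrib, sum_trans]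
    simp only [wt, Matrix.mulVec, dotProduct, Finset.mul_sum]
    refine Finset.sum_congr rfl fun a _ => Finset.sum_congr rfl fun b _ => ?_
    simp only [Matrix.smul_apply, astar, Matrix.add_apply, sum_H, smul_eq_mul]
    push_cast
    simp only [zpow_neg_one, zpow_zero, zpow_one]
    ring
  have k6 : ∑ a, π a * g a * (cderiv A p w *ᵥ v) a = ∑ a, π a * g a * d a
      - ∑ a, π a * g a * (creal A p w *ᵥ d) a := by
    rw [← Finset.sum_sub_distrib]
    refine Finset.sum_congr rfl fun a _ => ?_
    have := congrFun hd a
    simp only [Matrix.neg_mulVec, Pi.sub_apply, Pi.neg_apply] at this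
    rw [← mul_sub]
    congr 1
    linarith
  have k7 : ∑ a, π a * g a * d a = ∑ a, π a * v a * g a ^ 2 :=
    Finset.sum_congr rfl fun a _ => by simp only [hdg]; ring
  have k8 : ∑ a, π a * g a ^ 2 * v a = ∑ a, π a * v a * g a ^ 2 :=
    Finset.sum_congr rfl fun a _ => by ring
  -- This sum of squares is twice the quantity in question; some transition contributes, since `j +
  -- g b - g a` cannot vanish on all of them.
  have hpos : 0 < ∑ q ∈ trans S, wt A p w π v q * ((q.2.1 : ℝ) + g q.2.2.2 - g q.2.2.1) ^ 2 := by
    obtain ⟨i, hi, j, hj, a, b, hpab, hne⟩ := exists_transition_ne hirr g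
      (show ¬((0 : ℝ) = 0 ∧ (1 : ℝ) = 0) by simp)
    refine Finset.sum_pos' (fun q hq => mul_nonneg (wt_nonneg hA hp hw hπ hv hq) (sq_nonneg _))
      ⟨(i, j, a, b), by simp [trans, hi, hj], mul_pos (wt_pos hp hw hπ hv hpab) ?_⟩
    simp only [mul_zero, mul_one, zero_add] at hne
    positivity
  have e : ∑ q ∈ trans S, wt A p w π v q * ((q.2.1 : ℝ) + g q.2.2.2 - g q.2.2.1) ^ 2
      = ∑ q ∈ trans S, wt A p w π v q * ((q.2.1 : ℝ)) ^ 2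
        + ∑ q ∈ trans S, wt A p w π v q * (g q.2.2.2) ^ 2
        + ∑ q ∈ trans S, wt A p w π v q * (g q.2.2.1) ^ 2
        + 2 * ∑ q ∈ trans S, wt A p w π v q * ((q.2.1 : ℝ) * g q.2.2.2)
        - 2 * ∑ q ∈ trans S, wt A p w π v q * ((q.2.1 : ℝ) * g q.2.2.1)
        - 2 * ∑ q ∈ trans S, wt A p w π v q * (g q.2.2.1 * g q.2.2.2) := by
    simp only [Finset.mul_sum, ← Finset.sum_add_distrib, ← Finset.sum_sub_distrib]
    exact Finset.sum_congr rfl fun q _ => by ring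
  rw [e, k1, k2, k3, k4, k5, k6, key2, k7, k8] at hpos
  have : π ⬝ᵥ (cderiv A p w *ᵥ d) = ∑ a, π a * (cderiv A p w *ᵥ d) a := rfl
  rw [this]
  linarith

/-- The eigenvalue `w ζ` and the kernel vector `v ζ` of `Lmat A (zBar A - ζ²)` near the extreme
point `(zBar A, w₀)`; the two branches are `ζ` and `-ζ`. -/
structure IsBranchPair (A : ℤ → ℤ → Matrix S S ℝ) (w₀ : ℝ) (v₀ π : S → ℝ) (w : ℂ → ℂ)
    (v : ℂ → S → ℂ) : Prop where
  w₀_pos : 0 < w₀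
  v₀_pos : ∀ a, 0 < v₀ a
  π_pos : ∀ a, 0 < π a
  right : creal A (zBar A) w₀ *ᵥ v₀ = v₀
  left : π ᵥ* creal A (zBar A) w₀ = π
  drift : drift₂ A (zBar A) w₀ π v₀ = 0
  an_w : AnalyticAt ℂ w 0
  an_v : AnalyticAt ℂ v 0
  w_zero : w 0 = w₀
  v_zero : v 0 = cv v₀
  ker : ∀ᶠ ζ in 𝓝 (0 : ℂ), Lmat A (zBar A - ζ ^ 2) (w ζ) *ᵥ v ζ = 0
  real : ∀ᶠ t : ℝ in 𝓝 0, star (w t) = w t ∧ star (v t) = v t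
  lt : ∀ᶠ t : ℝ in 𝓝[>] 0, (w t).re < (w (-t)).re

/-- A fold: along the curve, `zBar - z` is to leading order a positive multiple of `(w - w₀)²`, by
the signs of the horizontal drift and of the second variation. -/
lemma exists_branches [Nonempty S] (hA : ∀ i ∈ H, ∀ j ∈ H, ∀ a b : S, 0 ≤ A i j a b)
    (hstoch : ∀ a : S, ∑ b : S, total A a b = 1)
    (hirr : ChainIrreducible (transition A)) (hlt : zLow A < zBar A) :
    ∃ (w₀ : ℝ) (v₀ π : S → ℝ) (w : ℂ → ℂ) (v : ℂ → S → ℂ), IsBranchPair A w₀ v₀ π w v := by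
  obtain ⟨w₀, v₀, π, hw, hv, hπ, h, hl, hdr₂, hdr₁⟩ := exists_extremal hA hstoch hirr hlt
  set p := zBar A with hpdef
  have hp : 0 < p := zBar_pos A
  have hi := irred_creal hA hirr hp hw
  -- The first-order equation for the kernel vector is solvable because the vertical drift vanishes.
  obtain ⟨d, hd⟩ := exists_solution hi hv hπ hl (y := -cderiv A p w₀ *ᵥ v₀) (by
    rw [Matrix.neg_mulVec, dotProduct_neg, ← drift₂_eq, hdr₂, neg_zero])
  have hsec := second_variation_pos hA hirr hp hw hv hπ h hl hdr₂ hd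
  have hl0 : ∀ x, π ⬝ᵥ ((creal A p w₀ - 1) *ᵥ x) = 0 := by
    intro x
    rw [Matrix.dotProduct_mulVec, Matrix.vecMul_sub, hl, Matrix.vecMul_one, sub_self,
      zero_dotProduct]
  set v₁ := w₀⁻¹ • d with hv₁
  set K := π ⬝ᵥ (expand₀ A p w₀ 1 *ᵥ v₁ + expand₀ A p w₀ 2 *ᵥ v₀) with hK
  have hKpos : 0 < K := by
    have e : K = p * w₀⁻¹ * (π ⬝ᵥ (cderiv A p w₀ *ᵥ d) + π ⬝ᵥ ((w₀ • astar A 1 p) *ᵥ v₀)) := by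
      rw [hK, expand₀_one hp.ne', expand₀_two hp.ne', Matrix.add_mulVec, dotProduct_add,
        dotProduct_add, Matrix.smul_mulVec, dotProduct_smul, hl0, hv₁]
      simp only [Matrix.smul_mulVec, Matrix.mulVec_smul, dotProduct_smul, smul_eq_mul]
      field_simp
      ring
    rw [e]; positivity
  have hm : 0 < π ⬝ᵥ expand₂ A p w₀ 0 *ᵥ v₀ := by
    rw [dotProduct_expand₂ hp.ne' hw.ne' π h]; positivity
  -- The second-order solvability condition fixes `y₀²`; the negative root assigns the smaller
  -- solution to `ζ > 0`.
  set y₀ := -Real.sqrt (π ⬝ᵥ expand₂ A p w₀ 0 *ᵥ v₀ / K) with hy₀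
  have hy₀neg : y₀ < 0 := neg_lt_zero.mpr (Real.sqrt_pos.mpr (div_pos hm hKpos))
  have hy₀sq : y₀ ^ 2 * K = π ⬝ᵥ expand₂ A p w₀ 0 *ᵥ v₀ := by
    rw [hy₀, neg_sq, Real.sq_sqrt (div_pos hm hKpos).le, div_mul_cancel₀ _ hKpos.ne']
  obtain ⟨W, hW⟩ := exists_solution hi hv hπ hl (y := (p * w₀)⁻¹ • (expand₂ A p w₀ 0 *ᵥ v₀
      - y₀ ^ 2 • (expand₀ A p w₀ 1 *ᵥ v₁ + expand₀ A p w₀ 2 *ᵥ v₀))) (by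
    rw [dotProduct_smul, dotProduct_sub, dotProduct_smul, ← hK, smul_eq_mul, smul_eq_mul, hy₀sq,
      sub_self, mul_zero])
  have h00 := expand₀_zero (A := A) hp.ne' hw.ne'
  have hM0 : ∀ x, expand₀ A p w₀ 0 *ᵥ x = (p * w₀) • (creal A p w₀ *ᵥ x - x) := by
    intro x
    rw [h00, Matrix.smul_mulVec, Matrix.sub_mulVec, Matrix.one_mulVec]
  have hpw : p * w₀ ≠ 0 := (mul_pos hp hw).ne'
  obtain ⟨y, v, hy, hvan, hy0, hv0, heq, hreal⟩ := exists_blow_up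
    (M := expand₀ A p w₀) (D := expand₂ A p w₀) (E := expand₄ A w₀) (v₀ := v₀) (v₁ := v₁) (π := π)
    (by rw [hM0, h, sub_self, smul_zero])
    (by
      rw [hM0, hv₁, Matrix.mulVec_smul, ← smul_sub, hd, expand₀_one hp.ne',
        Matrix.add_mulVec, Matrix.smul_mulVec, Matrix.smul_mulVec, Matrix.sub_mulVec, h,
        Matrix.one_mulVec, sub_self, smul_zero, zero_add, smul_smul, Matrix.neg_mulVec,
        mul_assoc, mul_inv_cancel₀ hw.ne', mul_one, smul_neg, neg_add_cancel])
    (by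
      rw [h00, Matrix.vecMul_smul, Matrix.vecMul_sub, hl, Matrix.vecMul_one, sub_self, smul_zero])
    (by
      intro x hx hπx
      refine perron_simple hi hπ hl (x := x) ?_ ?_
      · ext a
        have h1 := congrFun hx a
        rw [h00] at h1
        have h2 : (cm ((p * w₀) • (creal A p w₀ - 1)) *ᵥ x) a
            = (p * w₀ : ℝ) * ((((creal A p w₀).map (fun a : ℝ => (a : ℂ))) *ᵥ x) a - x a) := by
          have : cm ((p * w₀) • (creal A p w₀ - 1))
              = ((p * w₀ : ℝ) : ℂ) • ((creal A p w₀).map (fun a : ℝ => (a : ℂ)) - 1) := by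
            ext i j
            simp only [cm, Matrix.map_apply, Matrix.smul_apply, Matrix.sub_apply, smul_eq_mul,
              Matrix.one_apply]
            split_ifs <;> push_cast <;> ring
          rw [this, Matrix.smul_mulVec, Matrix.sub_mulVec, Matrix.one_mulVec]
          rfl
        rw [h2] at h1
        have h3 : ((p * w₀ : ℝ) : ℂ) ≠ 0 := by exact_mod_cast hpw
        exact sub_eq_zero.mp ((mul_eq_zero.mp h1).resolve_left h3)
      · rw [← hπx, dotProduct]
        exact Finset.sum_congr rfl fun a _ => mul_comm _ _)
    hKpos.ne' hy₀neg.ne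
    (W₀ := W) (by rw [hM0, hW, smul_smul, mul_inv_cancel₀ hpw, one_smul, sub_add_cancel])
  refine ⟨w₀, v₀, π, fun ζ => w₀ + ζ * y ζ, v, hw, hv, hπ, h, hl, hdr₂,
    analyticAt_const.add (analyticAt_id.mul hy), hvan, by simp, hv0, ?_, ?_, ?_⟩
  · have hne : ∀ᶠ ζ : ℂ in 𝓝 0, (p : ℂ) - ζ ^ 2 ≠ 0 := by
      refine ContinuousAt.eventually_ne (by fun_prop) ?_
      simpa using hp.ne'
    filter_upwards [heq, hne] with ζ h1 h2
    rw [Lmat_eq_blowPoly h2, h1]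
  · filter_upwards [hreal] with t ht
    refine ⟨?_, ht.2⟩
    rw [star_add, star_mul', ht.1]
    simp
  · have hneg : ∀ᶠ ζ : ℂ in 𝓝 0, (y ζ).re < 0 := by
      refine (Complex.continuous_re.continuousAt.comp hy.continuousAt).eventually_lt_const ?_
      simpa [hy0] using hy₀neg
    have hc1 : Filter.Tendsto (fun t : ℝ => (t : ℂ)) (𝓝[>] 0) (𝓝 0) := by
      have := Complex.continuous_ofReal.tendsto (0 : ℝ)
      rw [Complex.ofReal_zero] at this
      exact this.mono_left nhdsWithin_le_nhds
    have hc2 : Filter.Tendsto (fun t : ℝ => -(t : ℂ)) (𝓝[>] 0) (𝓝 0) := by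
      simpa using hc1.neg
    filter_upwards [hc1.eventually hneg, hc2.eventually hneg, self_mem_nhdsWithin] with t h1 h2 h3
    have h3 : 0 < t := h3
    have e1 : ((w₀ : ℂ) + t * y t).re = w₀ + t * (y t).re := by simp
    have e2 : ((w₀ : ℂ) + -t * y (-t)).re = w₀ - t * (y (-t)).re := by
      simp [sub_eq_add_neg]
    rw [e1, e2]
    nlinarith [mul_pos_of_neg_of_neg h1 (neg_lt_zero.mpr h3), mul_pos_of_neg_of_neg h2 (neg_lt_zero.mpr h3)]

end Branches

/-! ### The branches at real points, and the Perron value of `G₁` -/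

section RealBranch
variable {S : Type*} [Fintype S] [DecidableEq S] {A : ℤ → ℤ → Matrix S S ℝ}

lemma cv_injective : Function.Injective (cv : (S → ℝ) → S → ℂ) := fun u v h => by
  ext a
  have := congrFun h a
  simpa [cv] using this

lemma cm_add (M N : Matrix S S ℝ) : cm (M + N) = cm M + cm N := by ext; simp [cm]
lemma cm_sub (M N : Matrix S S ℝ) : cm (M - N) = cm M - cm N := by ext; simp [cm]
lemma cm_one : cm (1 : Matrix S S ℝ) = 1 := by
  ext a b; simp only [cm, Matrix.map_apply, Matrix.one_apply]; split_ifs <;> simp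
lemma cm_smul (c : ℝ) (M : Matrix S S ℝ) : cm (c • M) = (c : ℂ) • cm M := by ext; simp [cm]
lemma cm_mul (M N : Matrix S S ℝ) : cm (M * N) = cm M * cm N := by
  ext; simp [cm, Matrix.mul_apply]
lemma cm_pow (M : Matrix S S ℝ) (n : ℕ) : cm (M ^ n) = cm M ^ n := by
  induction n with
  | zero => simp [cm_one]
  | succ n ih => rw [pow_succ, pow_succ, cm_mul, ih]

lemma Astar_ofReal' (A : ℤ → ℤ → Matrix S S ℝ) (j : ℤ) (x : ℝ) :
    Astar A j (x : ℂ) = cm (astar A j x) := Astar_ofReal A j x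

lemma Lmat_ofReal (A : ℤ → ℤ → Matrix S S ℝ) (x : ℝ) {w : ℝ} (hw : w ≠ 0) :
    Lmat A x w = cm ((x * w) • (creal A x w - 1)) := by
  have e : (x * w) • (creal A x w - 1)
      = x • astar A (-1) x + (x * w) • (astar A 0 x - 1) + (x * w ^ 2) • astar A 1 x := by
    rw [creal_eq]
    simp only [smul_sub, smul_add, smul_smul]
    rw [show x * w * w⁻¹ = x by field_simp]
    module
  rw [e, Lmat, Astar_ofReal', Astar_ofReal', Astar_ofReal']
  simp only [cm_add, cm_sub, cm_smul, cm_one]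
  push_cast
  rfl

lemma zeta_eq [Nonempty S] (hA : ∀ i ∈ H, ∀ j ∈ H, ∀ a b : S, 0 ≤ A i j a b)
    (hirr : ChainIrreducible (transition A)) {x α β : ℝ} (hx : 0 < x) (hα : 0 < α) (hαβ : α < β)
    (h1 : chi A x α = 1) (h2 : chi A x β = 1) : zetaLow A x = α ∧ zetaHigh A x = β := by
  have e : {w | 0 < w ∧ chi A x w = 1} = {α, β} := by
    ext w
    simp only [Set.mem_ofPred_eq, Set.mem_insert_iff, Set.mem_singleton_iff]
    constructor
    · rintro ⟨hw, hw1⟩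
      by_contra! hne
      rcases lt_or_gt_of_ne hne.1 with h | h
      · exact chi_eq_one_at_most_two hA hirr hx hw h hαβ hw1 h1 h2
      · rcases lt_or_gt_of_ne hne.2 with h' | h'
        · exact chi_eq_one_at_most_two hA hirr hx hα h h' h1 hw1 h2
        · exact chi_eq_one_at_most_two hA hirr hx hα hαβ h' h1 h2 hw1
    · rintro (rfl | rfl)
      · exact ⟨hα, h1⟩
      · exact ⟨hα.trans hαβ, h2⟩
  rw [zetaLow, zetaHigh, e]
  exact ⟨by rw [csInf_pair, inf_of_le_left hαβ.le], by rw [csSup_pair, sup_of_le_right hαβ.le]⟩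

/-- Left multiplication of the censored generator by a stationary vector. -/
lemma factor_identity {Bm B0 Bp G : Matrix S S ℝ} (hq : Bm + B0 * G + Bp * G ^ 2 = G) {w : ℝ}
    (hw : w ≠ 0) : (1 - (B0 + Bp * G) - w • Bp) * (w • 1 - G)
      = w • (1 - (w⁻¹ • Bm + B0 + w • Bp)) := by
  have e : w • (w⁻¹ • Bm + B0 + w • Bp) = Bm + w • B0 + w ^ 2 • Bp := by
    simp only [smul_add, smul_smul, mul_inv_cancel₀ hw, one_smul, sq]
  rw [smul_sub, e]
  have h2 : Bm = G - B0 * G - Bp * G ^ 2 := by nth_rw 1 [← hq]; abel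
  rw [h2]
  simp only [sub_mul, add_mul, mul_sub, Matrix.mul_smul, Matrix.smul_mul, Matrix.mul_one,
    Matrix.one_mul, pow_two, Matrix.mul_assoc]
  module

/-- A substochastic vector below the spectral gap. -/
lemma left_eq_zero_of_lt {G : Matrix S S ℝ} (hG : ∀ a b, 0 ≤ G a b) {v τ : S → ℝ}
    (hv : ∀ a, 0 < v a) {α β : ℝ} (hαβ : α < β) (hβ : 0 ≤ β) (hGv : G *ᵥ v ≤ α • v)
    (hτ : τ ᵥ* G = β • τ) : τ = 0 := by
  have h1 : β * ∑ b, |τ b| * v b ≤ α * ∑ b, |τ b| * v b := by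
    calc β * ∑ b, |τ b| * v b = ∑ b, |(τ ᵥ* G) b| * v b := by
          rw [Finset.mul_sum]
          refine Finset.sum_congr rfl fun b _ => ?_
          rw [hτ, Pi.smul_apply, smul_eq_mul, abs_mul, abs_of_nonneg hβ, mul_assoc]
      _ ≤ ∑ b, (∑ a, |τ a| * G a b) * v b := by
          refine Finset.sum_le_sum fun b _ => mul_le_mul_of_nonneg_right ?_ (hv b).le
          refine (Finset.abs_sum_le_sum_abs _ _).trans (Finset.sum_le_sum fun a _ => ?_)
          rw [abs_mul, abs_of_nonneg (hG a b)]
      _ = ∑ a, |τ a| * (G *ᵥ v) a := by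
          simp only [Matrix.mulVec, dotProduct, Finset.sum_mul, Finset.mul_sum]
          rw [Finset.sum_comm]
          exact Finset.sum_congr rfl fun a _ => Finset.sum_congr rfl fun b _ => by ring
      _ ≤ ∑ a, |τ a| * (α * v a) :=
          Finset.sum_le_sum fun a _ => mul_le_mul_of_nonneg_left (hGv a) (abs_nonneg _)
      _ = α * ∑ b, |τ b| * v b := by
          rw [Finset.mul_sum]; exact Finset.sum_congr rfl fun b _ => by ring
  have h2 : ∑ b, |τ b| * v b ≤ 0 := by
    by_contra hcon
    push Not at hcon
    nlinarith
  have h3 := (Finset.sum_eq_zero_iff_of_nonneg fun b _ => mul_nonneg (abs_nonneg (τ b)) (hv b).le).mp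
    (le_antisymm h2 (Finset.sum_nonneg fun b _ => mul_nonneg (abs_nonneg _) (hv b).le))
  ext b
  have := h3 b (Finset.mem_univ b)
  simpa [(hv b).ne'] using this

/-- Below the extreme point the Perron value of `G` is the smaller solution of `χ(x,w) = 1`. -/
lemma greal_mulVec_eq [Nonempty S] (hA : ∀ i ∈ H, ∀ j ∈ H, ∀ a b : S, 0 ≤ A i j a b)
    (hstoch : ∀ a : S, ∑ b : S, total A a b = 1)
    (hirr : ChainIrreducible (transition A)) {x : ℝ} (h1 : zLow A ≤ x) (h2 : x ≤ zBar A)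
    {α β : ℝ} (hα : 0 < α) (hαβ : α < β) {v v' : S → ℝ} (hv : ∀ a, 0 < v a) (hv' : ∀ a, 0 < v' a)
    (h : creal A x α *ᵥ v = v) (h' : creal A x β *ᵥ v' = v') : greal A x *ᵥ v = α • v := by
  have hx : 0 < x := (zLow_pos A).trans_le h1
  have hβ := hα.trans hαβ
  obtain ⟨π, hπ, hl⟩ := exists_left (creal_nonneg hA hx hβ) (irred_creal hA hirr hx hβ) hv'
    (c := 1) (by rw [h', one_smul])
  rw [one_smul] at hl
  set G := greal A x with hGdef
  have hG := greal_nonneg hA hstoch hirr h1 h2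
  have hq := greal_quadratic hA hstoch hirr h1 h2
  have hGv : G *ᵥ v ≤ α • v := greal_mulVec_le hA hstoch hirr h1 h2 hα hv h.le
  set U := astar A 0 x + astar A 1 x * G with hU
  have fβ := factor_identity hq hβ.ne'
  have fα := factor_identity hq hα.ne'
  rw [← creal_eq] at fβ fα
  -- By the factorization this row vector is a left eigenvector of `G` for `β`, beyond the spectral
  -- bound `α`.
  have hτ : π ᵥ* (1 - U - β • astar A 1 x) = 0 := by
    refine left_eq_zero_of_lt hG hv hαβ hβ.le hGv ?_
    have := congrArg (fun M => π ᵥ* M) fβ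
    simp only [← Matrix.vecMul_vecMul] at this
    rw [Matrix.vecMul_smul π, Matrix.vecMul_sub 1 (creal A x β) π, hl, Matrix.vecMul_one, sub_self, smul_zero,
      Matrix.vecMul_sub, Matrix.vecMul_smul, Matrix.vecMul_one] at this
    exact (sub_eq_zero.mp this).symm
  -- The defect is nonnegative and, by the factorization at `α`, satisfies `y = U y + α A_{*,1} y`.
  set y := α • v - G *ᵥ v with hy
  have hy0 : 0 ≤ y := sub_nonneg.mpr hGv
  have hy1 : y = U *ᵥ y + α • (astar A 1 x *ᵥ y) := by
    have := congrArg (fun M => M *ᵥ v) fα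
    simp only [← Matrix.mulVec_mulVec] at this
    rw [Matrix.smul_mulVec, Matrix.sub_mulVec (1 : Matrix S S ℝ), h, Matrix.one_mulVec, sub_self,
      smul_zero, Matrix.sub_mulVec (α • (1 : Matrix S S ℝ)), Matrix.smul_mulVec, Matrix.one_mulVec,
      ← hy, Matrix.sub_mulVec, Matrix.sub_mulVec, Matrix.one_mulVec, Matrix.smul_mulVec,
      sub_sub, sub_eq_zero] at this
    exact this
  have hB := astar_nonneg hA one_mem_H hx
  -- Pairing with `π` gives the same identity with `β` in place of `α`; subtract. What remains is `y
  -- = U y`, excluded by transience.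
  have hAy : astar A 1 x *ᵥ y = 0 := by
    have e1 : π ⬝ᵥ y = π ⬝ᵥ (U *ᵥ y) + β * (π ⬝ᵥ (astar A 1 x *ᵥ y)) := by
      have : π ⬝ᵥ ((1 - U - β • astar A 1 x) *ᵥ y) = 0 := by
        rw [Matrix.dotProduct_mulVec, hτ, zero_dotProduct]
      rw [Matrix.sub_mulVec, Matrix.sub_mulVec, Matrix.one_mulVec, Matrix.smul_mulVec,
        dotProduct_sub, dotProduct_sub, dotProduct_smul, smul_eq_mul] at this
      linarith
    have e2 : π ⬝ᵥ y = π ⬝ᵥ (U *ᵥ y) + α * (π ⬝ᵥ (astar A 1 x *ᵥ y)) := by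
      conv_lhs => rw [hy1]
      rw [dotProduct_add, dotProduct_smul, smul_eq_mul]
    have e3 : π ⬝ᵥ (astar A 1 x *ᵥ y) = 0 := by
      have : (β - α) * (π ⬝ᵥ (astar A 1 x *ᵥ y)) = 0 := by linarith
      exact (mul_eq_zero.mp this).resolve_left (sub_pos.mpr hαβ).ne'
    have hn := mulVec_nonneg' hB hy0
    have e4 := (Finset.sum_eq_zero_iff_of_nonneg fun a _ => mul_nonneg (hπ a).le (hn a)).mp e3
    ext a
    have := e4 a (Finset.mem_univ a)
    simpa [(hπ a).ne'] using this
  rw [hAy, smul_zero, add_zero] at hy1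
  have := censored_transient (astar_nonneg hA neg_one_mem_H hx) (astar_nonneg hA zero_mem_H hx) hB
    hG hq (levelIrr_astar hA hirr hx) hv hα hGv (by rw [← creal_eq, h]) hy0 hy1.le
  exact (sub_eq_zero.mp this).symm

variable {w₀ : ℝ} {v₀ π : S → ℝ} {w : ℂ → ℂ} {v : ℂ → S → ℂ}

lemma tendsto_ofReal_zero : Filter.Tendsto (fun t : ℝ => (t : ℂ)) (𝓝 0) (𝓝 0) := by
  simpa using Complex.continuous_ofReal.tendsto (0 : ℝ)

lemma IsBranchPair.eventually_real (h : IsBranchPair A w₀ v₀ π w v) :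
    ∀ᶠ t : ℝ in 𝓝 0, 0 < (w t).re ∧ (∀ a, 0 < (v t a).re) ∧ w t = ((w t).re : ℂ) ∧
      v t = cv (fun a => (v t a).re) ∧
      creal A (zBar A - t ^ 2) (w t).re *ᵥ (fun a => (v t a).re) = fun a => (v t a).re := by
  have hw : ∀ᶠ ζ : ℂ in 𝓝 0, 0 < (w ζ).re := by
    refine (Complex.continuous_re.continuousAt.comp h.an_w.continuousAt).eventually_const_lt ?_
    simpa [h.w_zero] using h.w₀_pos
  have hv : ∀ᶠ ζ : ℂ in 𝓝 0, ∀ a, 0 < (v ζ a).re := by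
    refine Filter.eventually_all.mpr fun a => ?_
    have hc : ContinuousAt (fun ζ => v ζ a) 0 :=
      (continuous_apply a).continuousAt.comp h.an_v.continuousAt
    refine (Complex.continuous_re.continuousAt.comp hc).eventually_const_lt ?_
    simpa [h.v_zero, cv] using h.v₀_pos a
  have hx : ∀ᶠ t : ℝ in 𝓝 0, 0 < zBar A - t ^ 2 := by
    have hc : Filter.Tendsto (fun t : ℝ => zBar A - t ^ 2) (𝓝 0) (𝓝 (zBar A)) :=
      Continuous.tendsto' (by fun_prop) _ _ (by simp)
    exact hc.eventually_const_lt (zBar_pos A)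
  filter_upwards [h.real, tendsto_ofReal_zero.eventually hw, tendsto_ofReal_zero.eventually hv,
    tendsto_ofReal_zero.eventually h.ker, hx] with t hr h1 h2 h3 hx
  have e1 : w t = ((w t).re : ℂ) := (Complex.conj_eq_iff_re.mp hr.1).symm
  have e2 : v t = cv (fun a => (v t a).re) := by
    ext a
    exact (Complex.conj_eq_iff_re.mp (congrFun hr.2 a)).symm
  refine ⟨h1, h2, e1, e2, ?_⟩
  rw [e2, e1, show (zBar A : ℂ) - (t : ℂ) ^ 2 = ((zBar A - t ^ 2 : ℝ) : ℂ) by push_cast; rfl,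
    Lmat_ofReal A _ h1.ne', cm_mulVec_cv] at h3
  have h4 := cv_injective (h3.trans (show (0 : S → ℂ) = cv 0 by ext; simp [cv]))
  rw [Matrix.smul_mulVec, Matrix.sub_mulVec, Matrix.one_mulVec] at h4
  exact sub_eq_zero.mp ((smul_eq_zero.mp h4).resolve_left (mul_pos hx h1).ne')

/-- Two distinct real solutions with positive eigenvectors must be `zetaLow` and `zetaHigh`, by
`zeta_eq`. They also supply both eigenvectors needed to compute the Perron value of `G₁`. -/
lemma IsBranchPair.eventually_pos [Nonempty S]
    (hA : ∀ i ∈ H, ∀ j ∈ H, ∀ a b : S, 0 ≤ A i j a b)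
    (hstoch : ∀ a : S, ∑ b : S, total A a b = 1)
    (hirr : ChainIrreducible (transition A)) (hlt : zLow A < zBar A)
    (h : IsBranchPair A w₀ v₀ π w v) :
    ∀ᶠ t : ℝ in 𝓝[>] 0, w t = zetaLow A (zBar A - t ^ 2) ∧ w (-t) = zetaHigh A (zBar A - t ^ 2) ∧
      zLow A < zBar A - t ^ 2 ∧
      ‖w t‖ < ‖w (-t)‖ ∧ cm (greal A (zBar A - t ^ 2)) *ᵥ v t = w t • v t := by
  have hx : ∀ᶠ t : ℝ in 𝓝 0, zLow A < zBar A - t ^ 2 := by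
    have hc : Filter.Tendsto (fun t : ℝ => zBar A - t ^ 2) (𝓝 0) (𝓝 (zBar A)) :=
      Continuous.tendsto' (by fun_prop) _ _ (by simp)
    exact hc.eventually_const_lt hlt
  have hn : Filter.Tendsto (fun t : ℝ => -t) (𝓝 0) (𝓝 0) := by
    simpa using (continuous_neg (G := ℝ)).tendsto 0
  have hr := h.eventually_real
  filter_upwards [h.lt, nhdsWithin_le_nhds hx, nhdsWithin_le_nhds hr,
    nhdsWithin_le_nhds (hn.eventually hr)] with t h1 h2 h3 h4
  obtain ⟨p1, p2, p3, p4, p5⟩ := h3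
  simp only [Complex.ofReal_neg, neg_sq] at h4
  obtain ⟨q1, q2, q3, q4, q5⟩ := h4
  have hx0 : 0 < zBar A - t ^ 2 := (zLow_pos A).trans h2
  obtain ⟨z1, z2⟩ := zeta_eq hA hirr hx0 p1 h1 (chi_eq_one_of hA hx0 p1 p2 p5)
    (chi_eq_one_of hA hx0 q1 q2 q5)
  have hG := greal_mulVec_eq hA hstoch hirr h2.le (by nlinarith [sq_nonneg t]) p1 h1 p2 q2 p5 q5
  refine ⟨by rw [z1]; exact p3, by rw [z2]; exact q3, h2, ?_, ?_⟩
  · rw [p3, q3, Complex.norm_real, Complex.norm_real, Real.norm_eq_abs, Real.norm_eq_abs,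
      abs_of_pos p1, abs_of_pos q1]
    exact h1
  · rw [p4, cm_mulVec_cv, hG, p3]
    ext a; simp [cv]

section Entries
attribute [local instance] Matrix.linftyOpNormedRing Matrix.linftyOpNormedAlgebra

lemma G1_apply_continuousOn [Nonempty S] (hA : ∀ i ∈ H, ∀ j ∈ H, ∀ a b : S, 0 ≤ A i j a b)
    (hstoch : ∀ a : S, ∑ b : S, total A a b = 1)
    (hirr : ChainIrreducible (transition A)) (a b : S) :
    ContinuousOn (fun z => G1 A z a b) (cannulus A) := by
  have hf : FiniteDimensional ℂ (Matrix S S ℂ) := inferInstance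
  exact (LinearMap.toContinuousLinearMap
    (Matrix.entryLinearMap ℂ ℂ a b : Matrix S S ℂ →ₗ[ℂ] ℂ)).continuous.comp_continuousOn
    (G1_continuousOn hA hstoch hirr)

end Entries

/-- The Perron value of `G` at the extreme point. -/
lemma IsBranchPair.greal_mulVec [Nonempty S]
    (hA : ∀ i ∈ H, ∀ j ∈ H, ∀ a b : S, 0 ≤ A i j a b)
    (hstoch : ∀ a : S, ∑ b : S, total A a b = 1)
    (hirr : ChainIrreducible (transition A)) (hlt : zLow A < zBar A)
    (h : IsBranchPair A w₀ v₀ π w v) : greal A (zBar A) *ᵥ v₀ = w₀ • v₀ := by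
  have hev := h.eventually_pos hA hstoch hirr hlt
  have hG : Filter.Tendsto (fun t : ℝ => G1 A ((zBar A - t ^ 2 : ℝ) : ℂ)) (𝓝[>] 0)
      (𝓝 (G1 A (zBar A))) := by
    refine tendsto_pi_nhds.mpr fun i => tendsto_pi_nhds.mpr fun j => ?_
    have hc := G1_apply_continuousOn hA hstoch hirr i j (zBar A : ℂ)
      (by simp [cannulus, abs_of_pos (zBar_pos A), hlt.le])
    refine Filter.Tendsto.comp (f := fun t : ℝ => ((zBar A - t ^ 2 : ℝ) : ℂ)) hc (tendsto_nhdsWithin_iff.mpr ⟨?_, ?_⟩)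
    · have : Filter.Tendsto (fun t : ℝ => ((zBar A - t ^ 2 : ℝ) : ℂ)) (𝓝 0)
          (𝓝 ((zBar A - 0 ^ 2 : ℝ) : ℂ)) := Continuous.tendsto (by fun_prop) 0
      simp only [ne_eq, OfNat.ofNat_ne_zero, not_false_eq_true, zero_pow, sub_zero] at this
      exact this.mono_left nhdsWithin_le_nhds
    · filter_upwards [hev] with t ht
      have h1 := ht.2.2.1
      have h2 := (zLow_pos A).trans h1
      simp only [cannulus, Set.mem_ofPred_eq, Complex.norm_real, Real.norm_eq_abs, abs_of_pos h2]
      exact ⟨h1.le, by nlinarith [sq_nonneg t]⟩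
  have hc0 : Filter.Tendsto (fun t : ℝ => (t : ℂ)) (𝓝[>] 0) (𝓝 0) :=
    tendsto_ofReal_zero.mono_left nhdsWithin_le_nhds
  have hv := h.an_v.continuousAt.tendsto.comp hc0
  have hw := h.an_w.continuousAt.tendsto.comp hc0
  rw [h.v_zero] at hv
  rw [h.w_zero] at hw
  have hl : Filter.Tendsto (fun t : ℝ => G1 A ((zBar A - t ^ 2 : ℝ) : ℂ) *ᵥ v t) (𝓝[>] 0)
      (𝓝 (G1 A (zBar A) *ᵥ cv v₀)) := by
    refine tendsto_pi_nhds.mpr fun a => tendsto_finsetSum _ fun b _ => Filter.Tendsto.mul ?_ ?_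
    · exact ((continuous_apply_apply a b).tendsto _).comp hG
    · exact ((continuous_apply b).tendsto _).comp hv
  have hrr : Filter.Tendsto (fun t : ℝ => w t • v t) (𝓝[>] 0) (𝓝 ((w₀ : ℂ) • cv v₀)) := hw.smul hv
  have e := tendsto_nhds_unique (hl.congr' ?_) hrr
  · rw [G1_ofReal hA hstoch hirr hlt.le le_rfl] at e
    refine cv_injective ?_
    rw [← cm_mulVec_cv]
    refine (show _ = _ from e).trans ?_
    ext a; simp [cv]
  · filter_upwards [hev] with t ht
    rw [← ht.2.2.2.2, G1_ofReal hA hstoch hirr ht.2.2.1.le (by nlinarith [sq_nonneg t])]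
    rfl

end RealBranch

/-! ### The linearization at the extreme point -/

section Extreme
variable {S : Type*} [Fintype S] [DecidableEq S] {A : ℤ → ℤ → Matrix S S ℝ}
variable {w₀ : ℝ} {v₀ π : S → ℝ} {w : ℂ → ℂ} {v : ℂ → S → ℂ}

/-- The nonnegative matrix `A_{*,0} + A_{*,1} G` at the upper extreme point. -/
def censored (A : ℤ → ℤ → Matrix S S ℝ) : Matrix S S ℝ :=
  astar A 0 (zBar A) + astar A 1 (zBar A) * greal A (zBar A)

/-- A positive column of a power of `G` supplies the Dobrushin minorization. This is the spectral
gap of `G₁(zBar)` below `w₀`. -/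
lemma IsBranchPair.contraction [Nonempty S]
    (hA : ∀ i ∈ H, ∀ j ∈ H, ∀ a b : S, 0 ≤ A i j a b)
    (hstoch : ∀ a : S, ∑ b : S, total A a b = 1)
    (hirr : ChainIrreducible (transition A)) (hlt : zLow A < zBar A)
    (h : IsBranchPair A w₀ v₀ π w v) :
    ∃ (n : ℕ) (c : ℝ), c < w₀ ^ n ∧ ∀ u : S → ℂ, u ⬝ᵥ cv v₀ = 0 →
      ∑ b, ‖(u ᵥ* cm (greal A (zBar A)) ^ n) b‖ * v₀ b ≤ c * ∑ a, ‖u a‖ * v₀ a := by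
  have hp := zBar_pos A
  have hG := greal_nonneg hA hstoch hirr hlt.le le_rfl
  have hGv := h.greal_mulVec hA hstoch hirr hlt
  obtain ⟨N, e, he⟩ := exists_pow_col_pos (astar_nonneg hA neg_one_mem_H hp)
    (astar_nonneg hA zero_mem_H hp) (astar_nonneg hA one_mem_H hp) hG
    (greal_quadratic hA hstoch hirr hlt.le le_rfl) (levelIrr_astar hA hirr hp) h.v₀_pos h.w₀_pos hGv
  obtain ⟨c, hc, hcon⟩ := dobrushin (pow_nonneg' hG N) h.v₀_pos (pow_mulVec_eq hGv N) he
  refine ⟨N, c, hc, fun u hu => ?_⟩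
  refine le_trans (le_of_eq ?_) (hcon u hu)
  refine Finset.sum_congr rfl fun b _ => ?_
  rw [← cm_pow]
  rfl

lemma IsBranchPair.left_eigenvector_eq_zero [Nonempty S]
    (hA : ∀ i ∈ H, ∀ j ∈ H, ∀ a b : S, 0 ≤ A i j a b)
    (hstoch : ∀ a : S, ∑ b : S, total A a b = 1)
    (hirr : ChainIrreducible (transition A)) (hlt : zLow A < zBar A)
    (h : IsBranchPair A w₀ v₀ π w v) {u : S → ℂ}
    (hu : u ᵥ* cm (greal A (zBar A)) = (w₀ : ℂ) • u) (huv : u ⬝ᵥ cv v₀ = 0) : u = 0 := by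
  obtain ⟨n, c, hc, hcon⟩ := h.contraction hA hstoch hirr hlt
  have hn : u ᵥ* cm (greal A (zBar A)) ^ n = (w₀ : ℂ) ^ n • u := by
    clear hcon hc
    induction n with
    | zero => simp
    | succ n ih =>
      rw [pow_succ, ← Matrix.vecMul_vecMul, ih, Matrix.smul_vecMul, hu, smul_smul, pow_succ]
  have h1 := hcon u huv
  rw [hn] at h1
  have h2 : ∑ b, ‖((w₀ : ℂ) ^ n • u) b‖ * v₀ b = w₀ ^ n * ∑ a, ‖u a‖ * v₀ a := by
    rw [Finset.mul_sum]
    refine Finset.sum_congr rfl fun b _ => ?_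
    rw [Pi.smul_apply, smul_eq_mul, norm_mul, norm_pow, Complex.norm_real, Real.norm_eq_abs,
      abs_of_pos h.w₀_pos, mul_assoc]
  rw [h2] at h1
  have h0 : 0 ≤ ∑ a, ‖u a‖ * v₀ a :=
    Finset.sum_nonneg fun a _ => mul_nonneg (norm_nonneg _) (h.v₀_pos a).le
  have h3 : ∑ a, ‖u a‖ * v₀ a = 0 := by nlinarith
  ext a
  have := (Finset.sum_eq_zero_iff_of_nonneg fun a _ =>
    mul_nonneg (norm_nonneg (u a)) (h.v₀_pos a).le).mp h3 a (Finset.mem_univ a)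
  simpa [(h.v₀_pos a).ne'] using this

/-- By the factorization, `π (1 - U - w₀ A_{*,1})` is a left eigenvector of `G` for `w₀`, and its
product with `v₀` is minus the vertical drift, hence zero. Simplicity of the Perron value makes it
vanish. -/
lemma IsBranchPair.left_censored [Nonempty S]
    (hA : ∀ i ∈ H, ∀ j ∈ H, ∀ a b : S, 0 ≤ A i j a b)
    (hstoch : ∀ a : S, ∑ b : S, total A a b = 1)
    (hirr : ChainIrreducible (transition A)) (hlt : zLow A < zBar A)
    (h : IsBranchPair A w₀ v₀ π w v) :
    π ᵥ* (censored A + w₀ • astar A 1 (zBar A)) = π := by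
  have hq := greal_quadratic hA hstoch hirr hlt.le le_rfl
  have hGv := h.greal_mulVec hA hstoch hirr hlt
  have hw := h.w₀_pos.ne'
  have f := factor_identity hq hw
  rw [← creal_eq] at f
  set T := 1 - (astar A 0 (zBar A) + astar A 1 (zBar A) * greal A (zBar A))
    - w₀ • astar A 1 (zBar A) with hT
  have hτ1 : (π ᵥ* T) ᵥ* greal A (zBar A) = w₀ • (π ᵥ* T) := by
    have := congrArg (fun M => π ᵥ* M) f
    simp only [← Matrix.vecMul_vecMul] at this
    rw [Matrix.vecMul_smul, Matrix.vecMul_sub 1 (creal A _ _) π, h.left, Matrix.vecMul_one,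
      sub_self, smul_zero, Matrix.vecMul_sub, Matrix.vecMul_smul, Matrix.vecMul_one] at this
    exact (sub_eq_zero.mp this).symm
  have hτ2 : (π ᵥ* T) ⬝ᵥ v₀ = 0 := by
    have e1 : T *ᵥ v₀ = -(cderiv A (zBar A) w₀ *ᵥ v₀) := by
      have hr := h.right
      rw [creal_eq] at hr
      simp only [Matrix.add_mulVec, Matrix.smul_mulVec] at hr
      simp only [hT, cderiv, Matrix.sub_mulVec, Matrix.add_mulVec, Matrix.smul_mulVec,
        Matrix.one_mulVec, ← Matrix.mulVec_mulVec, hGv, Matrix.mulVec_smul]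
      nth_rw 1 [← hr]
      module
    rw [← Matrix.dotProduct_mulVec, e1, dotProduct_neg, ← drift₂_eq, h.drift, neg_zero]
  have hz : cv (π ᵥ* T) = 0 := by
    refine h.left_eigenvector_eq_zero hA hstoch hirr hlt ?_ ?_
    · rw [cv_vecMul_cm, hτ1]
      ext a; simp [cv]
    · rw [cv_dotProduct_cv, hτ2, Complex.ofReal_zero]
  have hz' : π ᵥ* T = 0 := cv_injective (hz.trans (by ext; simp [cv]))
  rw [hT, sub_sub, Matrix.vecMul_sub, Matrix.vecMul_one, sub_eq_zero] at hz'
  exact hz'.symm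

lemma IsBranchPair.eq_zero_of_le_censored [Nonempty S]
    (hA : ∀ i ∈ H, ∀ j ∈ H, ∀ a b : S, 0 ≤ A i j a b)
    (hstoch : ∀ a : S, ∑ b : S, total A a b = 1)
    (hirr : ChainIrreducible (transition A)) (hlt : zLow A < zBar A)
    (h : IsBranchPair A w₀ v₀ π w v) (y : S → ℝ) (hy : 0 ≤ y) (hle : y ≤ censored A *ᵥ y) :
    y = 0 := by
  have hp := zBar_pos A
  exact censored_transient (astar_nonneg hA neg_one_mem_H hp)
    (astar_nonneg hA zero_mem_H hp) (astar_nonneg hA one_mem_H hp)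
    (greal_nonneg hA hstoch hirr hlt.le le_rfl)
    (greal_quadratic hA hstoch hirr hlt.le le_rfl) (levelIrr_astar hA hirr hp) h.v₀_pos h.w₀_pos
    (h.greal_mulVec hA hstoch hirr hlt).le (by rw [← creal_eq, h.right]) hy hle

lemma censored_nonneg [Nonempty S]
    (hA : ∀ i ∈ H, ∀ j ∈ H, ∀ a b : S, 0 ≤ A i j a b)
    (hstoch : ∀ a : S, ∑ b : S, total A a b = 1)
    (hirr : ChainIrreducible (transition A)) (hlt : zLow A < zBar A) (a b : S) :
    0 ≤ censored A a b := by
  have hp := zBar_pos A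
  rw [censored, Matrix.add_apply, Matrix.mul_apply]
  exact add_nonneg (astar_nonneg hA zero_mem_H hp a b) (Finset.sum_nonneg fun c _ =>
    mul_nonneg (astar_nonneg hA one_mem_H hp a c) (greal_nonneg hA hstoch hirr hlt.le le_rfl c b))

lemma norm_cm_apply {M : Matrix S S ℝ} (hM : ∀ a b, 0 ≤ M a b) (a b : S) :
    ‖cm M a b‖ = M a b := by
  rw [cm, Matrix.map_apply, Complex.norm_real, Real.norm_eq_abs, abs_of_nonneg (hM a b)]

/-- The kernel of the linearized quadratic equation at the extreme point. -/
lemma IsBranchPair.linearized_eq_zero [Nonempty S]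
    (hA : ∀ i ∈ H, ∀ j ∈ H, ∀ a b : S, 0 ≤ A i j a b)
    (hstoch : ∀ a : S, ∑ b : S, total A a b = 1)
    (hirr : ChainIrreducible (transition A)) (hlt : zLow A < zBar A)
    (h : IsBranchPair A w₀ v₀ π w v) {X : Matrix S S ℂ}
    (hX : X = cm (censored A) * X + cm (astar A 1 (zBar A)) * X * cm (greal A (zBar A)))
    (hXv : X *ᵥ cv v₀ = 0) : X = 0 := by
  obtain ⟨n, c, hc, hcon⟩ := h.contraction hA hstoch hirr hlt
  refine QBD.linearized_eq_zero
    (fun a b => (norm_cm_apply (censored_nonneg hA hstoch hirr hlt) a b).le)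
    (fun a b => (norm_cm_apply (astar_nonneg hA one_mem_H (zBar_pos A)) a b).le)
    (fun a b => (norm_cm_apply (greal_nonneg hA hstoch hirr hlt.le le_rfl) a b).le)
    h.v₀_pos h.π_pos h.w₀_pos (h.greal_mulVec hA hstoch hirr hlt)
    (h.left_censored hA hstoch hirr hlt)
    (h.eq_zero_of_le_censored hA hstoch hirr hlt) hX hc fun a => ?_
  -- The rows of `X` are orthogonal to `v₀`, which is what the contraction requires.
  have := hcon (X a) (congrFun hXv a)
  refine le_trans (le_of_eq ?_) this
  refine Finset.sum_congr rfl fun b _ => ?_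
  rfl

/-- Resolvent bound: `cm T x = (1 + κ) x` with `π T = π` and `κ > 0` forces `x = 0`. -/
lemma eq_zero_of_left_fixed {T : Matrix S S ℝ} (hT : ∀ a b, 0 ≤ T a b) {π : S → ℝ}
    (hπ : ∀ a, 0 < π a) (hl : π ᵥ* T = π) {κ : ℝ} (hκ : 1 < κ) {x : S → ℂ}
    (hx : cm T *ᵥ x = (κ : ℂ) • x) : x = 0 := by
  have h1 : κ * ∑ a, π a * ‖x a‖ ≤ ∑ a, π a * ‖x a‖ := by
    calc κ * ∑ a, π a * ‖x a‖ = ∑ a, π a * ‖(cm T *ᵥ x) a‖ := by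
          rw [Finset.mul_sum]
          refine Finset.sum_congr rfl fun a _ => ?_
          rw [hx, Pi.smul_apply, smul_eq_mul, norm_mul, Complex.norm_real, Real.norm_eq_abs,
            abs_of_pos (by linarith : (0 : ℝ) < κ)]
          ring
      _ ≤ ∑ a, π a * ∑ b, T a b * ‖x b‖ := by
          refine Finset.sum_le_sum fun a _ => mul_le_mul_of_nonneg_left ?_ (hπ a).le
          refine (norm_sum_le _ _).trans (le_of_eq (Finset.sum_congr rfl fun b _ => ?_))
          rw [norm_mul, norm_cm_apply hT]
      _ = ∑ b, (π ᵥ* T) b * ‖x b‖ := by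
          simp only [Matrix.vecMul, dotProduct, Finset.sum_mul, Finset.mul_sum]
          rw [Finset.sum_comm]
          exact Finset.sum_congr rfl fun a _ => Finset.sum_congr rfl fun b _ => by ring
      _ = ∑ a, π a * ‖x a‖ := by rw [hl]
  have h0 : 0 ≤ ∑ a, π a * ‖x a‖ :=
    Finset.sum_nonneg fun a _ => mul_nonneg (hπ a).le (norm_nonneg _)
  have h3 : ∑ a, π a * ‖x a‖ = 0 := by nlinarith
  ext a
  have := (Finset.sum_eq_zero_iff_of_nonneg fun a _ =>
    mul_nonneg (hπ a).le (norm_nonneg (x a))).mp h3 a (Finset.mem_univ a)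
  simpa [(hπ a).ne'] using this

/-- A homogeneous linear system depending continuously on a parameter. -/
lemma exists_bound_of_injective {T : Type*} [Fintype T] {M : ℂ → Matrix T S ℂ} {l : ℂ → S → ℂ}
    (hM : ∀ a b, ContinuousAt (fun ζ => M ζ a b) 0) (hl : ContinuousAt l 0)
    (h : ∀ x, M 0 *ᵥ x = 0 → l 0 ⬝ᵥ x = 0 → x = 0) :
    ∃ C : ℝ, ∀ᶠ ζ in 𝓝 (0 : ℂ), ∀ x, M ζ *ᵥ x = 0 → ‖x‖ ≤ C * ‖l ζ ⬝ᵥ x‖ := by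
  set φ : ℂ → (S → ℂ) → ℝ := fun ζ x => ‖M ζ *ᵥ x‖ + ‖l ζ ⬝ᵥ x‖ with hφ
  have hx : ∀ (x : S → ℂ) (b : S), ContinuousAt (fun q : ℂ × (S → ℂ) => q.2 b) (0, x) :=
    fun x b => by fun_prop
  have hφc : ∀ x, ContinuousAt (fun q : ℂ × (S → ℂ) => φ q.1 q.2) (0, x) := by
    intro x
    refine ContinuousAt.add (ContinuousAt.norm ?_) (ContinuousAt.norm ?_)
    · refine continuousAt_pi.mpr fun a => tendsto_finsetSum _ fun b _ => Filter.Tendsto.mul ?_ (hx x b)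
      exact ContinuousAt.comp (f := Prod.fst) (g := fun ζ => M ζ a b) (x := ((0 : ℂ), x))
        (hM a b) continuousAt_fst
    · refine tendsto_finsetSum _ fun b _ => Filter.Tendsto.mul ?_ (hx x b)
      exact ContinuousAt.comp (f := Prod.fst) (g := fun ζ => l ζ b) (x := ((0 : ℂ), x))
        (continuousAt_pi.mp hl b) continuousAt_fst
  have hpos : ∀ x, x ≠ 0 → 0 < φ 0 x := by
    intro x hx0
    by_contra hcon
    have h1 : ‖M 0 *ᵥ x‖ = 0 := le_antisymm (by
      have := norm_nonneg (l 0 ⬝ᵥ x)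
      simp only [hφ] at hcon; linarith) (norm_nonneg _)
    have h2 : ‖l 0 ⬝ᵥ x‖ = 0 := le_antisymm (by
      have := norm_nonneg (M 0 *ᵥ x)
      simp only [hφ] at hcon; linarith) (norm_nonneg _)
    exact hx0 (h x (norm_eq_zero.mp h1) (norm_eq_zero.mp h2))
  have hK : IsCompact (Metric.sphere (0 : S → ℂ) 1) := isCompact_sphere _ _
  have hm : ∃ m > 0, ∀ x ∈ Metric.sphere (0 : S → ℂ) 1, m < φ 0 x := by
    rcases (Metric.sphere (0 : S → ℂ) 1).eq_empty_or_nonempty with he | hne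
    · exact ⟨1, one_pos, by simp [he]⟩
    · obtain ⟨x₀, hx₀, hmin⟩ := hK.exists_isMinOn hne (f := φ 0) (fun x _ =>
        (ContinuousAt.comp (f := fun x : S → ℂ => ((0 : ℂ), x))
          (g := fun q : ℂ × (S → ℂ) => φ q.1 q.2) (x := x)
          (hφc x) (by fun_prop)).continuousWithinAt)
      have h0 : x₀ ≠ 0 := by
        rintro rfl
        simp at hx₀
      refine ⟨φ 0 x₀ / 2, half_pos (hpos x₀ h0), fun x hx => ?_⟩
      exact (half_lt_self (hpos x₀ h0)).trans_le (hmin hx)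
  obtain ⟨m, hm0, hm⟩ := hm
  -- Compactness of the sphere transfers the positive lower bound at `ζ = 0` uniformly to nearby
  -- `ζ`.
  have hev : ∀ᶠ ζ in 𝓝 (0 : ℂ), ∀ x ∈ Metric.sphere (0 : S → ℂ) 1, m < φ ζ x :=
    hK.eventually_forall_of_forall_eventually fun x hx =>
      (hφc x).eventually (lt_mem_nhds (hm x hx))
  refine ⟨m⁻¹, ?_⟩
  filter_upwards [hev] with ζ hζ x hMx
  by_cases hx0 : x = 0
  · simp [hx0]
  have hn : 0 < ‖x‖ := norm_pos_iff.mpr hx0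
  have h1 := hζ ((‖x‖⁻¹ : ℂ) • x) (by
    simp [norm_smul, hn.ne'])
  simp only [hφ, Matrix.mulVec_smul, hMx, smul_zero, norm_zero, zero_add, dotProduct_smul,
    smul_eq_mul, norm_mul, norm_inv, Complex.norm_real, norm_norm] at h1
  rw [inv_mul_eq_div, lt_div_iff₀ hn] at h1
  rw [inv_mul_eq_div, le_div_iff₀ hm0]
  linarith

end Extreme

/-! ### The analytic solution branch of the quadratic equation -/

section Solutions
open scoped ContDiff
attribute [local instance] Matrix.normedAddCommGroup Matrix.normedSpace
variable {S : Type*} [Fintype S] [DecidableEq S] {A : ℤ → ℤ → Matrix S S ℝ}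
variable {w₀ : ℝ} {v₀ π : S → ℝ} {w : ℂ → ℂ} {v : ℂ → S → ℂ}

/-- The polynomial matrix `z A_{*,j}(z)`. -/
def polyA (A : ℤ → ℤ → Matrix S S ℝ) (j : ℤ) (z : ℂ) : Matrix S S ℂ :=
  cm (A (-1) j) + z • cm (A 0 j) + z ^ 2 • cm (A 1 j)

/-- The quadratic equation multiplied by `z`, in polynomial form. -/
def quad (A : ℤ → ℤ → Matrix S S ℝ) (z : ℂ) (X : Matrix S S ℂ) : Matrix S S ℂ :=
  polyA A (-1) z + polyA A 0 z * X + polyA A 1 z * (X * X) - z • X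

lemma quad_eq {z : ℂ} (hz : z ≠ 0) (X : Matrix S S ℂ) :
    quad A z X = z • (Astar A (-1) z + Astar A 0 z * X + Astar A 1 z * X ^ 2 - X) := by
  simp only [quad, polyA, ← smul_Astar hz, Matrix.smul_mul, pow_two X]
  module

lemma quad_eq_zero_iff {z : ℂ} (hz : z ≠ 0) {X : Matrix S S ℂ} :
    quad A z X = 0 ↔ SolvesQuadratic A z X := by
  rw [quad_eq hz, smul_eq_zero, or_iff_right hz, sub_eq_zero, SolvesQuadratic]

lemma quad_add_smul {z : ℂ} (hz : z ≠ 0) (X d : Matrix S S ℂ) (t : ℂ) :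
    quad A z (X + t • d) = quad A z X
      + t • (z • ((Astar A 0 z + Astar A 1 z * X) * d + Astar A 1 z * d * X - d))
      + t ^ 2 • (z • (Astar A 1 z * (d * d))) := by
  simp only [quad_eq hz, pow_two, mul_add, add_mul, Matrix.mul_smul, Matrix.smul_mul,
    Matrix.mul_assoc]
  module

lemma contDiffAt_matrix_mul {E : Type*} [NormedAddCommGroup E] [NormedSpace ℂ E]
    {f g : E → Matrix S S ℂ} {x : E} (hf : ContDiffAt ℂ ω f x) (hg : ContDiffAt ℂ ω g x) :
    ContDiffAt ℂ ω (fun y => f y * g y) x := by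
  refine contDiffAt_pi.mpr fun a => contDiffAt_pi.mpr fun b => ?_
  refine ContDiffAt.sum fun c _ => ContDiffAt.mul ?_ ?_
  · exact contDiffAt_pi.mp (contDiffAt_pi.mp hf a) c
  · exact contDiffAt_pi.mp (contDiffAt_pi.mp hg c) b

lemma contDiffAt_quad {E : Type*} [NormedAddCommGroup E] [NormedSpace ℂ E] {k : E → ℂ}
    {f : E → Matrix S S ℂ} {x : E} (hk : ContDiffAt ℂ ω k x) (hf : ContDiffAt ℂ ω f x) :
    ContDiffAt ℂ ω (fun y => quad A (k y) (f y)) x := by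
  have hp : ∀ j, ContDiffAt ℂ ω (fun y => polyA A j (k y)) x := fun j =>
    (contDiffAt_const.add (hk.smul contDiffAt_const)).add ((hk.pow 2).smul contDiffAt_const)
  exact (((hp (-1)).add (contDiffAt_matrix_mul (hp 0) hf)).add
    (contDiffAt_matrix_mul (hp 1) (contDiffAt_matrix_mul hf hf))).sub (hk.smul hf)

lemma hasDerivAt_quadratic {E : Type*} [NormedAddCommGroup E] [NormedSpace ℂ E] (a b c : E) :
    HasDerivAt (fun t : ℂ => a + t • b + t ^ 2 • c) b 0 := by
  have := (((hasDerivAt_id (0 : ℂ)).smul_const b).const_add a).add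
    (((hasDerivAt_id (0 : ℂ)).pow 2).smul_const c)
  refine this.congr_deriv ?_
  simp

/-- Continuation of a solution of the quadratic equation at a regular point. -/
lemma exists_regular_branch {z₁ : ℂ} (hz : z₁ ≠ 0) {X₁ : Matrix S S ℂ}
    (hX : SolvesQuadratic A z₁ X₁)
    (hinj : ∀ d : Matrix S S ℂ, d = (Astar A 0 z₁ + Astar A 1 z₁ * X₁) * d + Astar A 1 z₁ * d * X₁ →
      d = 0) :
    ∃ g : ℂ → Matrix S S ℂ, (∀ a b, AnalyticAt ℂ (fun z => g z a b) z₁) ∧ g z₁ = X₁ ∧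
      (∀ᶠ z in 𝓝 z₁, SolvesQuadratic A z (g z)) ∧
      ∀ᶠ q in 𝓝 (z₁, X₁), SolvesQuadratic A q.1 q.2 → g q.1 = q.2 := by
  obtain ⟨g, hg, hg1, hgz, hgu⟩ := exists_analytic_implicit (E := Matrix S S ℂ)
    (F := Matrix S S ℂ) rfl (f := fun q => quad A q.1 q.2) (z₀ := z₁) (e₀ := X₁)
    (contDiffAt_quad contDiffAt_fst contDiffAt_snd) ((quad_eq_zero_iff hz).mpr hX)
    (D := fun d => z₁ • ((Astar A 0 z₁ + Astar A 1 z₁ * X₁) * d + Astar A 1 z₁ * d * X₁ - d))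
    (by
      intro d
      simp only [quad_add_smul hz]
      exact hasDerivAt_quadratic _ _ _)
    (by
      intro d hd
      exact hinj d (sub_eq_zero.mp ((smul_eq_zero.mp hd).resolve_left hz)).symm)
  have hne : ∀ᶠ z in 𝓝 z₁, z ≠ 0 := isOpen_ne.mem_nhds hz
  refine ⟨g, fun a b => ?_, hg1, ?_, ?_⟩
  · exact analyticAt_pi_iff.mp (analyticAt_pi_iff.mp hg a) b
  · filter_upwards [hgz, hne] with z h1 h2
    exact (quad_eq_zero_iff h2).mp h1
  · have hne' : ∀ᶠ q : ℂ × Matrix S S ℂ in 𝓝 (z₁, X₁), q.1 ≠ 0 :=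
      (continuous_fst.tendsto (z₁, X₁)).eventually hne
    filter_upwards [hgu, hne'] with q h1 h2 h3
    exact h1 ((quad_eq_zero_iff h2).mpr h3)

/-- The quadratic form minus `L(z, l)` has the right factor `X - l`; on a kernel vector of `L` only
this product survives. -/
lemma quad_mulVec {z l : ℂ} {X : Matrix S S ℂ} {x : S → ℂ} (hz : z ≠ 0)
    (hx : Lmat A z l *ᵥ x = 0) : quad A z X *ᵥ x
      = (z • (Astar A 0 z - 1 + Astar A 1 z * (X + l • 1))) *ᵥ (X *ᵥ x - l • x) := by
  have e : quad A z X = Lmat A z l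
      + (z • (Astar A 0 z - 1 + Astar A 1 z * (X + l • 1))) * (X - l • 1) := by
    rw [quad_eq hz, Lmat]
    simp only [pow_two, mul_add, mul_sub, add_mul, sub_mul, Matrix.mul_smul, Matrix.smul_mul,
      Matrix.mul_one, Matrix.one_mul, Matrix.mul_assoc, smul_add, smul_sub, smul_smul]
    module
  have e2 : (X - l • 1) *ᵥ x = X *ᵥ x - l • x := by
    rw [Matrix.sub_mulVec, Matrix.smul_mulVec, Matrix.one_mulVec]
  rw [e, Matrix.add_mulVec, hx, zero_add, ← Matrix.mulVec_mulVec, e2]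

/-- The solution branch `F` in the uniformizing variable. -/
structure IsSolutionBranch (A : ℤ → ℤ → Matrix S S ℝ) (w : ℂ → ℂ) (v : ℂ → S → ℂ)
    (F : ℂ → Matrix S S ℂ) : Prop where
  analytic : ∀ a b, AnalyticAt ℂ (fun ζ => F ζ a b) 0
  zero : F 0 = cm (greal A (zBar A))
  solves : ∀ᶠ ζ in 𝓝 (0 : ℂ), SolvesQuadratic A (zBar A - ζ ^ 2) (F ζ)
  mulVec : ∀ᶠ ζ in 𝓝 (0 : ℂ), F ζ *ᵥ v ζ = w ζ • v ζ
  unique : ∀ᶠ q in 𝓝 ((0 : ℂ), cm (greal A (zBar A))), SolvesQuadratic A (zBar A - q.1 ^ 2) q.2 →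
    q.2 *ᵥ v q.1 = w q.1 • v q.1 → F q.1 = q.2

lemma eventually_ne_zero (A : ℤ → ℤ → Matrix S S ℝ) :
    ∀ᶠ ζ : ℂ in 𝓝 0, (zBar A : ℂ) - ζ ^ 2 ≠ 0 := by
  refine ContinuousAt.eventually_ne (by fun_prop) ?_
  simpa using (zBar_pos A).ne'

lemma mul_vecMulVec' (M : Matrix S S ℂ) (x y : S → ℂ) :
    M * Matrix.vecMulVec x y = Matrix.vecMulVec (M *ᵥ x) y := by
  ext a b
  simp [Matrix.mul_apply, Matrix.vecMulVec, Matrix.mulVec, dotProduct, Finset.sum_mul, mul_assoc]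

lemma vecMulVec_mulVec' (x y z : S → ℂ) :
    Matrix.vecMulVec x y *ᵥ z = (y ⬝ᵥ z) • x := by
  ext a
  simp only [Matrix.mulVec, dotProduct, Matrix.vecMulVec_apply, Pi.smul_apply, smul_eq_mul,
    Finset.sum_mul]
  exact Finset.sum_congr rfl fun b _ => by ring

/-- The matrix is `zBar (T - 1)` with `π T = π`, so the equation would make `1 + π ⬝ᵥ v₀ / zBar > 1`
an eigenvalue of `T`. -/
lemma IsBranchPair.corrected_injective [Nonempty S]
    (hA : ∀ i ∈ H, ∀ j ∈ H, ∀ a b : S, 0 ≤ A i j a b)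
    (hstoch : ∀ a : S, ∑ b : S, total A a b = 1)
    (hirr : ChainIrreducible (transition A)) (hlt : zLow A < zBar A)
    (h : IsBranchPair A w₀ v₀ π w v) {x : S → ℂ}
    (hx : ((zBar A : ℂ) • (cm (astar A 0 (zBar A)) - 1 + cm (astar A 1 (zBar A))
      * (cm (greal A (zBar A)) + (w₀ : ℂ) • 1))) *ᵥ x = (π ⬝ᵥ v₀ : ℝ) • x) : x = 0 := by
  have hp := zBar_pos A
  have hpv : 0 < π ⬝ᵥ v₀ := Finset.sum_pos (fun a _ => mul_pos (h.π_pos a) (h.v₀_pos a))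
    Finset.univ_nonempty
  refine eq_zero_of_left_fixed (T := censored A + w₀ • astar A 1 (zBar A)) (fun a b => ?_) h.π_pos
    (h.left_censored hA hstoch hirr hlt) (κ := 1 + (π ⬝ᵥ v₀) / zBar A) (by
      have := div_pos hpv hp
      linarith) ?_
  · exact add_nonneg (censored_nonneg hA hstoch hirr hlt a b)
      (mul_nonneg h.w₀_pos.le (astar_nonneg hA one_mem_H hp a b))
  · have e : (zBar A : ℂ) • (cm (astar A 0 (zBar A)) - 1 + cm (astar A 1 (zBar A))
      * (cm (greal A (zBar A)) + (w₀ : ℂ) • 1))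
      = (zBar A : ℂ) • (cm (censored A + w₀ • astar A 1 (zBar A)) - 1) := by
      rw [censored, cm_add, cm_add, cm_smul, cm_mul]
      simp only [mul_add, Matrix.mul_smul, Matrix.mul_one]
      module
    have hp' : (zBar A : ℂ) ≠ 0 := by exact_mod_cast hp.ne'
    rw [e, Matrix.smul_mulVec, Matrix.sub_mulVec, Matrix.one_mulVec] at hx
    have e2 := congrArg (fun y => (zBar A : ℂ)⁻¹ • y) hx
    simp only [smul_smul, inv_mul_cancel₀ hp', one_smul] at e2
    rw [sub_eq_iff_eq_add] at e2
    rw [e2]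
    ext a
    simp only [Pi.add_apply, Pi.smul_apply, smul_eq_mul, Complex.real_smul]
    push_cast
    field_simp
    ring

/-- Equation (1) alone has two branches meeting at `ζ = 0`, so the implicit function theorem cannot
apply to it. Adding `(X - w) v ⊗ b` changes nothing for matrices with the prescribed eigenpair and
makes the linearization injective. -/
lemma exists_solutionBranch [Nonempty S]
    (hA : ∀ i ∈ H, ∀ j ∈ H, ∀ a b : S, 0 ≤ A i j a b)
    (hstoch : ∀ a : S, ∑ b : S, total A a b = 1)
    (hirr : ChainIrreducible (transition A)) (hlt : zLow A < zBar A)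
    (h : IsBranchPair A w₀ v₀ π w v) : ∃ F, IsSolutionBranch A w v F := by
  set p : ℂ := ((zBar A : ℝ) : ℂ) with hpdef
  set G₀ := cm (greal A (zBar A)) with hG₀
  have hp : p ≠ 0 := by rw [hpdef]; exact_mod_cast (zBar_pos A).ne'
  have hA0 : Astar A 0 p = cm (astar A 0 (zBar A)) := Astar_ofReal' A 0 _
  have hA1 : Astar A 1 p = cm (astar A 1 (zBar A)) := Astar_ofReal' A 1 _
  have hcens : Astar A 0 p + Astar A 1 p * G₀ = cm (censored A) := by
    rw [hA0, hA1, hG₀, censored, cm_add, cm_mul]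
  have hq0 : quad A p G₀ = 0 := by
    rw [quad_eq_zero_iff hp, hG₀]
    have := G1_quadratic hA hstoch hirr (z := (zBar A : ℂ))
      (by simp [abs_of_pos (zBar_pos A), hlt.le]) (by simp [abs_of_pos (zBar_pos A)])
    rw [G1_ofReal hA hstoch hirr hlt.le le_rfl] at this
    exact this
  have hGv : G₀ *ᵥ cv v₀ = (w₀ : ℂ) • cv v₀ := by
    rw [hG₀, cm_mulVec_cv, h.greal_mulVec hA hstoch hirr hlt]
    ext a; simp [cv]
  -- The sign puts the eigenvalue in `corrected_injective` above one.
  set b : S → ℂ := -cv π with hb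
  set V : ℂ → Matrix S S ℂ := fun ζ => Matrix.vecMulVec (v ζ) b with hV
  have hVan : ContDiffAt ℂ ω V 0 := by
    refine contDiffAt_pi.mpr fun i => contDiffAt_pi.mpr fun j => ?_
    exact (contDiffAt_pi.mp h.an_v.contDiffAt i).mul contDiffAt_const
  have hcor : ∀ (X : Matrix S S ℂ) ζ, (X - w ζ • 1) * V ζ
      = Matrix.vecMulVec (X *ᵥ v ζ - w ζ • v ζ) b := by
    intro X ζ
    rw [hV, mul_vecMulVec', Matrix.sub_mulVec, Matrix.smul_mulVec, Matrix.one_mulVec]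
  have hbv : b ⬝ᵥ v 0 = -((π ⬝ᵥ v₀ : ℝ) : ℂ) := by
    rw [hb, h.v_zero, neg_dotProduct, cv_dotProduct_cv]
  obtain ⟨F, hF, hF0, hFz, hFu⟩ := exists_analytic_implicit (E := Matrix S S ℂ)
    (F := Matrix S S ℂ) rfl (f := fun q => quad A (p - q.1 ^ 2) q.2 + (q.2 - w q.1 • 1) * V q.1)
    (z₀ := 0) (e₀ := G₀)
    (by
      refine ContDiffAt.add (contDiffAt_quad (by fun_prop) contDiffAt_snd)
        (contDiffAt_matrix_mul (contDiffAt_snd.sub ?_) ?_)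
      · have hw1 : ContDiffAt ℂ ω (fun q : ℂ × Matrix S S ℂ => w q.1) (0, G₀) :=
          ContDiffAt.comp (f := Prod.fst) (g := w) ((0 : ℂ), G₀) h.an_w.contDiffAt contDiffAt_fst
        exact hw1.smul contDiffAt_const
      · exact ContDiffAt.comp (f := Prod.fst) (g := V) ((0 : ℂ), G₀) hVan contDiffAt_fst)
    (by
      change quad A (p - 0 ^ 2) G₀ + (G₀ - w 0 • 1) * V 0 = 0
      rw [hcor, h.w_zero, h.v_zero, hGv, sub_self, zero_pow two_ne_zero, sub_zero, hq0, zero_add]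
      ext; simp [Matrix.vecMulVec])
    (D := fun d => p • ((Astar A 0 p + Astar A 1 p * G₀) * d + Astar A 1 p * d * G₀ - d) + d * V 0)
    (by
      intro d
      simp only [ne_eq, OfNat.ofNat_ne_zero, not_false_eq_true, zero_pow, sub_zero,
        quad_add_smul hp]
      have e : ∀ t : ℂ, quad A p G₀ + t • (p • ((Astar A 0 p + Astar A 1 p * G₀) * d
            + Astar A 1 p * d * G₀ - d)) + t ^ 2 • (p • (Astar A 1 p * (d * d)))
            + (G₀ + t • d - w 0 • 1) * V 0
          = (quad A p G₀ + (G₀ - w 0 • 1) * V 0) + t • (p • ((Astar A 0 p + Astar A 1 p * G₀) * d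
            + Astar A 1 p * d * G₀ - d) + d * V 0) + t ^ 2 • (p • (Astar A 1 p * (d * d))) := by
        intro t
        rw [show G₀ + t • d - w 0 • 1 = (G₀ - w 0 • 1) + t • d by abel,
          add_mul (G₀ - w 0 • 1), Matrix.smul_mul t d]
        module
      simp only [e]
      exact hasDerivAt_quadratic _ _ _)
    (by
      intro d hd
      -- Applied to `v₀`, the corrected linearization reduces to a vector equation for `d v₀`. Once
      -- `d v₀ = 0` the correction drops out and the kernel statement for the uncorrected equation
      -- applies.
      have hdv : d *ᵥ cv v₀ = 0 := by
        refine h.corrected_injective hA hstoch hirr hlt ?_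
        have h1 := congrArg (fun M => M *ᵥ v 0) hd
        simp only [hV, mul_vecMulVec', Matrix.add_mulVec, Matrix.zero_mulVec, vecMulVec_mulVec',
          hbv] at h1
        rw [h.v_zero] at h1
        have h2 : (p • ((Astar A 0 p + Astar A 1 p * G₀) * d + Astar A 1 p * d * G₀ - d)) *ᵥ cv v₀
            = (p • (Astar A 0 p - 1 + Astar A 1 p * (G₀ + (w₀ : ℂ) • 1))) *ᵥ (d *ᵥ cv v₀) := by
          have h3 : (Astar A 1 p * d * G₀) *ᵥ cv v₀ = (w₀ : ℂ) • (Astar A 1 p *ᵥ (d *ᵥ cv v₀)) := by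
            rw [← Matrix.mulVec_mulVec, hGv, Matrix.mulVec_smul, Matrix.mulVec_mulVec]
          rw [Matrix.smul_mulVec, Matrix.smul_mulVec, Matrix.sub_mulVec, Matrix.add_mulVec, h3]
          simp only [mul_add, add_mul, Matrix.add_mulVec, Matrix.sub_mulVec, Matrix.mul_smul,
            Matrix.mul_one, Matrix.smul_mulVec, Matrix.one_mulVec, ← Matrix.mulVec_mulVec]
          module
        rw [h2, hA0, hA1] at h1
        rw [← hG₀]
        refine (eq_neg_of_add_eq_zero_left h1).trans ?_
        ext a
        simp
      have hz : d * V 0 = 0 := by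
        rw [hV, mul_vecMulVec', h.v_zero, hdv]
        ext; simp [Matrix.vecMulVec]
      rw [hz, add_zero, smul_eq_zero, or_iff_right hp, hcens, hA1] at hd
      exact h.linearized_eq_zero hA hstoch hirr hlt (sub_eq_zero.mp hd).symm hdv)
  have hent : ∀ a c, AnalyticAt ℂ (fun ζ => F ζ a c) 0 := fun a c =>
    analyticAt_pi_iff.mp (analyticAt_pi_iff.mp hF a) c
  have hne := eventually_ne_zero A
  set K : ℂ → Matrix S S ℂ := fun ζ => polyA A 0 (p - ζ ^ 2) - (p - ζ ^ 2) • 1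
    + polyA A 1 (p - ζ ^ 2) * (F ζ + w ζ • 1) + (b ⬝ᵥ v ζ) • 1 with hK
  have hKc : ContDiffAt ℂ ω K 0 := by
    have hk : ContDiffAt ℂ ω (fun ζ : ℂ => p - ζ ^ 2) 0 := by fun_prop
    have hpA : ∀ j, ContDiffAt ℂ ω (fun ζ => polyA A j (p - ζ ^ 2)) 0 := fun j =>
      (contDiffAt_const.add (hk.smul contDiffAt_const)).add ((hk.pow 2).smul contDiffAt_const)
    have hbv : ContDiffAt ℂ ω (fun ζ => b ⬝ᵥ v ζ) 0 :=
      ContDiffAt.sum fun i _ => contDiffAt_const.mul (contDiffAt_pi.mp h.an_v.contDiffAt i)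
    exact (((hpA 0).sub (hk.smul contDiffAt_const)).add (contDiffAt_matrix_mul (hpA 1)
      (hF.contDiffAt.add (h.an_w.contDiffAt.smul contDiffAt_const)))).add
      (hbv.smul contDiffAt_const)
  have hKz : ∀ z : ℂ, z ≠ 0 → ∀ (X : Matrix S S ℂ) (l : ℂ), polyA A 0 z - z • 1 + polyA A 1 z * (X + l • 1)
      = z • (Astar A 0 z - 1 + Astar A 1 z * (X + l • 1)) := by
    intro z hz X l
    simp only [polyA, ← smul_Astar hz, Matrix.smul_mul]
    module
  -- With the zero functional the bound says that `K ζ` remains injective. Since `K ζ` kills the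
  -- residual `F v - w v`, the corrected solution has the prescribed eigenpair and solves (1).
  obtain ⟨C, hC⟩ := exists_bound_of_injective (l := fun _ => (0 : S → ℂ)) (M := K)
    (fun i j => (contDiffAt_pi.mp (contDiffAt_pi.mp hKc i) j).continuousAt) continuousAt_const (by
      intro x hx _
      refine h.corrected_injective hA hstoch hirr hlt ?_
      simp only [hK, ne_eq, OfNat.ofNat_ne_zero, not_false_eq_true, zero_pow, sub_zero, hKz p hp,
        hF0, h.w_zero, hbv] at hx
      rw [Matrix.add_mulVec, hA0, hA1, Matrix.smul_mulVec _ 1, Matrix.one_mulVec] at hx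
      rw [← hG₀]
      refine (eq_neg_of_add_eq_zero_left hx).trans ?_
      ext a
      simp)
  have hFv : ∀ᶠ ζ in 𝓝 (0 : ℂ), F ζ *ᵥ v ζ = w ζ • v ζ := by
    filter_upwards [hFz, hne, hC, h.ker] with ζ h1 h2 h3 h4
    have h5 := congrArg (fun M => M *ᵥ v ζ) h1
    simp only [hcor, Matrix.add_mulVec, Matrix.zero_mulVec,
      vecMulVec_mulVec'] at h5
    have h6 : K ζ *ᵥ (F ζ *ᵥ v ζ - w ζ • v ζ) = 0 := by
      rw [← h5, hK]
      simp only
      rw [hKz _ h2, Matrix.add_mulVec, Matrix.smul_mulVec _ 1, Matrix.one_mulVec,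
        quad_mulVec h2 h4]
    have h7 := h3 _ h6
    simp only [zero_dotProduct, norm_zero, mul_zero] at h7
    exact sub_eq_zero.mp (norm_le_zero_iff.mp h7)
  refine ⟨F, hent, hF0, ?_, hFv, ?_⟩
  · filter_upwards [hFz, hne, hFv] with ζ h1 h2 h3
    simp only [hcor, h3, sub_self] at h1
    rw [← quad_eq_zero_iff h2]
    refine Eq.trans ?_ h1
    ext; simp [Matrix.vecMulVec, hpdef]
  · have hne' : ∀ᶠ q : ℂ × Matrix S S ℂ in 𝓝 ((0 : ℂ), G₀), p - q.1 ^ 2 ≠ 0 :=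
      (continuous_fst.tendsto ((0 : ℂ), G₀)).eventually hne
    filter_upwards [hFu, hne'] with q h1 h2 h3 h4
    refine h1 ?_
    rw [(quad_eq_zero_iff h2).mpr h3, hcor, h4, sub_self]
    ext; simp [Matrix.vecMulVec]

end Solutions

/-! ### The companion solution as the other determination -/

section Companion
open scoped ContDiff
attribute [local instance] Matrix.normedAddCommGroup Matrix.normedSpace
variable {S : Type*} [Fintype S] [DecidableEq S] {A : ℤ → ℤ → Matrix S S ℝ}
variable {w₀ : ℝ} {v₀ π : S → ℝ} {w : ℂ → ℂ} {v : ℂ → S → ℂ} {F : ℂ → Matrix S S ℂ}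

/-- Replacing an eigenvalue of a solvent. -/
lemma companion_solves {z : ℂ} (hz : z ≠ 0) {X : Matrix S S ℂ} (hX : SolvesQuadratic A z X)
    {α β : ℂ} {u x : S → ℂ} (hu : u ᵥ* X = α • u) (hx : Lmat A z β *ᵥ x = 0) (hux : u ⬝ᵥ x = 1) :
    SolvesQuadratic A z (X + (β • 1 - X) * Matrix.vecMulVec x u) ∧
      (X + (β • 1 - X) * Matrix.vecMulVec x u) *ᵥ x = β • x := by
  have ey : (β • (1 : Matrix S S ℂ) - X) *ᵥ x = β • x - X *ᵥ x := by
    rw [Matrix.sub_mulVec, Matrix.smul_mulVec, Matrix.one_mulVec]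
  rw [mul_vecMulVec', ey]
  set y := β • x - X *ᵥ x with hy
  set Y := Matrix.vecMulVec y u with hY
  have huX : u ⬝ᵥ (X *ᵥ x) = α := by
    rw [Matrix.dotProduct_mulVec, hu, smul_dotProduct, hux, smul_eq_mul, mul_one]
  have huy : u ⬝ᵥ y = β - α := by
    rw [hy, dotProduct_sub, dotProduct_smul, hux, huX, smul_eq_mul, mul_one]
  have hT : (Astar A 0 z - 1 + Astar A 1 z * (X + β • 1)) *ᵥ y = 0 := by
    have h1 := quad_mulVec (X := X) hz hx
    rw [(quad_eq_zero_iff hz).mpr hX, Matrix.zero_mulVec,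
      show X *ᵥ x - β • x = -y by rw [hy, neg_sub], Matrix.mulVec_neg,
      Matrix.smul_mulVec] at h1
    exact (smul_eq_zero.mp (neg_eq_zero.mp h1.symm)).resolve_left hz
  have hYX : Y * X = α • Y := by
    rw [hY, Matrix.vecMulVec_mul, hu, Matrix.vecMulVec_smul]
  have hYY : Y * Y = (β - α) • Y := by
    rw [hY, mul_vecMulVec', vecMulVec_mulVec', huy, Matrix.smul_vecMulVec]
  have hTY : (Astar A 0 z - 1 + Astar A 1 z * (X + β • 1)) * Y = 0 := by
    rw [hY, mul_vecMulVec', hT]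
    ext; simp [Matrix.vecMulVec]
  constructor
  -- `Y X = α Y` and `Y Y = (β - α) Y` add up to `β Y`; the resulting multiple of `Y` is the one
  -- killed in `hTY`.
  · have hsq : (X + Y) ^ 2 = X ^ 2 + (X + β • 1) * Y := by
      rw [pow_two, pow_two, mul_add, add_mul, add_mul, add_mul, hYX, hYY, Matrix.smul_mul,
        Matrix.one_mul]
      module
    rw [SolvesQuadratic] at hX ⊢
    have e : Astar A (-1) z + Astar A 0 z * (X + Y) + Astar A 1 z * (X + Y) ^ 2
        = (Astar A (-1) z + Astar A 0 z * X + Astar A 1 z * X ^ 2)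
          + (Astar A 0 z - 1 + Astar A 1 z * (X + β • 1)) * Y + Y := by
      rw [hsq]
      noncomm_ring
    rw [e, hX, hTY, add_zero]
  · rw [Matrix.add_mulVec, hY, vecMulVec_mulVec', hux, one_smul, hy, add_sub_cancel]

lemma tendsto_neg_zero : Filter.Tendsto (fun ζ : ℂ => -ζ) (𝓝 0) (𝓝 0) := by
  simpa using (continuous_neg (G := ℂ)).tendsto 0

/-- Simplicity of the Perron root at `ζ = 0` persists: a kernel vector orthogonal to `π` stays zero
nearby. -/
lemma IsBranchPair.kernel_eq [Nonempty S]
    (hA : ∀ i ∈ H, ∀ j ∈ H, ∀ a b : S, 0 ≤ A i j a b)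
    (hirr : ChainIrreducible (transition A)) (h : IsBranchPair A w₀ v₀ π w v) :
    ∀ᶠ ζ in 𝓝 (0 : ℂ), ∀ x, Lmat A (zBar A - ζ ^ 2) (w ζ) *ᵥ x = 0 → ∃ c : ℂ, x = c • v ζ := by
  have hp := zBar_pos A
  set p : ℂ := ((zBar A : ℝ) : ℂ) with hpdef
  have hp0 : p ≠ 0 := by rw [hpdef]; exact_mod_cast hp.ne'
  set K : ℂ → Matrix S S ℂ := fun ζ => polyA A (-1) (p - ζ ^ 2)
    + w ζ • (polyA A 0 (p - ζ ^ 2) - (p - ζ ^ 2) • 1) + w ζ ^ 2 • polyA A 1 (p - ζ ^ 2) with hK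
  have hKc : ContDiffAt ℂ ω K 0 := by
    have hk : ContDiffAt ℂ ω (fun ζ : ℂ => p - ζ ^ 2) 0 := by fun_prop
    have hpA : ∀ j, ContDiffAt ℂ ω (fun ζ => polyA A j (p - ζ ^ 2)) 0 := fun j =>
      (contDiffAt_const.add (hk.smul contDiffAt_const)).add ((hk.pow 2).smul contDiffAt_const)
    have hw := h.an_w.contDiffAt (n := ω)
    exact ((hpA (-1)).add (hw.smul ((hpA 0).sub (hk.smul contDiffAt_const)))).add
      ((hw.pow 2).smul (hpA 1))
  have hKL : ∀ ζ : ℂ, p - ζ ^ 2 ≠ 0 → K ζ = Lmat A (p - ζ ^ 2) (w ζ) := by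
    intro ζ hζ
    simp only [hK, polyA, ← smul_Astar hζ, Lmat]
    module
  obtain ⟨C, hC⟩ := exists_bound_of_injective (l := fun _ => cv π) (M := K)
    (fun i j => (contDiffAt_pi.mp (contDiffAt_pi.mp hKc i) j).continuousAt) continuousAt_const (by
      intro x hx hπx
      rw [hKL 0 (by simpa using hp0), h.w_zero, zero_pow two_ne_zero, sub_zero, hpdef,
        Lmat_ofReal A _ h.w₀_pos.ne', cm_smul, Matrix.smul_mulVec, smul_eq_zero, cm_sub, cm_one,
        Matrix.sub_mulVec, Matrix.one_mulVec, sub_eq_zero] at hx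
      refine perron_simple (irred_creal hA hirr hp h.w₀_pos) h.π_pos h.left
        (hx.resolve_left (by exact_mod_cast (mul_pos hp h.w₀_pos).ne')) ?_
      rw [← hπx, dotProduct]
      exact Finset.sum_congr rfl fun a _ => mul_comm _ _)
  have hπv : ∀ᶠ ζ in 𝓝 (0 : ℂ), cv π ⬝ᵥ v ζ ≠ 0 := by
    have hc : ContinuousAt (fun ζ => cv π ⬝ᵥ v ζ) 0 :=
      tendsto_finsetSum _ fun a _ => Filter.Tendsto.mul tendsto_const_nhds
        (continuousAt_pi.mp h.an_v.continuousAt a)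
    refine hc.eventually_ne ?_
    rw [h.v_zero, cv_dotProduct_cv]
    have : 0 < π ⬝ᵥ v₀ := Finset.sum_pos (fun a _ => mul_pos (h.π_pos a) (h.v₀_pos a))
      Finset.univ_nonempty
    exact_mod_cast this.ne'
  filter_upwards [hC, hπv, eventually_ne_zero A, h.ker] with ζ h1 h2 h3 h4 x hx
  refine ⟨(cv π ⬝ᵥ x) / (cv π ⬝ᵥ v ζ), ?_⟩
  have h5 := h1 (x - ((cv π ⬝ᵥ x) / (cv π ⬝ᵥ v ζ)) • v ζ) (by
    rw [hKL ζ h3, Matrix.mulVec_sub, Matrix.mulVec_smul, hx, h4, smul_zero, sub_zero])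
  rw [dotProduct_sub, dotProduct_smul, smul_eq_mul, div_mul_cancel₀ _ h2, sub_self, norm_zero,
    mul_zero] at h5
  exact sub_eq_zero.mp (norm_le_zero_iff.mp h5)

/-- At `ζ = 0` the vectors `v ζ` and `v (-ζ)` coincide, and left Perron vectors are not orthogonal
to `v₀`. The uniform bound lets the companion be normalized without blow-up as the eigenvalues
merge. -/
lemma IsSolutionBranch.left_bound [Nonempty S]
    (hA : ∀ i ∈ H, ∀ j ∈ H, ∀ a b : S, 0 ≤ A i j a b)
    (hstoch : ∀ a : S, ∑ b : S, total A a b = 1)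
    (hirr : ChainIrreducible (transition A)) (hlt : zLow A < zBar A)
    (h : IsBranchPair A w₀ v₀ π w v) (hF : IsSolutionBranch A w v F) :
    ∃ C : ℝ, ∀ᶠ ζ in 𝓝 (0 : ℂ), ∀ u, u ᵥ* F ζ = w ζ • u → ‖u‖ ≤ C * ‖u ⬝ᵥ v (-ζ)‖ := by
  have hT : ∀ ζ (u : S → ℂ), (F ζ - w ζ • (1 : Matrix S S ℂ))ᵀ *ᵥ u = u ᵥ* F ζ - w ζ • u := by
    intro ζ u
    rw [Matrix.mulVec_transpose, Matrix.vecMul_sub, Matrix.vecMul_smul, Matrix.vecMul_one]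
  obtain ⟨C, hC⟩ := exists_bound_of_injective (l := fun ζ => v (-ζ))
    (M := fun ζ => (F ζ - w ζ • 1)ᵀ) (fun i j => by
      simp only [Matrix.transpose_apply, Matrix.sub_apply, Matrix.smul_apply, smul_eq_mul]
      exact (hF.analytic j i).continuousAt.sub (h.an_w.continuousAt.mul continuousAt_const))
    (by
      have := h.an_v.continuousAt.tendsto.comp tendsto_neg_zero
      simpa [ContinuousAt, Function.comp_def] using this)
    (by
      intro u hu huv
      rw [hT, hF.zero, h.w_zero, sub_eq_zero] at hu
      rw [neg_zero, h.v_zero, dotProduct_comm] at huv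
      exact h.left_eigenvector_eq_zero hA hstoch hirr hlt hu huv)
  refine ⟨C, ?_⟩
  filter_upwards [hC] with ζ h1 u hu
  have := h1 u (by rw [hT, hu, sub_self])
  rwa [dotProduct_comm] at this

lemma IsSolutionBranch.exists_eps (hF : IsSolutionBranch A w v F) :
    ∃ ε > 0, ∀ (ζ : ℂ) (X : Matrix S S ℂ), ‖ζ‖ < ε →
      (∀ a b, ‖X a b - cm (greal A (zBar A)) a b‖ < ε) → SolvesQuadratic A (zBar A - ζ ^ 2) X →
      X *ᵥ v ζ = w ζ • v ζ → F ζ = X := by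
  obtain ⟨ε, hε, h⟩ := Metric.eventually_nhds_iff.mp hF.unique
  refine ⟨ε, hε, fun ζ X hζ hX => ?_⟩
  refine @h (ζ, X) ?_
  rw [Prod.dist_eq, max_lt_iff]
  refine ⟨by simpa using hζ, ?_⟩
  rw [dist_eq_norm, Matrix.norm_lt_iff hε]
  exact hX

lemma IsSolutionBranch.tendsto_apply (hF : IsSolutionBranch A w v F) (a b : S) :
    Filter.Tendsto (fun ζ => F ζ a b) (𝓝 0) (𝓝 (cm (greal A (zBar A)) a b)) := by
  have := (hF.analytic a b).continuousAt.tendsto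
  rwa [hF.zero] at this

/-- The companion of the solution branch is its other determination. -/
lemma IsSolutionBranch.eventually_companion [Nonempty S]
    (hA : ∀ i ∈ H, ∀ j ∈ H, ∀ a b : S, 0 ≤ A i j a b)
    (hstoch : ∀ a : S, ∑ b : S, total A a b = 1)
    (hirr : ChainIrreducible (transition A)) (hlt : zLow A < zBar A)
    (h : IsBranchPair A w₀ v₀ π w v) (hF : IsSolutionBranch A w v F) :
    ∀ᶠ ζ in 𝓝 (0 : ℂ), ∀ u x, u ᵥ* F ζ = w ζ • u →
      Lmat A (zBar A - ζ ^ 2) (w (-ζ)) *ᵥ x = 0 → u ⬝ᵥ x = 1 →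
      F ζ + (w (-ζ) • (1 : Matrix S S ℂ) - F ζ) * Matrix.vecMulVec x u = F (-ζ) := by
  obtain ⟨C, hC⟩ := hF.left_bound hA hstoch hirr hlt h
  obtain ⟨ε, hε, huniq⟩ := hF.exists_eps
  have hC' : ∃ C' > 0, C ≤ C' := ⟨max C 1, by positivity, le_max_left _ _⟩
  obtain ⟨C', hC'0, hCC⟩ := hC'
  have hsmall : ∀ᶠ ζ in 𝓝 (0 : ℂ), ‖ζ‖ < ε := by
    have := Metric.ball_mem_nhds (0 : ℂ) hε
    filter_upwards [this] with ζ hζ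
    simpa using hζ
  have hFs : ∀ᶠ ζ in 𝓝 (0 : ℂ), ∀ a b, ‖F ζ a b - cm (greal A (zBar A)) a b‖ < ε / 2 := by
    refine Filter.eventually_all.mpr fun a => Filter.eventually_all.mpr fun b => ?_
    have := Metric.tendsto_nhds.mp (hF.tendsto_apply a b) (ε / 2) (half_pos hε)
    simpa [dist_eq_norm] using this
  -- This residual tends to `w₀ v₀ - G₁(zBar) v₀ = 0`; with the bound on `x ⊗ u` it keeps the
  -- companion near `G₁(zBar)`, where local uniqueness applies.
  have hys : ∀ᶠ ζ in 𝓝 (0 : ℂ), ∀ a,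
      ‖(w (-ζ) • v (-ζ) - F ζ *ᵥ v (-ζ)) a‖ < ε / 2 / C' := by
    refine Filter.eventually_all.mpr fun a => ?_
    have hw := h.an_w.continuousAt.tendsto.comp tendsto_neg_zero
    have hv := h.an_v.continuousAt.tendsto.comp tendsto_neg_zero
    have hva : ∀ b, Filter.Tendsto (fun ζ => v (-ζ) b) (𝓝 0) (𝓝 (v 0 b)) := fun b =>
      (continuous_apply b).continuousAt.tendsto.comp hv
    have ht : Filter.Tendsto (fun ζ => (w (-ζ) • v (-ζ) - F ζ *ᵥ v (-ζ)) a) (𝓝 0)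
        (𝓝 ((w 0 • v 0 - cm (greal A (zBar A)) *ᵥ v 0) a)) :=
      (hw.mul (hva a)).sub (tendsto_finsetSum _ fun b _ => (hF.tendsto_apply a b).mul (hva b))
    have e : (w 0 • v 0 - cm (greal A (zBar A)) *ᵥ v 0) a = 0 := by
      rw [h.w_zero, h.v_zero, cm_mulVec_cv, h.greal_mulVec hA hstoch hirr hlt]
      simp [cv]
    rw [e] at ht
    have := Metric.tendsto_nhds.mp ht (ε / 2 / C') (by positivity)
    simpa [dist_eq_norm] using this
  filter_upwards [hC, hsmall, hFs, hys, tendsto_neg_zero.eventually (h.kernel_eq hA hirr),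
    eventually_ne_zero A, hF.solves] with ζ h1 h2 h3 h4 h5 h6 h7 u x hu hx hux
  rw [neg_sq] at h5
  obtain ⟨hq, hXx⟩ := companion_solves h6 h7 hu hx hux
  obtain ⟨c, rfl⟩ := h5 x hx
  rw [dotProduct_smul, smul_eq_mul] at hux
  have hc : c ≠ 0 := fun hc => by simp [hc] at hux
  refine (huniq (-ζ) _ (by rwa [norm_neg]) ?_ (by rwa [neg_sq]) ?_).symm
  · intro a b
    have e : (F ζ + (w (-ζ) • (1 : Matrix S S ℂ) - F ζ) * Matrix.vecMulVec (c • v (-ζ)) u) a b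
        - cm (greal A (zBar A)) a b = (F ζ a b - cm (greal A (zBar A)) a b)
          + (w (-ζ) • v (-ζ) - F ζ *ᵥ v (-ζ)) a * (c * u b) := by
      rw [mul_vecMulVec', Matrix.mulVec_smul, Matrix.sub_mulVec, Matrix.smul_mulVec,
        Matrix.one_mulVec, Matrix.add_apply, Matrix.vecMulVec_apply, Pi.smul_apply, smul_eq_mul]
      ring
    have hcu : ‖c * u b‖ ≤ C' := by
      have h8 : ‖u b‖ ≤ C * ‖u ⬝ᵥ v (-ζ)‖ := (norm_le_pi_norm u b).trans (h1 u hu)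
      have h9 : ‖c‖ * ‖u ⬝ᵥ v (-ζ)‖ = 1 := by rw [← norm_mul, hux, norm_one]
      rw [norm_mul]
      calc ‖c‖ * ‖u b‖ ≤ ‖c‖ * (C * ‖u ⬝ᵥ v (-ζ)‖) := by gcongr
        _ = C * (‖c‖ * ‖u ⬝ᵥ v (-ζ)‖) := by ring
        _ ≤ C' := by rw [h9, mul_one]; exact hCC
    rw [e]
    calc _ ≤ ‖F ζ a b - cm (greal A (zBar A)) a b‖
          + ‖(w (-ζ) • v (-ζ) - F ζ *ᵥ v (-ζ)) a‖ * ‖c * u b‖ :=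
          (norm_add_le _ _).trans_eq (by rw [norm_mul])
      _ ≤ ‖F ζ a b - cm (greal A (zBar A)) a b‖
          + ε / 2 / C' * C' := by
          gcongr
          exact (h4 a).le
      _ = ‖F ζ a b - cm (greal A (zBar A)) a b‖ + ε / 2 := by field_simp
      _ < ε / 2 + ε / 2 := by linarith [h3 a b]
      _ = ε := add_halves ε
  · rw [Matrix.mulVec_smul, smul_comm] at hXx
    exact smul_right_injective _ hc hXx

lemma IsSolutionBranch.eventually_exists_eigenvectors [Nonempty S]
    (hA : ∀ i ∈ H, ∀ j ∈ H, ∀ a b : S, 0 ≤ A i j a b)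
    (hstoch : ∀ a : S, ∑ b : S, total A a b = 1)
    (hirr : ChainIrreducible (transition A)) (hlt : zLow A < zBar A)
    (h : IsBranchPair A w₀ v₀ π w v) (hF : IsSolutionBranch A w v F) :
    ∀ᶠ ζ in 𝓝 (0 : ℂ), ∃ u x, u ≠ 0 ∧ u ᵥ* F ζ = w ζ • u ∧
      Lmat A (zBar A - ζ ^ 2) (w (-ζ)) *ᵥ x = 0 ∧ u ⬝ᵥ x = 1 := by
  obtain ⟨C, hC⟩ := hF.left_bound hA hstoch hirr hlt h
  have hv0 : ∀ᶠ ζ in 𝓝 (0 : ℂ), v ζ ≠ 0 := by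
    refine h.an_v.continuousAt.eventually_ne ?_
    obtain ⟨a⟩ := ‹Nonempty S›
    intro h0
    have := congrFun h0 a
    rw [h.v_zero] at this
    simp [cv, (h.v₀_pos a).ne'] at this
  filter_upwards [hC, hF.mulVec, hv0, tendsto_neg_zero.eventually h.ker] with ζ h1 h2 h3 h4
  have hdet : (F ζ - w ζ • (1 : Matrix S S ℂ)).det = 0 := by
    refine Matrix.exists_mulVec_eq_zero_iff.mp ⟨v ζ, h3, ?_⟩
    rw [Matrix.sub_mulVec, h2, Matrix.smul_mulVec, Matrix.one_mulVec, sub_self]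
  obtain ⟨u, hu0, hu⟩ := Matrix.exists_vecMul_eq_zero_iff.mpr hdet
  rw [Matrix.vecMul_sub, Matrix.vecMul_smul, Matrix.vecMul_one, sub_eq_zero] at hu
  have huv : u ⬝ᵥ v (-ζ) ≠ 0 := by
    intro h0
    have := h1 u hu
    rw [h0, norm_zero, mul_zero] at this
    exact hu0 (norm_le_zero_iff.mp this)
  rw [neg_sq] at h4
  refine ⟨u, (u ⬝ᵥ v (-ζ))⁻¹ • v (-ζ), hu0, hu, ?_, ?_⟩
  · rw [Matrix.mulVec_smul, h4, smul_zero]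
  · rw [dotProduct_smul, smul_eq_mul, inv_mul_cancel₀ huv]

/-- On the positive side the solution branch is `G₁`. -/
lemma IsSolutionBranch.eventually_eq_G1 [Nonempty S]
    (hA : ∀ i ∈ H, ∀ j ∈ H, ∀ a b : S, 0 ≤ A i j a b)
    (hstoch : ∀ a : S, ∑ b : S, total A a b = 1)
    (hirr : ChainIrreducible (transition A)) (hlt : zLow A < zBar A)
    (h : IsBranchPair A w₀ v₀ π w v) (hF : IsSolutionBranch A w v F) :
    ∀ᶠ t : ℝ in 𝓝[>] 0, F t = G1 A ((zBar A - t ^ 2 : ℝ) : ℂ) := by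
  obtain ⟨ε, hε, huniq⟩ := hF.exists_eps
  have hev := h.eventually_pos hA hstoch hirr hlt
  have hsmall : ∀ᶠ t : ℝ in 𝓝[>] 0, ‖(t : ℂ)‖ < ε := by
    have : ∀ᶠ ζ in 𝓝 (0 : ℂ), ‖ζ‖ < ε := by
      filter_upwards [Metric.ball_mem_nhds (0 : ℂ) hε] with ζ hζ
      simpa using hζ
    exact (tendsto_ofReal_zero.mono_left nhdsWithin_le_nhds).eventually this
  have hG : ∀ᶠ t : ℝ in 𝓝[>] 0, ∀ a b,
      ‖G1 A ((zBar A - t ^ 2 : ℝ) : ℂ) a b - cm (greal A (zBar A)) a b‖ < ε := by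
    refine Filter.eventually_all.mpr fun a => Filter.eventually_all.mpr fun b => ?_
    have hc := G1_apply_continuousOn hA hstoch hirr a b (zBar A : ℂ)
      (by simp [cannulus, abs_of_pos (zBar_pos A), hlt.le])
    rw [ContinuousWithinAt, G1_ofReal hA hstoch hirr hlt.le le_rfl] at hc
    have ht : Filter.Tendsto (fun t : ℝ => ((zBar A - t ^ 2 : ℝ) : ℂ)) (𝓝[>] 0)
        (𝓝[cannulus A] (zBar A : ℂ)) := by
      refine tendsto_nhdsWithin_iff.mpr ⟨?_, ?_⟩
      · have : Filter.Tendsto (fun t : ℝ => ((zBar A - t ^ 2 : ℝ) : ℂ)) (𝓝 0)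
            (𝓝 (zBar A : ℂ)) := Continuous.tendsto' (by fun_prop) _ _ (by simp)
        exact this.mono_left nhdsWithin_le_nhds
      · filter_upwards [hev] with t ht
        have h1 := ht.2.2.1
        have h2 := (zLow_pos A).trans h1
        simp only [cannulus, Set.mem_ofPred_eq, Complex.norm_real, Real.norm_eq_abs, abs_of_pos h2]
        exact ⟨h1.le, by nlinarith [sq_nonneg t]⟩
    have := Metric.tendsto_nhds.mp (hc.comp ht) ε hε
    simp only [dist_eq_norm, Function.comp_apply] at this
    exact this
  filter_upwards [hev, hsmall, hG] with t h1 h2 h3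
  have hx0 := (zLow_pos A).trans h1.2.2.1
  have hle : zBar A - t ^ 2 ≤ zBar A := by nlinarith [sq_nonneg t]
  refine huniq t _ h2 h3 ?_ ?_
  · have := G1_quadratic hA hstoch hirr (z := ((zBar A - t ^ 2 : ℝ) : ℂ))
      (by rw [Complex.norm_real, Real.norm_eq_abs, abs_of_pos hx0]; exact h1.2.2.1.le)
      (by rw [Complex.norm_real, Real.norm_eq_abs, abs_of_pos hx0]; exact hle)
    convert this using 1
    push_cast; rfl
  · rw [G1_ofReal hA hstoch hirr h1.2.2.1.le hle]
    exact h1.2.2.2.2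

/-- The two determinations of the solution branch differ. -/
lemma IsSolutionBranch.eventually_ne [Nonempty S]
    (hA : ∀ i ∈ H, ∀ j ∈ H, ∀ a b : S, 0 ≤ A i j a b)
    (hstoch : ∀ a : S, ∑ b : S, total A a b = 1)
    (hirr : ChainIrreducible (transition A)) (hlt : zLow A < zBar A)
    (h : IsBranchPair A w₀ v₀ π w v) (hF : IsSolutionBranch A w v F) :
    ∀ᶠ t : ℝ in 𝓝[>] 0, F (-t) ≠ F t := by
  have hc : Filter.Tendsto (fun t : ℝ => (t : ℂ)) (𝓝[>] 0) (𝓝 0) :=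
    tendsto_ofReal_zero.mono_left nhdsWithin_le_nhds
  have hn : Filter.Tendsto (fun t : ℝ => -(t : ℂ)) (𝓝[>] 0) (𝓝 0) := tendsto_neg_zero.comp hc
  have hn' : Filter.Tendsto (fun t : ℝ => -t) (𝓝[>] 0) (𝓝 0) :=
    (Continuous.tendsto' (by fun_prop) (0 : ℝ) 0 (by simp)).mono_left nhdsWithin_le_nhds
  filter_upwards [h.eventually_pos hA hstoch hirr hlt, hF.eventually_eq_G1 hA hstoch hirr hlt h,
    hn.eventually hF.mulVec, nhdsWithin_le_nhds h.eventually_real, hn'.eventually h.eventually_real]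
    with t h1 h2 h3 h4 h5 heq
  obtain ⟨-, -, hx1, hlt', -⟩ := h1
  have hle : zBar A - t ^ 2 ≤ zBar A := by nlinarith [sq_nonneg t]
  have hG : F t = cm (greal A (zBar A - t ^ 2)) := by
    rw [h2, G1_ofReal hA hstoch hirr hx1.le hle]; rfl
  have hGle := greal_mulVec_le hA hstoch hirr hx1.le hle h4.1 h4.2.1 h4.2.2.2.2.le
  rw [heq, hG] at h3
  -- Equality would give `G₁` the eigenvalue `w (-t)`, larger than the bound `w t` on its spectrum.
  have h6 := norm_eigenvalue_le
    (fun a b => (norm_cm_apply (greal_nonneg hA hstoch hirr hx1.le hle) a b).le) h4.2.1 hGle h3 (by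
      intro h0
      obtain ⟨a⟩ := ‹Nonempty S›
      have := h5.2.1 a
      rw [Complex.ofReal_neg, h0] at this
      simp at this)
  rw [h4.2.2.1, Complex.norm_real, Real.norm_eq_abs, abs_of_pos h4.1] at hlt'
  linarith

end Companion

/-! ### Continuation across the circle and gluing -/

section Extension
variable {S : Type*} [Fintype S] [DecidableEq S] {A : ℤ → ℤ → Matrix S S ℝ}
variable {w₀ : ℝ} {v₀ π : S → ℝ} {w : ℂ → ℂ} {v : ℂ → S → ℂ}

lemma norm_add_mul_apply_le {M N P : Matrix S S ℂ} {M' N' P' : Matrix S S ℝ}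
    (hM : ∀ a b, ‖M a b‖ ≤ M' a b) (hN : ∀ a b, ‖N a b‖ ≤ N' a b) (hP : ∀ a b, ‖P a b‖ ≤ P' a b)
    (a b : S) : ‖(M + N * P) a b‖ ≤ (M' + N' * P') a b := by
  rw [Matrix.add_apply, Matrix.add_apply]
  exact (norm_add_le _ _).trans (add_le_add (hM a b) (norm_mul_apply_le hN hP a b))

/-- The linearization is injective on the outer circle. -/
lemma linearized_injective_on_circle [Nonempty S]
    (hA : ∀ i ∈ H, ∀ j ∈ H, ∀ a b : S, 0 ≤ A i j a b)
    (hstoch : ∀ a : S, ∑ b : S, total A a b = 1)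
    (hirr : ChainIrreducible (transition A)) (hlt : zLow A < zBar A)
    (h : IsBranchPair A w₀ v₀ π w v) {z : ℂ} (hz : ‖z‖ = zBar A) (hne : z ≠ zBar A)
    {d : Matrix S S ℂ}
    (hd : d = (Astar A 0 z + Astar A 1 z * G1 A z) * d + Astar A 1 z * d * G1 A z) : d = 0 := by
  have hp := zBar_pos A
  have hz0 : z ≠ 0 := by
    rintro rfl
    rw [norm_zero] at hz
    exact hp.ne hz
  have h1 : zLow A ≤ ‖z‖ := hz ▸ hlt.le
  have h2 : ‖z‖ ≤ zBar A := hz.le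
  have hGle : ∀ a b, ‖G1 A z a b‖ ≤ greal A (zBar A) a b := fun a b => by
    have := norm_G1_le hA hstoch hirr h1 h2 a b
    rwa [hz] at this
  have hAle : ∀ j ∈ H, ∀ a b, ‖Astar A j z a b‖ ≤ astar A j (zBar A) a b := fun j hj a b => by
    have := norm_Astar_le hA hj z a b
    rwa [hz] at this
  have hGv := h.greal_mulVec hA hstoch hirr hlt
  have hG := greal_nonneg hA hstoch hirr hlt.le le_rfl
  choose N hN using fun a => norm_pow_lt hA hirr hz0 (by rw [hz]; exact hne)
    (G1_quadratic hA hstoch hirr h1 h2)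
    (by rw [hz]; exact greal_quadratic hA hstoch hirr hlt.le le_rfl) hGle a
  set n := ∑ a, N a with hn
  have hNn : ∀ a, N a ≤ n := fun a => Finset.single_le_sum (fun _ _ => Nat.zero_le _)
    (Finset.mem_univ a)
  have hpow := pow_mulVec_eq hGv n
  -- Every row of the dominating power has a positive entry because it fixes `v₀` up to scaling;
  -- there the domination is strict.
  have hrow : ∀ a, ∑ b, ‖(G1 A z ^ n) a b‖ * v₀ b < w₀ ^ n * v₀ a := by
    intro a
    have e : w₀ ^ n * v₀ a = ∑ b, (greal A (zBar A) ^ n) a b * v₀ b := (congrFun hpow a).symm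
    have hpos : 0 < w₀ ^ n * v₀ a := mul_pos (pow_pos h.w₀_pos n) (h.v₀_pos a)
    rw [e] at hpos ⊢
    obtain ⟨b, -, hb⟩ := Finset.exists_lt_of_sum_lt (by simpa using hpos :
      ∑ b : S, (0 : ℝ) < ∑ b, (greal A (zBar A) ^ n) a b * v₀ b)
    refine Finset.sum_lt_sum (fun c _ => mul_le_mul_of_nonneg_right
      (norm_pow_apply_le hGle n a c) (h.v₀_pos c).le) ⟨b, Finset.mem_univ b, ?_⟩
    exact mul_lt_mul_of_pos_right (hN a n (hNn a) b (pos_of_mul_pos_left hb (h.v₀_pos b).le))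
      (h.v₀_pos b)
  obtain ⟨c, hc, hcon⟩ := contraction_of_row_lt h.v₀_pos hrow
  exact QBD.linearized_eq_zero (U := censored A)
    (norm_add_mul_apply_le (hAle 0 zero_mem_H) (hAle 1 one_mem_H) hGle) (hAle 1 one_mem_H) hGle
    h.v₀_pos h.π_pos h.w₀_pos hGv (h.left_censored hA hstoch hirr hlt)
    (h.eq_zero_of_le_censored hA hstoch hirr hlt) hd hc (hcon d)

/-- A local analytic solution of the quadratic equation which continues `G₁` radially across the
outer circle. -/
structure IsPatch (A : ℤ → ℤ → Matrix S S ℝ) (V : Set ℂ) (g : ℂ → Matrix S S ℂ) : Prop where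
  isOpen : IsOpen V
  analytic : ∀ a b, AnalyticOnNhd ℂ (fun z => g z a b) V
  solves : ∀ z ∈ V, SolvesQuadratic A z (g z)
  agrees : ∀ z ∈ V, z ∈ annulus A → g z = G1 A z
  inner : ∀ z ∈ V, zLow A < ‖z‖
  radial : ∀ z ∈ V, ∀ s : ℝ, zBar A ≤ s → s ≤ ‖z‖ → ((s / ‖z‖ : ℝ) : ℂ) * z ∈ V

/-- An overlap of patches may be disconnected, but a radial segment joins each outer point to the
circle inside both patches, and just inside the circle both equal `G₁`. -/
lemma IsPatch.eq_of_mem {V V' : Set ℂ} {g g' : ℂ → Matrix S S ℂ} (h : IsPatch A V g)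
    (h' : IsPatch A V' g') (hlt : zLow A < zBar A) {z : ℂ} (hz : z ∈ V) (hz' : z ∈ V') :
    g z = g' z := by
  have hp := zBar_pos A
  rcases lt_or_ge ‖z‖ (zBar A) with hlt' | hge
  · have ha : z ∈ annulus A := ⟨h.inner z hz, hlt'⟩
    rw [h.agrees z hz ha, h'.agrees z hz' ha]
  have hn : 0 < ‖z‖ := hp.trans_le hge
  set γ : ℝ → ℂ := fun s => ((s / ‖z‖ : ℝ) : ℂ) * z with hγ
  have hγc : Continuous γ := by fun_prop
  have hγn : ∀ s : ℝ, 0 ≤ s → ‖γ s‖ = s := by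
    intro s hs
    rw [hγ]
    simp only
    rw [norm_mul, Complex.norm_real, Real.norm_eq_abs, abs_of_nonneg (div_nonneg hs hn.le),
      div_mul_cancel₀ _ hn.ne']
  have hγz : γ ‖z‖ = z := by simp only [hγ, div_self hn.ne', Complex.ofReal_one, one_mul]
  set T := γ '' Set.Icc (zBar A) ‖z‖ with hT
  have hTpre : IsPreconnected T := isPreconnected_Icc.image γ hγc.continuousOn
  have hTV : T ⊆ V := by
    rintro _ ⟨s, hs, rfl⟩
    exact h.radial z hz s hs.1 hs.2
  have hTV' : T ⊆ V' := by
    rintro _ ⟨s, hs, rfl⟩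
    exact h'.radial z hz' s hs.1 hs.2
  have h0 : γ (zBar A) ∈ T := ⟨zBar A, ⟨le_rfl, hge⟩, rfl⟩
  have hzT : z ∈ T := ⟨‖z‖, ⟨hge, le_rfl⟩, hγz⟩
  -- Points of the ray with radius slightly below `zBar` lie in the annulus and accumulate at the
  -- circle.
  have hfreq : ∃ᶠ y in 𝓝[≠] (γ (zBar A)), g y = g' y := by
    have ht : Filter.Tendsto γ (𝓝[<] (zBar A)) (𝓝[≠] (γ (zBar A))) := by
      refine tendsto_nhdsWithin_iff.mpr ⟨(hγc.tendsto _).mono_left nhdsWithin_le_nhds, ?_⟩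
      filter_upwards [self_mem_nhdsWithin, nhdsWithin_le_nhds (lt_mem_nhds hp)] with s hs hs0 heq
      have := congrArg norm heq
      rw [hγn s (le_of_lt hs0), hγn _ hp.le] at this
      exact (ne_of_lt hs) this
    refine ht.frequently (Filter.Eventually.frequently ?_)
    have e1 : ∀ᶠ s in 𝓝[<] (zBar A), γ s ∈ V ∩ V' :=
      ((hγc.tendsto _).mono_left nhdsWithin_le_nhds).eventually
        ((h.isOpen.inter h'.isOpen).mem_nhds ⟨hTV h0, hTV' h0⟩)
    filter_upwards [e1, self_mem_nhdsWithin, nhdsWithin_le_nhds (lt_mem_nhds hlt)] with s h1 h2 h3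
    have ha : γ s ∈ annulus A := by
      rw [annulus, Set.mem_ofPred_eq, hγn s ((zLow_pos A).trans h3).le]
      exact ⟨h3, h2⟩
    rw [h.agrees _ h1.1 ha, h'.agrees _ h1.2 ha]
  ext a b
  exact ((h.analytic a b).mono hTV).eqOn_of_preconnected_of_frequently_eq
    ((h'.analytic a b).mono hTV') hTpre h0 (hfreq.mono fun y hy => by simp only [hy]) hzT

lemma isPatch_annulus [Nonempty S] (hA : ∀ i ∈ H, ∀ j ∈ H, ∀ a b : S, 0 ≤ A i j a b)
    (hstoch : ∀ a : S, ∑ b : S, total A a b = 1)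
    (hirr : ChainIrreducible (transition A)) : IsPatch A (annulus A) (G1 A) where
  isOpen := isOpen_annulus A
  analytic := G1_analyticOnNhd hA hstoch hirr
  solves := fun _ hz => G1_quadratic hA hstoch hirr hz.1.le hz.2.le
  agrees := fun _ _ _ => rfl
  inner := fun _ hz => hz.1
  radial := fun _ hz _ h1 h2 => absurd (hz.2.trans_le h1) (not_lt.mpr h2)

/-- Points of a ball centred on a circle can be pulled back radially to the circle. -/
lemma radial_mem_ball {z z₁ : ℂ} {s p ε : ℝ} (hz₁ : ‖z₁‖ = p) (hp : 0 < p)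
    (hz : z ∈ Metric.ball z₁ ε) (h1 : p ≤ s) (h2 : s ≤ ‖z‖) :
    ((s / ‖z‖ : ℝ) : ℂ) * z ∈ Metric.ball z₁ ε := by
  have hn : 0 < ‖z‖ := hp.trans_le (h1.trans h2)
  rw [mem_ball_iff_norm] at hz ⊢
  refine lt_of_le_of_lt ?_ hz
  set t := s / ‖z‖ with ht
  have ht1 : t ≤ 1 := (div_le_one hn).mpr h2
  have htn : t * ‖z‖ = s := div_mul_cancel₀ _ hn.ne'
  have ht0 : 0 < t := div_pos (hp.trans_le h1) hn
  have hin : inner ℝ z z₁ ≤ ‖z‖ * p := hz₁ ▸ real_inner_le_norm z z₁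
  have e1 : ‖(t : ℂ) * z - z₁‖ ^ 2 = t ^ 2 * ‖z‖ ^ 2 - 2 * (t * inner ℝ z z₁) + p ^ 2 := by
    rw [show (t : ℂ) * z = t • z by simp, norm_sub_sq_real, norm_smul, inner_smul_left, hz₁,
      Real.norm_eq_abs, abs_of_pos ht0]
    simp; ring
  have e2 : ‖z - z₁‖ ^ 2 = ‖z‖ ^ 2 - 2 * inner ℝ z z₁ + p ^ 2 := by
    rw [norm_sub_sq_real, hz₁]
  refine (pow_le_pow_iff_left₀ (norm_nonneg _) (norm_nonneg _) two_ne_zero).mp ?_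
  rw [e1, e2]
  have h3 : 0 ≤ (1 - t) * ((1 + t) * ‖z‖ ^ 2 - 2 * inner ℝ z z₁) := by
    refine mul_nonneg (sub_nonneg.mpr ht1) ?_
    nlinarith [mul_le_mul_of_nonneg_left (htn ▸ h1 : p ≤ t * ‖z‖) hn.le,
      mul_le_mul_of_nonneg_left (h1.trans h2) hn.le]
  nlinarith

/-- The first passage matrix continues analytically across the outer circle. -/
lemma exists_isPatch_of_norm_eq [Nonempty S]
    (hA : ∀ i ∈ H, ∀ j ∈ H, ∀ a b : S, 0 ≤ A i j a b)
    (hstoch : ∀ a : S, ∑ b : S, total A a b = 1)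
    (hirr : ChainIrreducible (transition A)) (hlt : zLow A < zBar A)
    (h : IsBranchPair A w₀ v₀ π w v) {z : ℂ} (hz : ‖z‖ = zBar A) (hne : z ≠ zBar A) :
    ∃ V g, IsPatch A V g ∧ z ∈ V ∧ g z = G1 A z := by
  have hp := zBar_pos A
  have hz0 : z ≠ 0 := by
    rintro rfl
    rw [norm_zero] at hz
    exact hp.ne hz
  obtain ⟨g, hg, hgz, hgs, hgu⟩ := exists_regular_branch hz0
    (G1_quadratic hA hstoch hirr (hz ▸ hlt.le) hz.le)
    (fun d hd => linearized_injective_on_circle hA hstoch hirr hlt h hz hne hd)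
  have hzc : z ∈ cannulus A := ⟨hz ▸ hlt.le, hz.le⟩
  have hG : Filter.Tendsto (fun y => (y, G1 A y)) (𝓝[cannulus A] z) (𝓝 (z, G1 A z)) :=
    (Filter.tendsto_id.mono_left nhdsWithin_le_nhds).prodMk_nhds
      (tendsto_pi_nhds.mpr fun a => tendsto_pi_nhds.mpr fun b =>
        G1_apply_continuousOn hA hstoch hirr a b z hzc)
  have hev1 := eventually_nhdsWithin_iff.mp (hG.eventually hgu)
  have hev2 : ∀ᶠ y in 𝓝 z, ∀ a b, AnalyticAt ℂ (fun z => g z a b) y :=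
    Filter.eventually_all.mpr fun a => Filter.eventually_all.mpr fun b =>
      (hg a b).eventually_analyticAt
  have hev3 : ∀ᶠ y in 𝓝 z, zLow A < ‖y‖ :=
    continuous_norm.continuousAt.eventually (lt_mem_nhds (show zLow A < ‖z‖ by rw [hz]; exact hlt))
  obtain ⟨ε, hε, hall⟩ := Metric.eventually_nhds_iff_ball.mp
    (((hev1.and hev2).and hev3).and hgs)
  refine ⟨Metric.ball z ε, g, ⟨Metric.isOpen_ball, fun a b y hy => (hall y hy).1.1.2 a b,
    fun y hy => (hall y hy).2, fun y hy ha => ?_, fun y hy => (hall y hy).1.2,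
    fun y hy s h1 h2 => radial_mem_ball hz hp hy h1 h2⟩, Metric.mem_ball_self hε, hgz⟩
  exact (hall y hy).1.1.1 ⟨ha.1.le, ha.2.le⟩ (G1_quadratic hA hstoch hirr ha.1.le ha.2.le)

/-- Gluing all patches. -/
lemma exists_glued (hlt : zLow A < zBar A) :
    ∃ (U : Set ℂ) (G : ℂ → Matrix S S ℂ), IsOpen U ∧
      (∀ a b, AnalyticOnNhd ℂ (fun z => G z a b) U) ∧ (∀ z ∈ U, SolvesQuadratic A z (G z)) ∧
      ∀ V g, IsPatch A V g → V ⊆ U ∧ ∀ z ∈ V, G z = g z := by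
  classical
  set Ps : Set (Set ℂ × (ℂ → Matrix S S ℂ)) := {q | IsPatch A q.1 q.2} with hPs
  -- An arbitrary patch is chosen at each point; `IsPatch.eq_of_mem` makes the value independent of
  -- the choice.
  set G : ℂ → Matrix S S ℂ := fun z =>
    if hz : ∃ q ∈ Ps, z ∈ q.1 then hz.choose.2 z else 0 with hG
  have key : ∀ V g, IsPatch A V g → ∀ z ∈ V, G z = g z := by
    intro V g hP z hz
    have hex : ∃ q ∈ Ps, z ∈ q.1 := ⟨(V, g), hP, hz⟩
    rw [hG]
    simp only [hex, dif_pos]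
    exact IsPatch.eq_of_mem hex.choose_spec.1 hP hlt hex.choose_spec.2 hz
  refine ⟨⋃ q ∈ Ps, q.1, G, isOpen_biUnion fun q hq => hq.isOpen, fun a b z hz => ?_,
    fun z hz => ?_, fun V g hP => ⟨fun z hz => Set.mem_biUnion (x := (V, g)) hP hz, key V g hP⟩⟩
  · obtain ⟨q, hq, hzq⟩ := Set.mem_iUnion₂.mp hz
    have hq' : IsPatch A q.1 q.2 := hq
    refine (hq'.analytic a b z hzq).congr ?_
    filter_upwards [hq'.isOpen.mem_nhds hzq] with y hy
    rw [key _ _ hq' y hy]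
  · obtain ⟨q, hq, hzq⟩ := Set.mem_iUnion₂.mp hz
    rw [key _ _ hq z hzq]
    exact hq.solves z hzq

end Extension

/-! ### The square root on the slit disc -/

section Slit
variable {S : Type*} [Fintype S] [DecidableEq S] {A : ℤ → ℤ → Matrix S S ℝ}
variable {w₀ : ℝ} {v₀ π : S → ℝ} {w : ℂ → ℂ} {v : ℂ → S → ℂ} {F : ℂ → Matrix S S ℂ}

lemma rootAt_one_sq (p z : ℂ) : rootAt 1 p z ^ 2 = p - z := by
  rw [rootAt, show (1 : ℂ) / (((1 : ℕ) : ℂ) + 1) = ((2 : ℕ) : ℂ)⁻¹ by norm_num]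
  exact Complex.cpow_nat_inv_pow _ two_ne_zero

lemma sub_rootAt_one_sq (p z : ℂ) : p - rootAt 1 p z ^ 2 = z := by
  rw [rootAt_one_sq, sub_sub_cancel]

lemma norm_rootAt_one_sq (p z : ℂ) : ‖rootAt 1 p z‖ ^ 2 = ‖z - p‖ := by
  rw [← norm_pow, rootAt_one_sq, norm_sub_rev]

lemma rootAt_one_mem_ball {p z : ℂ} {r : ℝ} (hr : 0 < r) (hz : z ∈ slitDisc p (r ^ 2)) :
    rootAt 1 p z ∈ Metric.ball (0 : ℂ) r := by
  have h := mem_ball_iff_norm.mp hz.1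
  rw [← norm_rootAt_one_sq] at h
  rw [mem_ball_zero_iff]
  exact lt_of_pow_lt_pow_left₀ 2 hr.le h

lemma analyticAt_rootAt_one {p z : ℂ} (hz : p - z ∈ Complex.slitPlane) :
    AnalyticAt ℂ (rootAt 1 p) z :=
  (analyticAt_const.sub analyticAt_id).cpow analyticAt_const hz

lemma rootAt_one_ofReal {p t : ℝ} (ht : 0 ≤ t) :
    rootAt 1 (p : ℂ) ((p - t ^ 2 : ℝ) : ℂ) = t := by
  rw [rootAt, show (1 : ℂ) / (((1 : ℕ) : ℂ) + 1) = ((2⁻¹ : ℝ) : ℂ) by norm_num,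
    show (p : ℂ) - ((p - t ^ 2 : ℝ) : ℂ) = ((t ^ 2 : ℝ) : ℂ) by push_cast; ring,
    ← Complex.ofReal_cpow (sq_nonneg t), ← one_div, ← Real.sqrt_eq_rpow, Real.sqrt_sq ht]

lemma ofReal_sub_sq_mem_slitDisc {p t r : ℝ} (ht : 0 < t) (htr : t < r) :
    ((p - t ^ 2 : ℝ) : ℂ) ∈ slitDisc (p : ℂ) (r ^ 2) := by
  have e : (p : ℂ) - ((p - t ^ 2 : ℝ) : ℂ) = ((t ^ 2 : ℝ) : ℂ) := by push_cast; ring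
  refine ⟨?_, ?_⟩
  · rw [mem_ball_iff_norm, norm_sub_rev, e, Complex.norm_real, Real.norm_eq_abs,
      abs_of_nonneg (sq_nonneg t)]
    exact pow_lt_pow_left₀ htr ht.le two_ne_zero
  · rw [e]
    exact Complex.ofReal_mem_slitPlane.mpr (by positivity)

lemma exists_eq_of_ofReal_mem_slitDisc {p x r : ℝ} (hr : 0 < r)
    (hx : (x : ℂ) ∈ slitDisc (p : ℂ) (r ^ 2)) : ∃ t, 0 < t ∧ t < r ∧ x = p - t ^ 2 := by
  have h2 := hx.2
  rw [← Complex.ofReal_sub, Complex.ofReal_mem_slitPlane] at h2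
  have h1 := mem_ball_iff_norm.mp hx.1
  rw [← Complex.ofReal_sub, Complex.norm_real, Real.norm_eq_abs, abs_sub_comm, abs_of_pos h2] at h1
  refine ⟨Real.sqrt (p - x), Real.sqrt_pos.mpr h2, ?_, ?_⟩
  · exact (Real.sqrt_lt' hr).mpr h1
  · rw [Real.sq_sqrt h2.le]; ring

lemma isOpen_slitDisc (p : ℂ) (δ : ℝ) : IsOpen (slitDisc p δ) :=
  Metric.isOpen_ball.inter (Complex.isOpen_slitPlane.preimage (continuous_const.sub continuous_id))

/-- The set is star-shaped about a real point to the left of `p`. -/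
lemma isPreconnected_slitDisc (p : ℂ) {δ : ℝ} (hδ : 0 < δ) : IsPreconnected (slitDisc p δ) := by
  have hmem : p - ((δ / 2 : ℝ) : ℂ) ∈ slitDisc p δ := by
    refine ⟨?_, ?_⟩
    · rw [mem_ball_iff_norm]
      simp only [sub_sub_cancel_left, norm_neg, Complex.norm_real, Real.norm_eq_abs]
      rw [abs_of_pos (half_pos hδ)]
      exact half_lt_self hδ
    · rw [sub_sub_cancel]
      exact Complex.ofReal_mem_slitPlane.mpr (half_pos hδ)
  have hs : StarConvex ℝ (p - ((δ / 2 : ℝ) : ℂ)) (slitDisc p δ) := by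
    intro z hz a b ha hb hab
    refine ⟨(convex_ball p δ) hmem.1 hz.1 ha hb hab, ?_⟩
    have e : p - (a • (p - ((δ / 2 : ℝ) : ℂ)) + b • z) = ((a * (δ / 2) : ℝ) : ℂ) + b • (p - z) := by
      have : (a : ℂ) + b = 1 := by exact_mod_cast hab
      simp only [Complex.real_smul]
      push_cast
      linear_combination (-p) * this
    rw [e, Complex.mem_slitPlane_iff]
    rcases hb.eq_or_lt with rfl | hb'
    · left
      have : a = 1 := by linarith
      simp [this, hδ]
    · rcases Complex.mem_slitPlane_iff.mp hz.2 with h | h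
      · left
        have h1 := mul_pos hb' h
        have h2 := mul_nonneg ha (half_pos hδ).le
        simp only [Complex.add_re, Complex.ofReal_re, Complex.real_smul, Complex.re_ofReal_mul]
        linarith
      · right
        simp only [Complex.add_im, Complex.ofReal_im, Complex.real_smul, Complex.im_ofReal_mul,
          zero_add]
        exact mul_ne_zero hb'.ne' h
  exact (hs.isPathConnected hmem).isConnected.isPreconnected

/-- Analytic functions which agree at the real points to the left of `p` agree near them. -/
lemma frequently_of_real {p t r : ℝ} (ht : 0 < t) (htr : t < r) {P : ℂ → Prop}
    (h : ∀ s : ℝ, 0 < s → s < r → P ((p - s ^ 2 : ℝ) : ℂ)) :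
    ∃ᶠ z in 𝓝[≠] ((p - t ^ 2 : ℝ) : ℂ), P z := by
  have hlim : Filter.Tendsto (fun s : ℝ => ((p - s ^ 2 : ℝ) : ℂ)) (𝓝[>] t)
      (𝓝[≠] ((p - t ^ 2 : ℝ) : ℂ)) := by
    refine tendsto_nhdsWithin_iff.mpr ⟨?_, ?_⟩
    · exact (Continuous.tendsto (by fun_prop) t).mono_left nhdsWithin_le_nhds
    · filter_upwards [self_mem_nhdsWithin] with s hs heq
      have hs : t < s := hs
      have h1 : p - s ^ 2 = p - t ^ 2 := Complex.ofReal_injective heq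
      nlinarith
  refine hlim.frequently (Filter.Eventually.frequently ?_)
  filter_upwards [self_mem_nhdsWithin, nhdsWithin_le_nhds (gt_mem_nhds htr)] with s hs hsr
  exact h s (ht.trans hs) hsr

lemma isPatch_slitDisc [Nonempty S] (hA : ∀ i ∈ H, ∀ j ∈ H, ∀ a b : S, 0 ≤ A i j a b)
    (hstoch : ∀ a : S, ∑ b : S, total A a b = 1)
    (hirr : ChainIrreducible (transition A)) {r : ℝ} (hr : 0 < r) (hrp : r ^ 2 ≤ zBar A - zLow A)
    (hF : ∀ a b, AnalyticOnNhd ℂ (fun ζ => F ζ a b) (Metric.ball 0 r))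
    (hsol : ∀ ζ ∈ Metric.ball (0 : ℂ) r, SolvesQuadratic A (zBar A - ζ ^ 2) (F ζ))
    (hreal : ∀ t : ℝ, 0 < t → t < r → F t = G1 A ((zBar A - t ^ 2 : ℝ) : ℂ)) :
    IsPatch A (slitDisc (zBar A) (r ^ 2)) (fun z => F (rootAt 1 (zBar A) z)) := by
  have hp := zBar_pos A
  have hpn : ‖(zBar A : ℂ)‖ = zBar A := by
    rw [Complex.norm_real, Real.norm_eq_abs, abs_of_pos hp]
  have han : ∀ a b, AnalyticOnNhd ℂ (fun z => F (rootAt 1 (zBar A) z) a b)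
      (slitDisc (zBar A) (r ^ 2)) := fun a b z hz =>
    (hF a b _ (rootAt_one_mem_ball hr hz)).comp (analyticAt_rootAt_one hz.2)
  have hinner : ∀ z ∈ slitDisc (zBar A : ℂ) (r ^ 2), zLow A < ‖z‖ := by
    intro z hz
    have h1 := mem_ball_iff_norm.mp hz.1
    have h2 := norm_sub_norm_le (zBar A : ℂ) z
    rw [hpn, norm_sub_rev] at h2
    linarith
  -- This convex lens contains all points where agreement with `G₁` is required, and the identity
  -- theorem carries it there from the real points.
  have hconv : IsPreconnected (Metric.ball (zBar A : ℂ) (r ^ 2) ∩ Metric.ball 0 (zBar A)) :=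
    ((convex_ball _ _).inter (convex_ball _ _)).isPreconnected
  have hsub : Metric.ball (zBar A : ℂ) (r ^ 2) ∩ Metric.ball 0 (zBar A)
      ⊆ slitDisc (zBar A : ℂ) (r ^ 2) := by
    rintro z ⟨h1, h2⟩
    refine ⟨h1, Or.inl ?_⟩
    have := (Complex.re_le_norm z).trans_lt (mem_ball_zero_iff.mp h2)
    simp [this]
  have hsub' : Metric.ball (zBar A : ℂ) (r ^ 2) ∩ Metric.ball 0 (zBar A) ⊆ annulus A :=
    fun z hz => ⟨hinner z (hsub hz), mem_ball_zero_iff.mp hz.2⟩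
  refine ⟨isOpen_slitDisc _ _, han, fun z hz => ?_, fun z hz ha => ?_, hinner,
    fun z hz s h1 h2 => ⟨radial_mem_ball hpn hp hz.1 h1 h2, ?_⟩⟩
  · have := hsol _ (rootAt_one_mem_ball hr hz)
    rwa [sub_rootAt_one_sq] at this
  · ext a b
    have hr2 : 0 < r / 2 ∧ r / 2 < r := ⟨half_pos hr, half_lt_self hr⟩
    have hm := ofReal_sub_sq_mem_slitDisc (p := zBar A) hr2.1 hr2.2
    have hx0 : 0 < zBar A - (r / 2) ^ 2 := by
      have := zLow_pos A
      nlinarith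
    have hm' : ((zBar A - (r / 2) ^ 2 : ℝ) : ℂ)
        ∈ Metric.ball (zBar A : ℂ) (r ^ 2) ∩ Metric.ball 0 (zBar A) := by
      refine ⟨hm.1, ?_⟩
      rw [mem_ball_zero_iff, Complex.norm_real, Real.norm_eq_abs, abs_of_pos hx0]
      have := pow_pos hr2.1 2
      linarith
    refine ((han a b).mono hsub).eqOn_of_preconnected_of_frequently_eq
      ((G1_analyticOnNhd hA hstoch hirr a b).mono hsub') hconv hm'
      (frequently_of_real hr2.1 hr2.2 fun s hs hsr => ?_) ⟨hz.1, mem_ball_zero_iff.mpr ha.2⟩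
    rw [rootAt_one_ofReal hs.le, hreal s hs hsr]
  · have hn : 0 < ‖z‖ := hp.trans_le (h1.trans h2)
    have ht0 : 0 < s / ‖z‖ := div_pos (hp.trans_le h1) hn
    rw [Complex.mem_slitPlane_iff]
    -- A nonreal point stays nonreal under scaling. A real point off the slit with modulus at least
    -- `zBar` is negative and remains to the left of `zBar`.
    by_cases him : z.im = 0
    · left
      rcases Complex.mem_slitPlane_iff.mp hz.2 with h | h
      · have hre : z.re < zBar A := by simpa using h
        have habs : |z.re| = ‖z‖ := by
          conv_rhs => rw [show z = (z.re : ℂ) from Complex.ext rfl (by simp [him])]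
          rw [Complex.norm_real, Real.norm_eq_abs]
        have hneg : z.re < 0 := by
          by_contra hcon
          rw [abs_of_nonneg (not_lt.mp hcon)] at habs
          linarith
        rw [Complex.sub_re, Complex.ofReal_re, Complex.re_ofReal_mul]
        nlinarith [mul_pos_of_neg_of_neg hneg (neg_lt_zero.mpr ht0)]
      · simp [him] at h
    · right
      rw [Complex.sub_im, Complex.ofReal_im, Complex.im_ofReal_mul, zero_sub]
      exact neg_ne_zero.mpr (mul_ne_zero ht0.ne' him)

lemma tendsto_rootAt_one (p : ℂ) : Filter.Tendsto (rootAt 1 p) (𝓝 p) (𝓝 0) := by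
  rw [tendsto_zero_iff_norm_tendsto_zero]
  have e : (fun z => ‖rootAt 1 p z‖) = fun z => Real.sqrt ‖z - p‖ := by
    ext z
    rw [← norm_rootAt_one_sq, Real.sqrt_sq (norm_nonneg _)]
  rw [e]
  exact Continuous.tendsto' (by fun_prop) _ _ (by simp)

/-- A radius on which all local statements hold. -/
lemma exists_radius [Nonempty S] (hA : ∀ i ∈ H, ∀ j ∈ H, ∀ a b : S, 0 ≤ A i j a b)
    (hstoch : ∀ a : S, ∑ b : S, total A a b = 1)
    (hirr : ChainIrreducible (transition A)) (hlt : zLow A < zBar A)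
    (h : IsBranchPair A w₀ v₀ π w v) (hF : IsSolutionBranch A w v F) :
    ∃ r > 0, r ^ 2 ≤ zBar A - zLow A ∧
      (∀ a b, AnalyticOnNhd ℂ (fun ζ => F ζ a b) (Metric.ball 0 r)) ∧
      AnalyticOnNhd ℂ w (Metric.ball 0 r) ∧
      (∀ ζ ∈ Metric.ball (0 : ℂ) r, SolvesQuadratic A (zBar A - ζ ^ 2) (F ζ) ∧
        (∃ u x, u ≠ 0 ∧ u ᵥ* F ζ = w ζ • u ∧
          Lmat A (zBar A - ζ ^ 2) (w (-ζ)) *ᵥ x = 0 ∧ u ⬝ᵥ x = 1) ∧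
        ∀ u x, u ᵥ* F ζ = w ζ • u → Lmat A (zBar A - ζ ^ 2) (w (-ζ)) *ᵥ x = 0 → u ⬝ᵥ x = 1 →
          F ζ + (w (-ζ) • (1 : Matrix S S ℂ) - F ζ) * Matrix.vecMulVec x u = F (-ζ)) ∧
      ∀ t : ℝ, 0 < t → t < r → F t = G1 A ((zBar A - t ^ 2 : ℝ) : ℂ) ∧ F (-t) ≠ F t ∧
        w t = zetaLow A (zBar A - t ^ 2) ∧ w (-t) = zetaHigh A (zBar A - t ^ 2) := by
  have h1 : ∀ᶠ ζ in 𝓝 (0 : ℂ), ∀ a b, AnalyticAt ℂ (fun ζ => F ζ a b) ζ :=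
    Filter.eventually_all.mpr fun a => Filter.eventually_all.mpr fun b =>
      (hF.analytic a b).eventually_analyticAt
  obtain ⟨r₁, hr₁, hb⟩ := Metric.eventually_nhds_iff_ball.mp
    (((h1.and h.an_w.eventually_analyticAt).and hF.solves).and
      ((hF.eventually_exists_eigenvectors hA hstoch hirr hlt h).and
        (hF.eventually_companion hA hstoch hirr hlt h)))
  obtain ⟨r₂, hr₂, ht⟩ := mem_nhdsGT_iff_exists_Ioo_subset.mp
    (((hF.eventually_eq_G1 hA hstoch hirr hlt h).and (hF.eventually_ne hA hstoch hirr hlt h)).and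
      (h.eventually_pos hA hstoch hirr hlt))
  have hr₂ : 0 < r₂ := hr₂
  have hs : 0 < Real.sqrt (zBar A - zLow A) := Real.sqrt_pos.mpr (sub_pos.mpr hlt)
  -- The last term keeps the disc of radius `r ^ 2` outside the circle `|z| = zLow`.
  refine ⟨min (min r₁ r₂) (Real.sqrt (zBar A - zLow A)), lt_min (lt_min hr₁ hr₂) hs, ?_, ?_, ?_, ?_, ?_⟩
  · calc _ ≤ Real.sqrt (zBar A - zLow A) ^ 2 :=
          pow_le_pow_left₀ (lt_min (lt_min hr₁ hr₂) hs).le (min_le_right _ _) 2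
      _ = _ := Real.sq_sqrt (sub_pos.mpr hlt).le
  all_goals
    have hsub : Metric.ball (0 : ℂ) (min (min r₁ r₂) (Real.sqrt (zBar A - zLow A)))
        ⊆ Metric.ball 0 r₁ :=
      Metric.ball_subset_ball ((min_le_left _ _).trans (min_le_left _ _))
  · exact fun a b ζ hζ => (hb ζ (hsub hζ)).1.1.1 a b
  · exact fun ζ hζ => (hb ζ (hsub hζ)).1.1.2
  · exact fun ζ hζ => ⟨(hb ζ (hsub hζ)).1.2, (hb ζ (hsub hζ)).2⟩
  · intro t ht0 htr
    have := ht ⟨ht0, htr.trans_le ((min_le_left _ _).trans (min_le_right _ _))⟩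
    exact ⟨this.1.1, this.1.2, this.2.1, this.2.2.1⟩

end Slit

end QBD

end


/-! ### Assembly of the extension, the branch point and the companion -/

theorem lemma4p6 {S : Type*} [Fintype S] [DecidableEq S] [Nonempty S]
    (A : ℤ → ℤ → Matrix S S ℝ)
    (hnonneg : ∀ i ∈ QBD.H, ∀ j ∈ QBD.H, ∀ a b : S, 0 ≤ A i j a b)
    (hstoch : ∀ a : S, ∑ b : S, QBD.total A a b = 1)
    (hirr : QBD.ChainIrreducible (QBD.transition A))
    (haper : QBD.ChainAperiodic (QBD.transition A))
    (hdist : ∃ z₀ : ℂ, QBD.zLow A < ‖z₀‖ ∧ ‖z₀‖ ≤ QBD.zBar A ∧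
      (QBD.G1 A z₀).charpoly.roots.Nodup) :
    ∃ (U : Set ℂ) (G : ℂ → Matrix S S ℂ) (r : ℝ) (F : ℂ → Matrix S S ℂ),
      -- `G` is an analytic extension of `G₁` to an open set `U` which contains the open annulus,
      -- the circle `|z| = zBar` without the point `zBar`, and a slit disc around `zBar`
      IsOpen U ∧
      {z : ℂ | QBD.zLow A < ‖z‖ ∧ ‖z‖ ≤ QBD.zBar A ∧ z ≠ (QBD.zBar A : ℂ)} ⊆ U ∧
      QBD.slitDisc (QBD.zBar A) (r ^ 2) ⊆ U ∧
      (∀ a b : S, AnalyticOnNhd ℂ (fun z => G z a b) U) ∧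
      (∀ z : ℂ, QBD.zLow A < ‖z‖ → ‖z‖ ≤ QBD.zBar A → z ≠ (QBD.zBar A : ℂ) →
        G z = QBD.G1 A z) ∧
      (∀ z ∈ U, QBD.SolvesQuadratic A z (G z)) ∧
      -- `zBar` is a branch point of order one
      QBD.IsBranchPoint 1 G (QBD.zBar A) r F ∧
      F 0 = QBD.G1 A (QBD.zBar A) ∧
      -- the companion exists, solves the same equation, is the other branch, and coalesces
      (∃ Gco : ℂ → Matrix S S ℂ, QBD.IsCompanion A (r ^ 2) G Gco) ∧
      ∀ Gco : ℂ → Matrix S S ℂ, QBD.IsCompanion A (r ^ 2) G Gco →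
        (∀ z ∈ QBD.slitDisc (QBD.zBar A) (r ^ 2), QBD.SolvesQuadratic A z (Gco z)) ∧
        (∀ z ∈ QBD.slitDisc (QBD.zBar A) (r ^ 2),
          Gco z = F (-QBD.rootAt 1 (QBD.zBar A) z)) ∧
        Filter.Tendsto G
          (nhdsWithin (QBD.zBar A : ℂ) (QBD.slitDisc (QBD.zBar A) (r ^ 2)))
          (nhds (QBD.G1 A (QBD.zBar A))) ∧
        Filter.Tendsto Gco
          (nhdsWithin (QBD.zBar A : ℂ) (QBD.slitDisc (QBD.zBar A) (r ^ 2)))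
          (nhds (QBD.G1 A (QBD.zBar A))) := by
  open QBD in
  have hlt : zLow A < zBar A := by
    obtain ⟨z₀, h1, h2, -⟩ := hdist
    exact h1.trans_le h2
  obtain ⟨w₀, v₀, π, w, v, h⟩ := exists_branches hnonneg hstoch hirr hlt
  obtain ⟨F, hF⟩ := exists_solutionBranch hnonneg hstoch hirr hlt h
  obtain ⟨r, hr, hrp, hFan, hwan, hball, hreal⟩ := exists_radius hnonneg hstoch hirr hlt h hF
  obtain ⟨U, G, hUo, hGan, hGsol, hpatch⟩ := exists_glued (A := A) hlt
  have hr2 : 0 < r ^ 2 := pow_pos hr 2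
  have hp := zBar_pos A
  obtain ⟨hDU, hGD⟩ := hpatch _ _ (isPatch_slitDisc hnonneg hstoch hirr hr hrp hFan
    (fun ζ hζ => (hball ζ hζ).1) fun t h0 h1 => (hreal t h0 h1).1)
  have hclosed : ∀ z : ℂ, zLow A < ‖z‖ → ‖z‖ ≤ zBar A → z ≠ (zBar A : ℂ) →
      z ∈ U ∧ G z = G1 A z := by
    intro z h1 h2 hne
    rcases h2.lt_or_eq with h2 | h2
    · obtain ⟨ha, hb⟩ := hpatch _ _ (isPatch_annulus hnonneg hstoch hirr)
      exact ⟨ha ⟨h1, h2⟩, hb z ⟨h1, h2⟩⟩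
    · obtain ⟨V, g, hV, hzV, hg⟩ := exists_isPatch_of_norm_eq hnonneg hstoch hirr hlt h h2 hne
      obtain ⟨ha, hb⟩ := hpatch V g hV
      exact ⟨ha hzV, (hb z hzV).trans hg⟩
  have hF0 : F 0 = G1 A (zBar A) := by
    rw [hF.zero, G1_ofReal hnonneg hstoch hirr hlt.le le_rfl]
    rfl
  have hroot : ∀ z ∈ slitDisc (zBar A : ℂ) (r ^ 2), rootAt 1 (zBar A : ℂ) z ∈ Metric.ball (0 : ℂ) r :=
    fun z hz => rootAt_one_mem_ball hr hz
  have hnroot : ∀ z ∈ slitDisc (zBar A : ℂ) (r ^ 2),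
      -rootAt 1 (zBar A : ℂ) z ∈ Metric.ball (0 : ℂ) r := fun z hz => by
    simpa using hroot z hz
  have hα : AnalyticOnNhd ℂ (fun z => w (rootAt 1 (zBar A : ℂ) z)) (slitDisc (zBar A) (r ^ 2)) :=
    fun z hz => (hwan _ (hroot z hz)).comp (analyticAt_rootAt_one hz.2)
  have hβ : AnalyticOnNhd ℂ (fun z => w (-rootAt 1 (zBar A : ℂ) z)) (slitDisc (zBar A) (r ^ 2)) :=
    fun z hz => AnalyticAt.comp (f := fun z => -rootAt 1 (zBar A : ℂ) z) (hwan _ (hnroot z hz))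
      (analyticAt_rootAt_one hz.2).neg
  have hlim : ∀ f : ℂ → ℂ, Filter.Tendsto f (nhds 0) (nhds 0) →
      Filter.Tendsto (fun z => F (f (rootAt 1 (zBar A : ℂ) z)))
        (nhdsWithin (zBar A : ℂ) (slitDisc (zBar A) (r ^ 2))) (nhds (G1 A (zBar A))) := by
    intro f hf
    rw [← hF0]
    refine tendsto_pi_nhds.mpr fun a => tendsto_pi_nhds.mpr fun b => ?_
    exact ((hF.analytic a b).continuousAt.tendsto.comp (hf.comp (tendsto_rootAt_one _))).mono_left
      nhdsWithin_le_nhds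
  refine ⟨U, G, r, F, hUo, fun z hz => (hclosed z hz.1 hz.2.1 hz.2.2).1, hDU, hGan,
    fun z h1 h2 h3 => (hclosed z h1 h2 h3).2, hGsol, ?_, hF0, ?_, ?_⟩
  · refine ⟨le_rfl, hr, hFan, hGD, fun ω h1 h2 => ?_⟩
    have hω : ω = -1 := by
      have : (ω - 1) * (ω + 1) = 0 := by linear_combination h1
      exact eq_neg_of_add_eq_zero_left ((mul_eq_zero.mp this).resolve_left (sub_ne_zero.mpr h2))
    refine ⟨((r / 2 : ℝ) : ℂ), ?_, ?_⟩
    · rw [mem_ball_zero_iff, Complex.norm_real, Real.norm_eq_abs, abs_of_pos (half_pos hr)]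
      exact half_lt_self hr
    · rw [hω, neg_one_mul]
      exact (hreal _ (half_pos hr) (half_lt_self hr)).2.1
  -- No regularity of the eigenvectors in `z` is needed, so they are chosen pointwise.
  · choose! u x hu0 hu hx hux using fun z hz => (hball _ (hroot z hz)).2.1
    refine ⟨_, _, _, u, x, hα, hβ, fun y hy hy' => ?_, fun z hz => ⟨hu0 z hz, ?_, ?_, hux z hz, rfl⟩⟩
    · obtain ⟨t, ht0, htr, rfl⟩ := exists_eq_of_ofReal_mem_slitDisc hr hy
      rw [rootAt_one_ofReal ht0.le]
      exact (hreal t ht0 htr).2.2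
    · rw [hGD z hz]; exact hu z hz
    · have := hx z hz
      rwa [sub_rootAt_one_sq] at this
  · rintro Gco ⟨α, β, u, x, hα', hβ', hab, hco⟩
    have hh : 0 < r / 2 ∧ r / 2 < r := ⟨half_pos hr, half_lt_self hr⟩
    have hxlow : ∀ s : ℝ, 0 < s → s < r → zLow A < zBar A - s ^ 2 := by
      intro s h0 h1
      nlinarith
    -- The identity theorem on the connected slit disc leaves only one candidate for `α`, and
    -- likewise for `β`, so every companion has these eigenvalues.
    have hαeq : Set.EqOn α (fun z => w (rootAt 1 (zBar A : ℂ) z)) (slitDisc (zBar A) (r ^ 2)) :=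
      hα'.eqOn_of_preconnected_of_frequently_eq hα (isPreconnected_slitDisc _ hr2)
        (ofReal_sub_sq_mem_slitDisc hh.1 hh.2) (frequently_of_real hh.1 hh.2 fun s h0 h1 => by
          rw [rootAt_one_ofReal h0.le, (hreal s h0 h1).2.2.1]
          exact (hab _ (ofReal_sub_sq_mem_slitDisc h0 h1) (hxlow s h0 h1)).1)
    have hβeq : Set.EqOn β (fun z => w (-rootAt 1 (zBar A : ℂ) z)) (slitDisc (zBar A) (r ^ 2)) :=
      hβ'.eqOn_of_preconnected_of_frequently_eq hβ (isPreconnected_slitDisc _ hr2)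
        (ofReal_sub_sq_mem_slitDisc hh.1 hh.2) (frequently_of_real hh.1 hh.2 fun s h0 h1 => by
          rw [rootAt_one_ofReal h0.le, (hreal s h0 h1).2.2.2]
          exact (hab _ (ofReal_sub_sq_mem_slitDisc h0 h1) (hxlow s h0 h1)).2)
    have hGco : ∀ z ∈ slitDisc (zBar A : ℂ) (r ^ 2), Gco z = F (-rootAt 1 (zBar A : ℂ) z) := by
      intro z hz
      obtain ⟨-, e1, e2, e3, e4⟩ := hco z hz
      rw [hGD z hz, hαeq hz] at e1
      rw [hβeq hz] at e2
      rw [e4, hGD z hz, hβeq hz]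
      refine (hball _ (hroot z hz)).2.2 _ _ e1 ?_ e3
      rw [sub_rootAt_one_sq]
      exact e2
    refine ⟨fun z hz => ?_, hGco, ?_, ?_⟩
    · have := (hball _ (hnroot z hz)).1
      rwa [neg_sq, sub_rootAt_one_sq, ← hGco z hz] at this
    · refine (hlim id Filter.tendsto_id).congr' ?_
      filter_upwards [self_mem_nhdsWithin] with z hz
      rw [hGD z hz, id]
    · refine (hlim _ tendsto_neg_zero).congr' ?_
      filter_upwards [self_mem_nhdsWithin] with z hz
      rw [hGco z hz]
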